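/- Let $X$ be a smooth complex algebraic variety (a smooth separated scheme of finite type over $\mathbb{C}$) with the Zariski topology, let $\mathbb{C}^\hbar=\mathbb{C}[[\hbar]]$, and let $\mathcal{A}_X$ be a DQ-algebroid on $X$: a $\mathbb{C}^\hbar$-linear stack on $X$ which is locally non-empty, in which any two objects over the same open set are locally isomorphic, and such that for every open $U$ and every $\sigma\in\mathcal{A}_X(U)$ the sheaf of $\mathbb{C}^\hbar$-algebras $\mathcal{E}nd(\sigma)$ is locally isomorphic to a star algebra $(\mathcal{O}_X[[\hbar]],\star)$. (That is, $\star$ is an associative $\mathbb{C}^\hbar$-bilinear product with $f\star g=\sum_{i\ge 0}P_i(f,g)\hbar^i$ for $f,g\in\mathcal{O}_X$, where the $P_i$ are $\mathbb{C}$-bilinear bidifferential operators, $P_0(f,g)=fg$, and $P_i(f,1)=P_i(1,f)=0$ for $i>0$.) An $\mathcal{A}_X$-module is a $\mathbb{C}^\hbar$-linear functor of stacks from $\mathcal{A}_X$ to sheaves of $\mathbb{C}^\hbar$-modules; $\mathsf{D}(\mathcal{A}_X)$ is the unbounded derived category of the abelian category of $\mathcal{A}_X$-modules. Let $\mathcal{A}_X^{loc}=\mathbb{C}((\hbar))\otimes_{\mathbb{C}^\hbar}\mathcal{A}_X$.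 An object $\mathcal{M}\in\mathsf{D}(\mathcal{A}_X)$ is cohomologically complete if $\mathrm{R}\mathcal{H}om_{\mathcal{A}_X}(\mathcal{A}_X^{loc},\mathcal{M})\simeq 0$. Let $\mathrm{gr}_\hbar:\mathsf{D}(\mathcal{A}_X)\to\mathsf{D}(\mathcal{A}_X/\hbar\mathcal{A}_X)$ be the left derived functor of $\mathcal{M}\mapsto\mathcal{M}/\hbar\mathcal{M}$, where $(\mathcal{A}_X/\hbar\mathcal{A}_X)$-modules are the $\mathcal{A}_X$-modules annihilated by $\hbar$; given an additive equivalence $e:\mathrm{Mod}(\mathcal{A}_X/\hbar\mathcal{A}_X)\simeq\mathrm{Mod}(\mathcal{O}_X)$, it may also be viewed as the left derived functor $\mathsf{D}(\mathcal{A}_X)\to\mathsf{D}(\mathcal{O}_X)$ of $\mathcal{M}\mapsto e(\mathcal{M}/\hbar\mathcal{M})$. Then these left derived functors exist, and the following holds. Let $\mathcal{M}\in\mathsf{D}(\mathcal{A}_X)$ be cohomologically complete. If $\mathrm{gr}_\hbar\mathcal{M}$ is bounded, i.e. belongs to $\mathsf{D}^b(\mathcal{A}_X/\hbar\mathcal{A}_X)$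 (respectively, for some equivalence $e$ as above, to $\mathsf{D}^b(\mathcal{O}_X)$), then $\mathcal{M}$ is bounded: $\mathcal{M}\in\mathsf{D}^b(\mathcal{A}_X)$, so that $\mathcal{M}$ is a bounded cohomologically complete object. -/

import Mathlib

open CategoryTheory AlgebraicGeometry Opposite Limits Bicategory

universe w

noncomputable section

namespace DQ

/-- The ring `ℂ[[ħ]]` of formal power series. -/
abbrev Ch : Type := PowerSeries ℂ

/-- The formal parameter `ħ`. -/
abbrev hbar : Ch := PowerSeries.X

/-- A `ℂ[[ħ]]`-linear structure on a prestack (a pseudofunctor `Cᵒᵖ → Cat`): every fibre category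
is `ℂ[[ħ]]`-linear and every restriction functor is `ℂ[[ħ]]`-linear. -/
class LinearPrestack {C : Type} [SmallCategory C]
    (A : LocallyDiscrete Cᵒᵖ ⥤ᵖ Cat.{0, 0}) where
  preadditive (S : Cᵒᵖ) : Preadditive (A.obj ⟨S⟩)
  linear (S : Cᵒᵖ) : Linear Ch (A.obj ⟨S⟩)
  map_add {S T : Cᵒᵖ} (f : S ⟶ T) {x y : A.obj ⟨S⟩} (φ ψ : x ⟶ y) :
    (A.map f.toLoc).toFunctor.map (φ + ψ) =
      (A.map f.toLoc).toFunctor.map φ + (A.map f.toLoc).toFunctor.map ψ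
  map_smul {S T : Cᵒᵖ} (f : S ⟶ T) {x y : A.obj ⟨S⟩} (c : Ch) (φ : x ⟶ y) :
    (A.map f.toLoc).toFunctor.map (c • φ) = c • (A.map f.toLoc).toFunctor.map φ

attribute [reducible, instance] LinearPrestack.preadditive LinearPrestack.linear

section Total

variable {C : Type} [SmallCategory C] (A : LocallyDiscrete Cᵒᵖ ⥤ᵖ Cat.{0, 0})

/-- The total category of a prestack: objects are pairs `(U, σ)` with `σ ∈ A(U)`, and a morphism
`(U, σ) ⟶ (V, τ)` is a morphism `V ⟶ U` of the base together with a morphism `σ|_V ⟶ τ`. -/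
abbrev Tot : Type := Pseudofunctor.Grothendieck A

variable {A}

/-- The morphism of the total category given by a base morphism and a morphism in the fibre. -/
abbrev homMk {a b : Tot A} (f : a.base ⟶ b.base)
    (φ : (A.map f.toLoc).toFunctor.obj a.fiber ⟶ b.fiber) : a ⟶ b :=
  ⟨f, φ⟩

/-- The restriction of `a = (U, σ)` along `V ⟶ U`. -/
abbrev res (a : Tot A) {S : Cᵒᵖ} (f : a.base ⟶ S) : Tot A :=
  ⟨S, (A.map f.toLoc).toFunctor.obj a.fiber⟩

/-- The restriction morphism `(U, σ) ⟶ (V, σ|_V)`. -/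
def toRes (a : Tot A) {S : Cᵒᵖ} (f : a.base ⟶ S) : a ⟶ res a f :=
  homMk (b := res a f) f (𝟙 _)

lemma homMk_ext {a b : Tot A} {f g : a.base ⟶ b.base} (h : f = g)
    (φ : (A.map f.toLoc).toFunctor.obj a.fiber ⟶ b.fiber)
    (ψ : (A.map g.toLoc).toFunctor.obj a.fiber ⟶ b.fiber)
    (hφ : eqToHom (by rw [h]) ≫ φ = ψ) : homMk f φ = homMk g ψ := by
  subst h; subst hφ; simp

lemma homMk_comp {a b c : Tot A} (f : a.base ⟶ b.base) (g : b.base ⟶ c.base)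
    (φ : (A.map f.toLoc).toFunctor.obj a.fiber ⟶ b.fiber)
    (ψ : (A.map g.toLoc).toFunctor.obj b.fiber ⟶ c.fiber) :
    homMk f φ ≫ homMk g ψ = homMk (f ≫ g) ((A.mapComp f.toLoc g.toLoc).hom.toNatTrans.app a.fiber ≫
      (A.map g.toLoc).toFunctor.map φ ≫ ψ) := rfl

lemma comp_aux₁ {D : Type} [SmallCategory D] {x₀ x₁ x₂ x₃ y : D} (e : x₀ ⟶ x₁) (m : x₁ ⟶ x₂)
    (k : x₂ ⟶ x₃) (i : x₃ ⟶ x₀) (φ : x₀ ⟶ y) (h : e ≫ m ≫ k ≫ i = 𝟙 x₀) :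
    e ≫ m ≫ k ≫ i ≫ φ = φ := by
  simpa using congrArg (· ≫ φ) h

lemma comp_aux₃ {D : Type} [SmallCategory D] {x y z : D} (e : x ⟶ y) (k : y ⟶ z) :
    e ≫ k ≫ 𝟙 z = e ≫ k := by
  rw [Category.comp_id]

lemma comp_aux₂ {D : Type} [SmallCategory D] {x y : D} (e : x ⟶ y) (k : y ⟶ y)
    (i : y ⟶ x) (hk : k = 𝟙 y) (h : e ≫ i = 𝟙 x) : e ≫ k ≫ i = 𝟙 x := by
  rw [hk, Category.id_comp, h]

/-- The vertical morphism of the total category out of a restriction of `a`, given by a morphism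
in the fibre. -/
def vert {a b : Tot A} {f : a.base ⟶ b.base}
    (φ : (A.map f.toLoc).toFunctor.obj a.fiber ⟶ b.fiber) : res a f ⟶ b :=
  homMk (a := res a f) (𝟙 b.base) ((A.mapId ⟨b.base⟩).hom.toNatTrans.app _ ≫ φ)

lemma toRes_vert {a b : Tot A} {f : a.base ⟶ b.base}
    (φ : (A.map f.toLoc).toFunctor.obj a.fiber ⟶ b.fiber) :
    toRes a f ≫ vert φ = homMk f φ := by
  have key : toRes a f ≫ homMk (a := res a f) (b := res a f) (𝟙 b.base)
      ((A.mapId ⟨b.base⟩).hom.toNatTrans.app _) = toRes a f := Category.comp_id (toRes a f)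
  refine Pseudofunctor.Grothendieck.Hom.ext _ _ (Category.comp_id f) ?_
  change _ ≫ (A.mapComp f.toLoc (𝟙 b.base).toLoc).hom.toNatTrans.app a.fiber ≫
      (A.map (𝟙 b.base).toLoc).toFunctor.map (𝟙 _) ≫
      (A.mapId ⟨b.base⟩).hom.toNatTrans.app _ ≫ φ = φ
  obtain ⟨h4, h5⟩ := (Pseudofunctor.Grothendieck.Hom.ext_iff _ _).1 key
  change _ ≫ (A.mapComp f.toLoc (𝟙 b.base).toLoc).hom.toNatTrans.app a.fiber ≫
      (A.map (𝟙 b.base).toLoc).toFunctor.map (𝟙 _) ≫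
      (A.mapId ⟨b.base⟩).hom.toNatTrans.app _ = 𝟙 _ at h5
  exact comp_aux₁ _ _ _ _ φ h5

lemma fac (a : Tot A) {b : Tot A} (h : a ⟶ b) : toRes a h.base ≫ vert h.fiber = h :=
  toRes_vert _

lemma homMk_toRes {a b : Tot A} (f : a.base ⟶ b.base)
    (φ : (A.map f.toLoc).toFunctor.obj a.fiber ⟶ b.fiber) {S : Cᵒᵖ} (g : b.base ⟶ S) :
    homMk f φ ≫ toRes b g = toRes a (f ≫ g) ≫ vert (b := res b g)
      ((A.mapComp f.toLoc g.toLoc).hom.toNatTrans.app a.fiber ≫ (A.map g.toLoc).toFunctor.map φ) := by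
  rw [toRes_vert (b := res b g)]
  exact congrArg (homMk (b := res b g) (f ≫ g)) (comp_aux₃ _ _)

lemma toRes_toRes (a : Tot A) {S T : Cᵒᵖ} (f : a.base ⟶ S) (g : S ⟶ T) :
    toRes a f ≫ homMk (a := res a f) (b := res a (f ≫ g)) g
      ((A.mapComp f.toLoc g.toLoc).inv.toNatTrans.app a.fiber) = toRes a (f ≫ g) := by
  refine congrArg (homMk (b := res a (f ≫ g)) (f ≫ g)) ?_
  refine comp_aux₂ _ _ _ (CategoryTheory.Functor.map_id _ _) ?_
  exact congrArg (fun k => k.toNatTrans.app a.fiber) (A.mapComp f.toLoc g.toLoc).hom_inv_id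

/-- The restriction of a fibre morphism `σ|_V ⟶ τ` to a smaller object of the base. -/
def resFiber {a b : Tot A} (f : a.base ⟶ b.base) {S : Cᵒᵖ} (g : b.base ⟶ S)
    (φ : (A.map f.toLoc).toFunctor.obj a.fiber ⟶ b.fiber) :
    (A.map (𝟙 S : S ⟶ S).toLoc).toFunctor.obj (res a (f ≫ g)).fiber ⟶ (res b g).fiber :=
  (A.mapId ⟨S⟩).hom.toNatTrans.app _ ≫
    (A.mapComp f.toLoc g.toLoc).hom.toNatTrans.app a.fiber ≫ (A.map g.toLoc).toFunctor.map φ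

lemma homMk_resFiber {a b : Tot A} (f : a.base ⟶ b.base) {S : Cᵒᵖ} (g : b.base ⟶ S)
    (φ : (A.map f.toLoc).toFunctor.obj a.fiber ⟶ b.fiber) :
    homMk f φ ≫ toRes b g = toRes a (f ≫ g) ≫ homMk (𝟙 S) (resFiber f g φ) :=
  homMk_toRes f φ g

/-- The sieve of the base formed by the restrictions which belong to a sieve of the total
category. -/
def baseSieve {a : Tot A} (S : Sieve (op a)) : Sieve a.base.unop where
  arrows _ f := S (toRes a f.op).op
  downward_closed {V W f} hf g := by
    have h := S.downward_closed hf (homMk (a := res a f.op) (b := res a (g ≫ f).op) g.op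
        ((A.mapComp f.op.toLoc g.op.toLoc).inv.toNatTrans.app a.fiber)).op
    rw [← op_comp] at h
    exact (congrArg (fun k => S k.op) (toRes_toRes a f.op g.op)).mp h

lemma mem_of_baseSieve {a b : Tot A} {S : Sieve (op a)} (h : a ⟶ b)
    (hS : baseSieve S h.base.unop) : S h.op := by
  have := S.downward_closed hS (vert h.fiber).op
  rw [← op_comp] at this
  exact (congrArg (fun k => S k.op) (fac a h)).mp this

/-- The topology on the (opposite of the) total category which is induced by a topology of the
base: a sieve on `(U, σ)` is covering if the restrictions `(V, σ|_V)` that belong to it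
cover `U`. -/
def totTopology (K : GrothendieckTopology C) (A : LocallyDiscrete Cᵒᵖ ⥤ᵖ Cat.{0, 0}) :
    GrothendieckTopology (Tot A)ᵒᵖ where
  sieves a := {S | baseSieve (a := a.unop) S ∈ K _}
  top_mem' a := K.superset_covering (fun _ _ _ => trivial) (K.top_mem _)
  pullback_stable' a b S g hS := by
    refine K.superset_covering ?_ (K.pullback_stable g.unop.base.unop hS)
    intro W w hw
    change S ((toRes b.unop w.op).op ≫ g)
    have e : (toRes b.unop w.op).op ≫ g = (g.unop ≫ toRes b.unop w.op).op := rfl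
    rw [e]
    exact mem_of_baseSieve (g.unop ≫ toRes b.unop w.op) hw
  transitive' a S hS T hT := by
    refine K.transitive hS _ ?_
    intro V f hf
    have h := hT hf
    refine K.superset_covering ?_ h
    intro W w hw
    have h' := T.downward_closed (mem_of_baseSieve (homMk (a := res a.unop f.op)
      (b := res a.unop (w ≫ f).op) w.op
        ((A.mapComp f.op.toLoc w.op.toLoc).inv.toNatTrans.app a.unop.fiber)) hw) (𝟙 _)
    rw [Category.id_comp] at h'
    change T (_ ≫ _) at h'
    rw [← op_comp] at h'
    exact (congrArg (fun k => T k.op) (toRes_toRes a.unop f.op w.op)).mp h'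

lemma mem_totTopology {K : GrothendieckTopology C} {a : Tot A} (S : Sieve (op a)) :
    S ∈ totTopology K A (op a) ↔ baseSieve S ∈ K _ := Iff.rfl

end Total

section Modules

variable {C : Type} [SmallCategory C] (A : LocallyDiscrete Cᵒᵖ ⥤ᵖ Cat.{0, 0}) [LinearPrestack A]

/-- A presheaf of `ℂ[[ħ]]`-modules on the total category, `(U, σ) ↦ M(U, σ)`, is linear if its
action on the morphisms `σ|_V ⟶ τ` is `ℂ[[ħ]]`-linear. -/
structure IsLinear (M : (Tot A)ᵒᵖᵒᵖ ⥤ ModuleCat.{0} Ch) : Prop where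
  map_add {a b : Tot A} (f : a.base ⟶ b.base)
    (φ ψ : (A.map f.toLoc).toFunctor.obj a.fiber ⟶ b.fiber) (x : M.obj (op (op a))) :
    M.map (homMk f (φ + ψ)).op.op x = M.map (homMk f φ).op.op x + M.map (homMk f ψ).op.op x
  map_smul {a b : Tot A} (f : a.base ⟶ b.base) (c : Ch)
    (φ : (A.map f.toLoc).toFunctor.obj a.fiber ⟶ b.fiber) (x : M.obj (op (op a))) :
    M.map (homMk f (c • φ)).op.op x = c • M.map (homMk f φ).op.op x

variable {A}

lemma comp_add_aux {D : Type} [SmallCategory D] [Preadditive D] {w x y z : D} (e : w ⟶ x)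
    (m : x ⟶ y) (φ ψ : y ⟶ z) : e ≫ m ≫ (φ + ψ) = e ≫ m ≫ φ + e ≫ m ≫ ψ := by simp

lemma comp_smul_aux {D : Type} [SmallCategory D] [Preadditive D] [Linear Ch D] {w x y z : D}
    (e : w ⟶ x) (m : x ⟶ y) (c : Ch) (φ : y ⟶ z) : e ≫ m ≫ (c • φ) = c • (e ≫ m ≫ φ) := by simp

lemma IsLinear.of_injective {M N : (Tot A)ᵒᵖᵒᵖ ⥤ ModuleCat.{0} Ch} (i : M ⟶ N)
    (hi : ∀ a, Function.Injective (i.app a)) (hN : IsLinear A N) : IsLinear A M where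
  map_add {a b} f φ ψ x := by
    apply hi
    simp only [_root_.map_add, NatTrans.naturality_apply, hN.map_add]
  map_smul {a b} f c φ x := by
    apply hi
    simp only [_root_.map_smul, NatTrans.naturality_apply, hN.map_smul]

lemma resFiber_add {a b : Tot A} (f : a.base ⟶ b.base) {S : Cᵒᵖ} (g : b.base ⟶ S)
    (φ ψ : (A.map f.toLoc).toFunctor.obj a.fiber ⟶ b.fiber) :
    resFiber f g (φ + ψ) = resFiber f g φ + resFiber f g ψ := by
  simp only [resFiber, LinearPrestack.map_add]
  exact comp_add_aux _ _ _ _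

lemma resFiber_smul {a b : Tot A} (f : a.base ⟶ b.base) {S : Cᵒᵖ} (g : b.base ⟶ S) (c : Ch)
    (φ : (A.map f.toLoc).toFunctor.obj a.fiber ⟶ b.fiber) :
    resFiber f g (c • φ) = c • resFiber f g φ := by
  simp only [resFiber, LinearPrestack.map_smul]
  exact comp_smul_aux _ _ _ _

lemma IsLinear.of_locallySurjective (K : GrothendieckTopology C)
    {M N : (Tot A)ᵒᵖᵒᵖ ⥤ ModuleCat.{0} Ch} (p : M ⟶ N)
    [Presheaf.IsLocallySurjective (totTopology K A) p]
    (hM : IsLinear A M) (hN : Presheaf.IsSheaf (totTopology K A) N) : IsLinear A N := by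
  have key : ∀ {a b : Tot A} (f : a.base ⟶ b.base) (y : N.obj (op (op a)))
      (u v : N.obj (op (op b))),
      (∀ (S : Cᵒᵖ) (g : b.base ⟶ S) (x : M.obj (op (op (res a (f ≫ g))))),
        p.app _ x = N.map (toRes a (f ≫ g)).op.op y →
        N.map (toRes b g).op.op u = N.map (toRes b g).op.op v) → u = v := by
    intro a b f y u v h
    let T : Sieve (op b) :=
      { arrows := fun c g => N.map g.op u = N.map g.op v
        downward_closed := fun {c d g} hg k => by
          rw [op_comp, N.map_comp, ConcreteCategory.comp_apply, hg, ConcreteCategory.comp_apply] }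
    refine hN.isSeparated _ T ?_ u v fun _ _ hg => hg
    rw [mem_totTopology]
    refine K.superset_covering ?_
      (K.pullback_stable f.unop (Presheaf.imageSieve_mem (totTopology K A) p y))
    rintro W w ⟨x, hx⟩
    exact h (op W) w.op x hx
  have e : ∀ {a b : Tot A} (f : a.base ⟶ b.base) (y : N.obj (op (op a))) {S : Cᵒᵖ} (g : b.base ⟶ S)
      (φ : (A.map f.toLoc).toFunctor.obj a.fiber ⟶ b.fiber) (x : M.obj (op (op (res a (f ≫ g))))),
        p.app _ x = N.map (toRes a (f ≫ g)).op.op y →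
      N.map (toRes b g).op.op (N.map (homMk f φ).op.op y) =
        p.app _ (M.map (homMk (𝟙 S) (resFiber f g φ)).op.op x) := by
    intro a b f y S g φ x h
    rw [NatTrans.naturality_apply, h, ← ConcreteCategory.comp_apply, ← ConcreteCategory.comp_apply,
      ← N.map_comp, ← N.map_comp, ← op_comp, ← op_comp, ← op_comp, ← op_comp, homMk_resFiber]
  constructor
  · intro a b f φ ψ y
    refine key f y _ _ fun S g x h => ?_
    rw [_root_.map_add, e f y g _ x h, e f y g _ x h, e f y g _ x h, resFiber_add, hM.map_add, _root_.map_add]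
  · intro a b f c φ y
    refine key f y _ _ fun S g x h => ?_
    rw [_root_.map_smul, e f y g _ x h, e f y g _ x h, resFiber_smul, hM.map_smul, _root_.map_smul]

end Modules
section Quotient

universe v u

variable {𝓒 : Type u} [Category.{v} 𝓒] [Abelian 𝓒] (θ : 𝟭 𝓒 ⟶ 𝟭 𝓒)

/-- The objects of an abelian category on which an endomorphism `θ` of the identity functor
acts by zero. -/
def annihilated : ObjectProperty 𝓒 := fun M => θ.app M = 0

instance : (annihilated θ).IsClosedUnderSubobjects where
  prop_of_mono {X Y} f _ hY := by
    have h := θ.naturality f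
    have hY' : θ.app Y = 0 := hY
    dsimp at h
    rw [hY', comp_zero] at h
    exact zero_of_comp_mono f h.symm

instance : (annihilated θ).IsClosedUnderQuotients where
  prop_of_epi {X Y} f _ hX := by
    have h := θ.naturality f
    have hX' : θ.app X = 0 := hX
    dsimp at h
    rw [hX', zero_comp] at h
    exact zero_of_epi_comp f h

instance : (annihilated θ).ContainsZero where
  exists_zero := by
    obtain ⟨Z, hZ⟩ := HasZeroObject.zero (C := 𝓒)
    exact ⟨Z, hZ, hZ.eq_of_tgt _ _⟩

instance : (annihilated θ).IsClosedUnderFiniteProducts where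
  isClosedUnderLimitsOfShape J _ :=
    { limitsOfShape_le := by
        rintro X ⟨p⟩
        refine p.isLimit.hom_ext fun j => ?_
        have h := θ.naturality (p.π.app j)
        have hj : θ.app (p.diag.obj j) = 0 := p.prop_diag_obj j
        dsimp at h ⊢
        rw [hj, comp_zero] at h
        rw [zero_comp]
        exact h.symm }

/-- The cokernel of `θ`, as a functor. -/
def cokernelFunctor : 𝓒 ⥤ 𝓒 where
  obj M := cokernel (θ.app M)
  map {M N} f := cokernel.map (θ.app M) (θ.app N) f f (θ.naturality f).symm
  map_id M := by
    rw [← cancel_epi (cokernel.π (θ.app M))]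
    simp
  map_comp {M N P} f g := by
    rw [← cancel_epi (cokernel.π (θ.app M))]
    simp

lemma annihilated_cokernel (M : 𝓒) : annihilated θ ((cokernelFunctor θ).obj M) := by
  have h := θ.naturality (cokernel.π (θ.app M))
  have h' : cokernel.π (θ.app M) ≫ θ.app (cokernel (θ.app M)) = 0 :=
    h.trans (cokernel.condition (θ.app M))
  exact zero_of_epi_comp (cokernel.π (θ.app M)) h'

/-- The functor `M ↦ M / θM`, from an abelian category to the category of its objects that are
annihilated by `θ`. -/
def quotientFunctor : 𝓒 ⥤ (annihilated θ).FullSubcategory :=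
  (annihilated θ).lift (cokernelFunctor θ) (annihilated_cokernel θ)

instance : (cokernelFunctor θ).Additive where
  map_add {M N f g} := by
    refine (cancel_epi (cokernel.π (θ.app M))).1 ?_
    simp only [cokernelFunctor, cokernel.map, cokernel.π_desc, Preadditive.add_comp]
    exact (congrArg₂ (· + ·) (cokernel.π_desc ..) (cokernel.π_desc ..)).symm.trans
      (Preadditive.comp_add ..).symm

instance : (quotientFunctor θ).Additive where
  map_add {_ _ f g} := ObjectProperty.hom_ext _ ((cokernelFunctor θ).map_add (f := f) (g := g))

end Quotient

section LinearSheaves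

variable {C : Type} [SmallCategory C] (K : GrothendieckTopology C)
  (A : LocallyDiscrete Cᵒᵖ ⥤ᵖ Cat.{0, 0})

lemma injective_of_mono {M N : Sheaf (totTopology K A) (ModuleCat.{0} Ch)} (f : M ⟶ N) [Mono f]
    (a) : Function.Injective (f.hom.app a) := by
  have : Mono ((sheafToPresheaf _ _).map f) := inferInstance
  have : Mono f.hom := this
  have : Mono (f.hom.app a) := inferInstance
  exact (ModuleCat.mono_iff_injective _).1 this

variable [LinearPrestack A]

/-- The sheaves of `ℂ[[ħ]]`-modules on the total category of `A` that are linear. -/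
def linearSheaves : ObjectProperty (Sheaf (totTopology K A) (ModuleCat.{0} Ch)) :=
  fun M => IsLinear A M.obj

instance : (linearSheaves K A).IsClosedUnderSubobjects where
  prop_of_mono f _ hY := IsLinear.of_injective f.hom (injective_of_mono K A f) hY

instance : (linearSheaves K A).IsClosedUnderQuotients where
  prop_of_epi {X Y} f _ hX := by
    have : Sheaf.IsLocallySurjective f := (Sheaf.isLocallySurjective_iff_epi' _ f).2 inferInstance
    have : Presheaf.IsLocallySurjective (totTopology K A) f.hom := this
    exact IsLinear.of_locallySurjective K f.hom hX Y.property

instance : (linearSheaves K A).IsClosedUnderFiniteProducts where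
  isClosedUnderLimitsOfShape J _ :=
    { limitsOfShape_le := by
        rintro X ⟨p⟩
        have inj : ∀ (a : (Tot A)ᵒᵖᵒᵖ) (x y : X.obj.obj a),
            (∀ j, (p.π.app j).hom.app a x = (p.π.app j).hom.app a y) → x = y := by
          intro a x y h
          exact Concrete.isLimit_ext _ (isLimitOfPreserves (sheafToPresheaf _ _ ⋙
            (evaluation _ _).obj a) p.isLimit) x y h
        refine ⟨fun {a b} f φ ψ x => ?_, fun {a b} f c φ x => ?_⟩
        · refine inj _ _ _ fun j => ?_
          have hj : IsLinear A (p.diag.obj j).obj := p.prop_diag_obj j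
          refine (NatTrans.naturality_apply (p.π.app j).hom _ _).trans ?_
          rw [_root_.map_add]
          refine (hj.map_add f φ ψ _).trans ?_
          exact congrArg₂ (· + ·) (NatTrans.naturality_apply (p.π.app j).hom _ _).symm
            (NatTrans.naturality_apply (p.π.app j).hom _ _).symm
        · refine inj _ _ _ fun j => ?_
          have hj : IsLinear A (p.diag.obj j).obj := p.prop_diag_obj j
          refine (NatTrans.naturality_apply (p.π.app j).hom _ _).trans ?_
          rw [_root_.map_smul]
          refine (hj.map_smul f c φ _).trans ?_
          exact congrArg (c • ·) (NatTrans.naturality_apply (p.π.app j).hom _ _).symm }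

instance : (linearSheaves K A).ContainsZero where
  exists_zero := by
    obtain ⟨Z, hZ⟩ := HasZeroObject.zero (C := Sheaf (totTopology K A) (ModuleCat.{0} Ch))
    have hs : ∀ (a : (Tot A)ᵒᵖᵒᵖ), Subsingleton (Z.obj.obj a) := fun a =>
      ModuleCat.subsingleton_of_isZero
        ((sheafToPresheaf _ _ ⋙ (evaluation _ _).obj a).map_isZero hZ)
    exact ⟨Z, hZ, fun _ _ _ _ => (hs _).elim _ _, fun _ _ _ _ => (hs _).elim _ _⟩

/-- The category of (left) modules over the `ℂ[[ħ]]`-linear prestack `A`: sheaves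
`(U, σ) ↦ M(U, σ)` of `ℂ[[ħ]]`-modules on which the morphisms of `A` act `ℂ[[ħ]]`-linearly. -/
abbrev AMod : Type 1 := (linearSheaves K A).FullSubcategory

/-- Multiplication by `ħ` on modules. -/
def hbarMap : 𝟭 (AMod K A) ⟶ 𝟭 (AMod K A) where
  app M := ObjectProperty.homMk ⟨{ app := fun a => ModuleCat.ofHom (hbar • LinearMap.id) }⟩

end LinearSheaves

section Localization

variable {C : Type} [SmallCategory C] {A : LocallyDiscrete Cᵒᵖ ⥤ᵖ Cat.{0, 0}} [LinearPrestack A]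

open scoped DirectSum

/-- The module freely generated by `a = (U, σ)`, at `b = (V, τ)`: the direct sum over
`V ⟶ U` of the modules `Hom(σ|_V, τ)`. -/
abbrev FreeAt (a b : Tot A) : Type :=
  ⨁ f : a.base ⟶ b.base, ((A.map f.toLoc).toFunctor.obj a.fiber ⟶ b.fiber)

open scoped Classical in
/-- The element of the free module given by a morphism of the total category. -/
def FreeAt.single {a b : Tot A} (h : a ⟶ b) : FreeAt a b :=
  DirectSum.lof Ch _ (fun f : a.base ⟶ b.base =>
    ((A.map f.toLoc).toFunctor.obj a.fiber ⟶ b.fiber)) h.base h.fiber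

lemma comp_add_aux' {D : Type} [SmallCategory D] [Preadditive D] {w x y z : D} (e : w ⟶ x)
    (φ ψ : x ⟶ y) (m : y ⟶ z) : e ≫ (φ + ψ) ≫ m = e ≫ φ ≫ m + e ≫ ψ ≫ m := by simp

lemma comp_smul_aux' {D : Type} [SmallCategory D] [Preadditive D] [Linear Ch D] {w x y z : D}
    (e : w ⟶ x) (c : Ch) (φ : x ⟶ y) (m : y ⟶ z) : e ≫ (c • φ) ≫ m = c • (e ≫ φ ≫ m) := by simp

open scoped Classical in
/-- Post-composition with a morphism of the total category. -/
def FreeAt.map (a : Tot A) {b c : Tot A} (g : b ⟶ c) : FreeAt a b →ₗ[Ch] FreeAt a c :=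
  DirectSum.toModule Ch _ _ fun f =>
    { toFun := fun φ => FreeAt.single (homMk f φ ≫ g)
      map_add' := fun φ ψ => by
        refine Eq.trans ?_ (_root_.map_add (DirectSum.lof Ch _ (fun f : a.base ⟶ c.base =>
          ((A.map f.toLoc).toFunctor.obj a.fiber ⟶ c.fiber)) (f ≫ g.base)) _ _)
        refine congrArg (DirectSum.lof Ch _ (fun f : a.base ⟶ c.base =>
          ((A.map f.toLoc).toFunctor.obj a.fiber ⟶ c.fiber)) (f ≫ g.base)) ?_
        change _ ≫ (A.map g.base.toLoc).toFunctor.map (φ + ψ) ≫ g.fiber = _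
        rw [LinearPrestack.map_add]
        exact comp_add_aux' _ _ _ _
      map_smul' := fun r φ => by
        refine Eq.trans ?_ (_root_.map_smul (DirectSum.lof Ch _ (fun f : a.base ⟶ c.base =>
          ((A.map f.toLoc).toFunctor.obj a.fiber ⟶ c.fiber)) (f ≫ g.base)) _ _)
        refine congrArg (DirectSum.lof Ch _ (fun f : a.base ⟶ c.base =>
          ((A.map f.toLoc).toFunctor.obj a.fiber ⟶ c.fiber)) (f ≫ g.base)) ?_
        change _ ≫ (A.map g.base.toLoc).toFunctor.map (r • φ) ≫ g.fiber = _
        rw [LinearPrestack.map_smul]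
        exact comp_smul_aux' _ _ _ _ }

open scoped Classical in
lemma FreeAt.map_single {a b c : Tot A} (h : a ⟶ b) (g : b ⟶ c) :
    FreeAt.map a g (FreeAt.single h) = FreeAt.single (h ≫ g) :=
  DirectSum.toModule_lof ..

open scoped Classical in
lemma FreeAt.hom_ext {a b : Tot A} {N : Type} [AddCommMonoid N] [Module Ch N]
    {u v : FreeAt a b →ₗ[Ch] N} (h : ∀ k : a ⟶ b, u (single k) = v (single k)) : u = v := by
  refine DirectSum.linearMap_ext _ fun f => LinearMap.ext fun φ => ?_
  exact h (homMk f φ)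

/-- The free presheaf on the generator `a = (U, σ)`: it sends `(V, τ)` to the direct sum over
`V ⟶ U` of the modules `Hom(σ|_V, τ)`. -/
def freePresheaf (a : Tot A) : (Tot A)ᵒᵖᵒᵖ ⥤ ModuleCat.{0} Ch where
  obj b := ModuleCat.of Ch (FreeAt a b.unop.unop)
  map g := ModuleCat.ofHom (FreeAt.map a g.unop.unop)
  map_id b := by
    refine ModuleCat.hom_ext (FreeAt.hom_ext fun k => ?_)
    exact (FreeAt.map_single k _).trans (congrArg FreeAt.single (Category.comp_id k))
  map_comp g h := by
    refine ModuleCat.hom_ext (FreeAt.hom_ext fun k => ?_)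
    refine (FreeAt.map_single k _).trans ?_
    refine (congrArg FreeAt.single (Category.assoc k g.unop.unop h.unop.unop).symm).trans ?_
    refine (FreeAt.map_single (k ≫ g.unop.unop) h.unop.unop).symm.trans ?_
    exact congrArg _ (FreeAt.map_single k g.unop.unop).symm

/-- The `ħ`-localization of the free presheaf on `a = (U, σ)`: it sends `(V, τ)` to the direct sum
over `V ⟶ U` of the modules `ℂ((ħ)) ⊗ Hom(σ|_V, τ)`. -/
def freeLocPresheaf (a : Tot A) : (Tot A)ᵒᵖᵒᵖ ⥤ ModuleCat.{0} Ch :=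
  freePresheaf a ⋙ MonoidalCategory.tensorLeft (ModuleCat.of Ch (LaurentSeries ℂ))

open scoped TensorProduct

lemma freePresheaf_map_add (a : Tot A) {b c : Tot A} (f : b.base ⟶ c.base)
    (φ ψ : (A.map f.toLoc).toFunctor.obj b.fiber ⟶ c.fiber) :
    FreeAt.map a (homMk f (φ + ψ)) = FreeAt.map a (homMk f φ) + FreeAt.map a (homMk f ψ) := by
  classical
  refine FreeAt.hom_ext fun k => ?_
  rw [LinearMap.add_apply, FreeAt.map_single, FreeAt.map_single, FreeAt.map_single]
  refine Eq.trans ?_ (_root_.map_add (DirectSum.lof Ch _ (fun f : a.base ⟶ c.base =>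
    ((A.map f.toLoc).toFunctor.obj a.fiber ⟶ c.fiber)) (k.base ≫ f)) _ _)
  exact congrArg (DirectSum.lof Ch _ (fun f : a.base ⟶ c.base =>
    ((A.map f.toLoc).toFunctor.obj a.fiber ⟶ c.fiber)) (k.base ≫ f)) (comp_add_aux _ _ _ _)

lemma freePresheaf_map_smul (a : Tot A) {b c : Tot A} (f : b.base ⟶ c.base) (r : Ch)
    (φ : (A.map f.toLoc).toFunctor.obj b.fiber ⟶ c.fiber) :
    FreeAt.map a (homMk f (r • φ)) = r • FreeAt.map a (homMk f φ) := by
  classical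
  refine FreeAt.hom_ext fun k => ?_
  rw [LinearMap.smul_apply, FreeAt.map_single, FreeAt.map_single]
  refine Eq.trans ?_ (_root_.map_smul (DirectSum.lof Ch _ (fun f : a.base ⟶ c.base =>
    ((A.map f.toLoc).toFunctor.obj a.fiber ⟶ c.fiber)) (k.base ≫ f)) _ _)
  exact congrArg (DirectSum.lof Ch _ (fun f : a.base ⟶ c.base =>
    ((A.map f.toLoc).toFunctor.obj a.fiber ⟶ c.fiber)) (k.base ≫ f)) (comp_smul_aux _ _ _ _)

lemma isLinear_freeLocPresheaf (a : Tot A) : IsLinear A (freeLocPresheaf a) where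
  map_add {b c} f φ ψ x := by
    change (FreeAt.map a (homMk f (φ + ψ))).lTensor (LaurentSeries ℂ) x =
      (FreeAt.map a (homMk f φ)).lTensor (LaurentSeries ℂ) x +
        (FreeAt.map a (homMk f ψ)).lTensor (LaurentSeries ℂ) x
    rw [freePresheaf_map_add, LinearMap.lTensor_add]
    rfl
  map_smul {b c} f r φ x := by
    change (FreeAt.map a (homMk f (r • φ))).lTensor (LaurentSeries ℂ) x =
      r • (FreeAt.map a (homMk f φ)).lTensor (LaurentSeries ℂ) x
    rw [freePresheaf_map_smul, LinearMap.lTensor_smul]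
    rfl

/-- The `A`-module `j_!(A^loc(σ, -))` for `a = (U, σ)`, where `A^loc = ℂ((ħ)) ⊗ A` and `j` is the
inclusion of `U`: the sheaf associated with the `ħ`-localization of the free presheaf on `a`.
It represents `M ↦ Γ(U; Hom_A(A^loc, M)(σ))`. -/
def locModule (K : GrothendieckTopology C) (a : Tot A) : AMod K A :=
  ⟨(presheafToSheaf (totTopology K A) _).obj (freeLocPresheaf a),
    IsLinear.of_locallySurjective K (toSheafify (totTopology K A) (freeLocPresheaf a))
      (isLinear_freeLocPresheaf a)
      ((presheafToSheaf (totTopology K A) _).obj (freeLocPresheaf a)).property⟩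

end Localization

section StarProducts

/-- A map `D : R → R` is a differential operator of order at most `n` on the commutative
ring `R`: it is `R`-linear if `n = 0`, and its commutators with the multiplications by elements
of `R` are differential operators of order at most `n - 1` if `n > 0`. -/
def IsDiffOp {R : Type} [CommRing R] : ℕ → (R → R) → Prop
  | 0, D => ∀ a b, D (a * b) = a * D b
  | n + 1, D => ∀ a, IsDiffOp n fun b => D (a * b) - a * D b

variable {X : Scheme.{0}} (f : X ⟶ Spec (.of ℂ))

/-- The constant functions, as sections of the structure sheaf of a scheme over `ℂ`. -/
def constants (W : X.Opens) : ℂ →+* Γ(X, W) :=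
  ((Scheme.ΓSpecIso (.of ℂ)).inv ≫ f.appTop ≫ X.presheaf.map (homOfLE le_top).op).hom

/-- A star product `g ⋆ h = ∑ i, P i (g, h) ħ ^ i` on `𝒪_V[[ħ]]`, where `V` is an open subset of a
scheme over `ℂ`: an associative product with `ℂ`-bilinear bidifferential operators
`P i : 𝒪_V × 𝒪_V → 𝒪_V` such that `P 0 (g, h) = g h`, and `P i (g, 1) = P i (1, g) = 0`
for `i > 0`. -/
structure StarProduct (V : X.Opens) where
  /-- The operators `P i`, on the sections over `W ⊆ V`. -/
  P (i : ℕ) (W : X.Opens) (hW : W ≤ V) : Γ(X, W) →+ Γ(X, W) →+ Γ(X, W)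
  P_res (i : ℕ) {W W' : X.Opens} (hW : W ≤ V) (hW' : W' ≤ W) (g h : Γ(X, W)) :
    X.presheaf.map (homOfLE hW').op (P i W hW g h) =
      P i W' (hW'.trans hW) (X.presheaf.map (homOfLE hW').op g) (X.presheaf.map (homOfLE hW').op h)
  P_const_left (i : ℕ) (W : X.Opens) (hW : W ≤ V) (c : ℂ) (g h : Γ(X, W)) :
    P i W hW (constants f W c * g) h = constants f W c * P i W hW g h
  P_const_right (i : ℕ) (W : X.Opens) (hW : W ≤ V) (c : ℂ) (g h : Γ(X, W)) :
    P i W hW g (constants f W c * h) = constants f W c * P i W hW g h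
  /-- Locally, `P i` is a differential operator of bounded order in each argument. -/
  bidifferential (i : ℕ) (x : X) (hx : x ∈ V) :
    ∃ (V' : X.Opens) (hV' : V' ≤ V) (n : ℕ), x ∈ V' ∧
      ∀ (W : X.Opens) (hW : W ≤ V') (g : Γ(X, W)),
        IsDiffOp n (fun h => P i W (hW.trans hV') g h) ∧
          IsDiffOp n (fun h => P i W (hW.trans hV') h g)
  P_zero (W : X.Opens) (hW : W ≤ V) (g h : Γ(X, W)) : P 0 W hW g h = g * h
  P_one_left (i : ℕ) (hi : 0 < i) (W : X.Opens) (hW : W ≤ V) (g : Γ(X, W)) : P i W hW 1 g = 0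
  P_one_right (i : ℕ) (hi : 0 < i) (W : X.Opens) (hW : W ≤ V) (g : Γ(X, W)) : P i W hW g 1 = 0
  assoc (n : ℕ) (W : X.Opens) (hW : W ≤ V) (g h k : Γ(X, W)) :
    ∑ p ∈ Finset.HasAntidiagonal.antidiagonal n, P p.1 W hW (P p.2 W hW g h) k =
      ∑ p ∈ Finset.HasAntidiagonal.antidiagonal n, P p.1 W hW g (P p.2 W hW h k)

variable {f}

/-- The product `G ⋆ H` of formal power series: it is the `ħ`-bilinear and `ħ`-adically continuous
extension of the star product of functions, so that its coefficient of `ħ ^ n` is the sum of the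
`P i (G_a, H_b)` with `i + (a + b) = n`. -/
def StarProduct.star {V : X.Opens} (S : StarProduct f V) {W : X.Opens} (hW : W ≤ V)
    (G H : PowerSeries Γ(X, W)) : PowerSeries Γ(X, W) :=
  PowerSeries.mk fun n => ∑ p ∈ Finset.HasAntidiagonal.antidiagonal n,
    ∑ q ∈ Finset.HasAntidiagonal.antidiagonal p.2,
      S.P p.1 W hW (PowerSeries.coeff q.1 G) (PowerSeries.coeff q.2 H)

variable (f)

/-- The object `σ|_V`, for `V ⊆ U` and `σ ∈ A(U)`. -/
abbrev restr {A : LocallyDiscrete X.Opensᵒᵖ ⥤ᵖ Cat.{0, 0}} {U V : X.Opens} (h : V ≤ U)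
    (σ : A.obj ⟨op U⟩) : A.obj ⟨op V⟩ :=
  (A.map (homOfLE h).op.toLoc).toFunctor.obj σ

/-- The restriction map `Hom(σ|_W, σ|_W) → Hom(σ|_{W'}, σ|_{W'})`, for `W' ⊆ W ⊆ U`
and `σ ∈ A(U)`. -/
def endRestr {A : LocallyDiscrete X.Opensᵒᵖ ⥤ᵖ Cat.{0, 0}} {U W W' : X.Opens} (h : W ≤ U)
    (h' : W' ≤ W) {σ : A.obj ⟨op U⟩} (u : restr h σ ⟶ restr h σ) :
    restr (h'.trans h) σ ⟶ restr (h'.trans h) σ :=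
  Pseudofunctor.LocallyDiscreteOpToCat.pullHom u (homOfLE h') (homOfLE (h'.trans h))
    (homOfLE (h'.trans h))

/-- An isomorphism of sheaves of `ℂ[[ħ]]`-algebras, over the open subset `V ⊆ U`, between the sheaf
of endomorphisms of `σ ∈ A(U)` and the star algebra `(𝒪_V[[ħ]], ⋆)`. -/
structure EndTrivialization {A : LocallyDiscrete X.Opensᵒᵖ ⥤ᵖ Cat.{0, 0}} [LinearPrestack A]
    {U V : X.Opens} (hV : V ≤ U) (σ : A.obj ⟨op U⟩) (S : StarProduct f V) where
  /-- The isomorphism on the sections over `W ⊆ V`. -/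
  equiv (W : X.Opens) (hW : W ≤ V) :
    (restr (hW.trans hV) σ ⟶ restr (hW.trans hV) σ) ≃+ PowerSeries Γ(X, W)
  map_smul (W : X.Opens) (hW : W ≤ V) (c : Ch) (u : restr (hW.trans hV) σ ⟶ restr (hW.trans hV) σ) :
    equiv W hW (c • u) = PowerSeries.map (constants f W) c * equiv W hW u
  /-- The product of two endomorphisms `u` and `v` is `u ∘ v`. -/
  map_mul (W : X.Opens) (hW : W ≤ V) (u v : restr (hW.trans hV) σ ⟶ restr (hW.trans hV) σ) :
    equiv W hW (v ≫ u) = S.star hW (equiv W hW u) (equiv W hW v)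
  map_res (W W' : X.Opens) (hW : W ≤ V) (hW' : W' ≤ W)
      (u : restr (hW.trans hV) σ ⟶ restr (hW.trans hV) σ) :
    equiv W' (hW'.trans hW) (endRestr (hW.trans hV) hW' u) =
      PowerSeries.map (X.presheaf.map (homOfLE hW').op).hom (equiv W hW u)

/-- A DQ-algebroid on a scheme `X` over `ℂ` (for the Zariski topology): a `ℂ[[ħ]]`-linear stack `A`
on `X` which is locally non-empty, in which any two objects are locally isomorphic, and such that
for every local object `σ` the sheaf of algebras of endomorphisms of `σ` is locally isomorphic
to a star algebra. -/
structure IsDQAlgebroid (A : LocallyDiscrete X.Opensᵒᵖ ⥤ᵖ Cat.{0, 0}) [LinearPrestack A] :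
    Prop where
  isStack : A.IsStack (Opens.grothendieckTopology X)
  locally_nonempty (x : X) : ∃ V : X.Opens, x ∈ V ∧ Nonempty (A.obj ⟨op V⟩)
  locally_iso (U : X.Opens) (σ τ : A.obj ⟨op U⟩) (x : X) (hx : x ∈ U) :
    ∃ (V : X.Opens) (hV : V ≤ U), x ∈ V ∧ Nonempty (restr hV σ ≅ restr hV τ)
  locally_star (U : X.Opens) (σ : A.obj ⟨op U⟩) (x : X) (hx : x ∈ U) :
    ∃ (V : X.Opens) (hV : V ≤ U), x ∈ V ∧
      ∃ S : StarProduct f V, Nonempty (EndTrivialization f hV σ S)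

end StarProducts

section Derived

/-- For an additive functor `G` of abelian categories, the functor from complexes to the derived
category of which the left derived functor of `G` is the total left derived functor. -/
abbrev onComplexes {𝓒 𝓑 : Type 1} [Category.{0} 𝓒] [Category.{0} 𝓑] [Abelian 𝓒] [Abelian 𝓑]
    [HasDerivedCategory.{w} 𝓑] (G : 𝓒 ⥤ 𝓑) [G.Additive] :
    CochainComplex 𝓒 ℤ ⥤ DerivedCategory 𝓑 :=
  G.mapHomologicalComplex (ComplexShape.up ℤ) ⋙ DerivedCategory.Q

/-- An additive functor `G` of abelian categories has a left derived functor, on unbounded derived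
categories. -/
abbrev HasLeftDerived {𝓒 𝓑 : Type 1} [Category.{0} 𝓒] [Category.{0} 𝓑] [Abelian 𝓒] [Abelian 𝓑]
    [HasDerivedCategory.{w} 𝓑] (G : 𝓒 ⥤ 𝓑) [G.Additive] : Prop :=
  (onComplexes G).HasLeftDerivedFunctor (HomologicalComplex.quasiIso 𝓒 (ComplexShape.up ℤ))

/-- The left derived functor `D(𝓒) ⥤ D(𝓑)` of an additive functor `G : 𝓒 ⥤ 𝓑`. -/
abbrev leftDerived {𝓒 𝓑 : Type 1} [Category.{0} 𝓒] [Category.{0} 𝓑] [Abelian 𝓒] [Abelian 𝓑]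
    [HasDerivedCategory.{w} 𝓒] [HasDerivedCategory.{w} 𝓑] (G : 𝓒 ⥤ 𝓑) [G.Additive]
    [HasLeftDerived G] : DerivedCategory 𝓒 ⥤ DerivedCategory 𝓑 :=
  (onComplexes G).totalLeftDerived DerivedCategory.Q
    (HomologicalComplex.quasiIso 𝓒 (ComplexShape.up ℤ))

/-- An object of the derived category has bounded cohomology. -/
abbrev IsBounded {𝓒 : Type 1} [Category.{0} 𝓒] [Abelian 𝓒] [HasDerivedCategory.{w} 𝓒]
    (M : DerivedCategory 𝓒) : Prop :=
  DerivedCategory.TStructure.t.bounded M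

variable {C : Type} [SmallCategory C] (K : GrothendieckTopology C)
  (A : LocallyDiscrete Cᵒᵖ ⥤ᵖ Cat.{0, 0}) [LinearPrestack A]

/-- The category of modules over `A / ħA`, i.e. of `A`-modules which are annihilated by `ħ`. -/
abbrev GrMod : Type 1 := (annihilated (hbarMap K A)).FullSubcategory

/-- The functor `M ↦ M / ħM = (A / ħA) ⊗_A M`. -/
abbrev gr : AMod K A ⥤ GrMod K A := quotientFunctor (hbarMap K A)

variable {K A}

/-- An object `M` of the derived category of `A`-modules is cohomologically complete:
`RHom_A(A^loc, M) = 0`. This is expressed by the vanishing, for all `n : ℤ` and all `σ ∈ A(U)`, of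
`H^n(U; RHom_A(A^loc, M)(σ)) = Hom_{D(A)}(j_!(A^loc(σ, -)), M[n])`. -/
def IsCohomologicallyComplete [HasDerivedCategory.{w} (AMod K A)]
    (M : DerivedCategory (AMod K A)) : Prop :=
  ∀ (a : Tot A) (n : ℤ) (u : (DerivedCategory.singleFunctor (AMod K A) 0).obj (locModule K a) ⟶
    (shiftFunctor (DerivedCategory (AMod K A)) n).obj M), u = 0

end Derived

end DQ

end

/-! Write L_a for `locModule K a`, so that completeness of M means Hom(L_a, M[n]) = 0 for all a and
n. The triangle M → M → gr M given by ħ shows that, when gr M is bounded, ħ is invertible on H^i(M)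
for all i outside a finite range (`exists_isIso_theta_homology`). The point is that completeness
then kills these cohomology modules for |i| large (`isBounded_of_isIso_theta`).

A morphism L_a → Z is a sequence of sections with ħ s_{n+1} = s_n, so the L_a detect everything in a
module Z on which ħ is invertible. A complex N with ħ invertible on its cohomology is
quasi-isomorphic to the colimit of N → N → ⋯ along ħ, and ħ is invertible on the terms and cycles of
that colimit. Hence a nonzero H^i(N) receives a nonzero map from some L_a[-i] → N
(`exists_single_hom_ne_zero`). For low degrees take N = τ_{<p} M: the composite L_a[-i] → N → M
vanishes by completeness, although N → M is an isomorphism on H^i. For high degrees take N = τ_{>q}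
M: the obstruction to lifting L_a[-i] → N to M lies in Hom(L_a[-i], τ_{≤q} M[1]), where τ_{≤q} M is
now known to be bounded. If L_a has finite projective dimension, this group is zero for i large; the
lift exists, and it vanishes by completeness.

Finite projective dimension (`ext_locModule_eq_zero`) is where the geometry enters. Star algebras
have no ħ-torsion, hence neither do free modules, so injective modules are both flasque and
ħ-divisible. An ħ-divisible sequence of sections lifts through an epimorphism whose kernel is
flasque and divisible; consequently Ext^n(L_a, F) = 0 for F flasque and n ≥ 2. The space is
Noetherian and sober, and codimensions are at most some d, so a Cousin-type filtration resolves each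
module by flasque ones in length d, and Ext^n(L_a, -) = 0 for n > d + 1.

The derived functors exist on unbounded complexes because every module is functorially a quotient of
a torsion-free one and submodules of torsion-free modules are torsion-free: a mapping cone is a
functorial two-step resolution. -/

noncomputable section

namespace DQ

/-! ### Restriction morphisms of the total category are cocartesian. -/

section Cocartesian

variable {C : Type} [SmallCategory C] {A : LocallyDiscrete Cᵒᵖ ⥤ᵖ Cat.{0, 0}}

lemma toRes_comp_fiber (a : Tot A) {S : Cᵒᵖ} (f : a.base ⟶ S) {c : Tot A} (u : res a f ⟶ c) :
    (toRes a f ≫ u).fiber =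
      (A.mapComp f.toLoc u.base.toLoc).hom.toNatTrans.app a.fiber ≫ u.fiber := by
  change _ ≫ (A.map u.base.toLoc).toFunctor.map (𝟙 _) ≫ u.fiber = _
  have h : (A.map u.base.toLoc).toFunctor.map (𝟙 (res a f).fiber) = 𝟙 _ :=
    CategoryTheory.Functor.map_id _ _
  exact (congrArg (fun k => (A.mapComp f.toLoc u.base.toLoc).hom.toNatTrans.app a.fiber ≫
    k ≫ u.fiber) h).trans (congrArg _ (Category.id_comp u.fiber))

lemma mapComp_hom_inv_app (a : Tot A) {S T : Cᵒᵖ} (f : a.base ⟶ S) (g : S ⟶ T) :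
    (A.mapComp f.toLoc g.toLoc).hom.toNatTrans.app a.fiber ≫
      (A.mapComp f.toLoc g.toLoc).inv.toNatTrans.app a.fiber = 𝟙 _ :=
  congrArg (fun k => k.toNatTrans.app a.fiber) (A.mapComp f.toLoc g.toLoc).hom_inv_id

lemma mapComp_inv_hom_app (a : Tot A) {S T : Cᵒᵖ} (f : a.base ⟶ S) (g : S ⟶ T) :
    (A.mapComp f.toLoc g.toLoc).inv.toNatTrans.app a.fiber ≫
      (A.mapComp f.toLoc g.toLoc).hom.toNatTrans.app a.fiber = 𝟙 _ :=
  congrArg (fun k => k.toNatTrans.app a.fiber) (A.mapComp f.toLoc g.toLoc).inv_hom_id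

/-- The `eqToHom` of a trivial equality matches the form in which fibres of equal morphisms are
compared in the Grothendieck construction. -/
lemma eq_of_retraction_comp {D : Type} [SmallCategory D] {x y z : D} (m : x ⟶ y) (i : y ⟶ x)
    (hi : i ≫ m = 𝟙 y) (φ ψ : y ⟶ z) (e : x = x) (h : m ≫ φ = eqToHom e ≫ m ≫ ψ) : φ = ψ := by
  rw [eqToHom_refl, Category.id_comp] at h
  have := congrArg (i ≫ ·) h
  simpa [← Category.assoc, hi] using this

lemma eqToHom_comp_retraction {D : Type} [SmallCategory D] {x y z : D} (m : x ⟶ y) (i : y ⟶ x)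
    (hi : m ≫ i = 𝟙 x) (φ : x ⟶ z) (e e' : x = x) :
    eqToHom e ≫ m ≫ i ≫ eqToHom e' ≫ φ = φ := by
  simp [← Category.assoc, hi]

/-- A morphism out of a restriction of `a` is determined by its base and by its composition with
the restriction morphism. -/
lemma res_hom_ext {a c : Tot A} {S : Cᵒᵖ} {f : a.base ⟶ S} {u v : res a f ⟶ c}
    (hb : u.base = v.base) (h : toRes a f ≫ u = toRes a f ≫ v) : u = v := by
  obtain ⟨g, φ⟩ := u
  obtain ⟨g', ψ⟩ := v
  obtain rfl : g = g' := hb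
  have h' := Pseudofunctor.Grothendieck.Hom.congr h
  rw [toRes_comp_fiber, toRes_comp_fiber] at h'
  have : φ = ψ := eq_of_retraction_comp _ _ (mapComp_inv_hom_app a f g) φ ψ rfl h'
  rw [this]

/-- The factorization of a morphism `a ⟶ c` through a restriction of `a`. -/
def resDesc {a c : Tot A} {S : Cᵒᵖ} (f : a.base ⟶ S) (h : a ⟶ c) (g : S ⟶ c.base)
    (hg : f ≫ g = h.base) : res a f ⟶ c :=
  homMk (a := res a f) g ((A.mapComp f.toLoc g.toLoc).inv.toNatTrans.app a.fiber ≫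
    eqToHom (by rw [← hg]; rfl) ≫ h.fiber)

lemma toRes_resDesc {a c : Tot A} {S : Cᵒᵖ} (f : a.base ⟶ S) (h : a ⟶ c) (g : S ⟶ c.base)
    (hg : f ≫ g = h.base) : toRes a f ≫ resDesc f h g hg = h := by
  obtain ⟨k, φ⟩ := h
  obtain rfl : f ≫ g = k := hg
  refine Pseudofunctor.Grothendieck.Hom.ext _ _ rfl ?_
  rw [toRes_comp_fiber]
  exact eqToHom_comp_retraction _ _ (mapComp_hom_inv_app a f g) φ rfl rfl

end Cocartesian

/-! ### Sheaves on the total category over a topological space: locality and gluing. -/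

section Opens

open TopologicalSpace

variable {X : Type} [TopologicalSpace X] {A : LocallyDiscrete (Opens X)ᵒᵖ ⥤ᵖ Cat.{0, 0}}

/-- The open subset `U` underlying `a = (U, σ)`. -/
abbrev dom (a : Tot A) : Opens X := a.base.unop

/-- The restriction `(V, σ|_V)` of `a = (U, σ)`, for `V ⊆ U`. -/
abbrev rs (a : Tot A) (V : Opens X) (h : V ≤ dom a) : Tot A := res a (homOfLE h).op

/-- The restriction morphism `(U, σ) ⟶ (V, σ|_V)`. -/
abbrev toRs (a : Tot A) (V : Opens X) (h : V ≤ dom a) : a ⟶ rs a V h := toRes a (homOfLE h).op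

/-- The factorization of `a ⟶ c` through the restriction of `a` to `V`. -/
def rsDesc {a c : Tot A} {V : Opens X} (hV : V ≤ dom a) (h : a ⟶ c) (hc : dom c ≤ V) :
    rs a V hV ⟶ c :=
  resDesc _ h (homOfLE hc).op (Subsingleton.elim _ _)

lemma toRs_rsDesc {a c : Tot A} {V : Opens X} (hV : V ≤ dom a) (h : a ⟶ c) (hc : dom c ≤ V) :
    toRs a V hV ≫ rsDesc hV h hc = h :=
  toRes_resDesc _ _ _ _

lemma rs_hom_ext {a c : Tot A} {V : Opens X} {hV : V ≤ dom a} {u v : rs a V hV ⟶ c}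
    (h : toRs a V hV ≫ u = toRs a V hV ≫ v) : u = v :=
  res_hom_ext (Subsingleton.elim _ _) h

lemma rsDesc_comp {a c d : Tot A} {V : Opens X} (hV : V ≤ dom a) (h : a ⟶ c) (hc : dom c ≤ V)
    (k : c ⟶ d) : rsDesc hV h hc ≫ k = rsDesc hV (h ≫ k) ((leOfHom k.base.unop).trans hc) :=
  rs_hom_ext (by rw [← Category.assoc, toRs_rsDesc, toRs_rsDesc])

/-- The restriction morphism between restrictions of `a`. -/
abbrev rr (a : Tot A) {V W : Opens X} (hV : V ≤ dom a) (hW : W ≤ V) :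
    rs a V hV ⟶ rs a W (hW.trans hV) :=
  rsDesc hV (toRs a W (hW.trans hV)) hW

lemma toRs_rr (a : Tot A) {V W : Opens X} (hV : V ≤ dom a) (hW : W ≤ V) :
    toRs a V hV ≫ rr a hV hW = toRs a W (hW.trans hV) :=
  toRs_rsDesc _ _ _

lemma rr_rr (a : Tot A) {V W Z : Opens X} (hV : V ≤ dom a) (hW : W ≤ V) (hZ : Z ≤ W) :
    rr a hV hW ≫ rr a (hW.trans hV) hZ = rr a hV (hZ.trans hW) :=
  rs_hom_ext (by rw [← Category.assoc, toRs_rr, toRs_rr, toRs_rr])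

lemma rr_rsDesc {a c : Tot A} {V W : Opens X} (hV : V ≤ dom a) (hW : W ≤ V) (h : a ⟶ c)
    (hc : dom c ≤ W) :
    rr a hV hW ≫ rsDesc (hW.trans hV) h hc = rsDesc hV h (hc.trans hW) :=
  rs_hom_ext (by rw [← Category.assoc, toRs_rr, toRs_rsDesc, toRs_rsDesc])

section Sections

/-- The action of a morphism of the total category on sections. -/
abbrev act {C : Type} [SmallCategory C] {A : LocallyDiscrete Cᵒᵖ ⥤ᵖ Cat.{0, 0}}
    (F : (Tot A)ᵒᵖᵒᵖ ⥤ ModuleCat.{0} Ch) {a b : Tot A} (h : a ⟶ b) :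
    F.obj (op (op a)) →ₗ[Ch] F.obj (op (op b)) :=
  (F.map h.op.op).hom

lemma act_comp {C : Type} [SmallCategory C] {A : LocallyDiscrete Cᵒᵖ ⥤ᵖ Cat.{0, 0}}
    (F : (Tot A)ᵒᵖᵒᵖ ⥤ ModuleCat.{0} Ch) {a b c : Tot A} (h : a ⟶ b) (k : b ⟶ c)
    (s : F.obj (op (op a))) : act F (h ≫ k) s = act F k (act F h s) := by
  simp only [act, op_comp, F.map_comp]
  rfl

lemma act_id {C : Type} [SmallCategory C] {A : LocallyDiscrete Cᵒᵖ ⥤ᵖ Cat.{0, 0}}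
    (F : (Tot A)ᵒᵖᵒᵖ ⥤ ModuleCat.{0} Ch) (a : Tot A)
    (s : F.obj (op (op a))) : act F (𝟙 a) s = s := by
  simp only [act, op_id, F.map_id]
  rfl

lemma act_naturality {C : Type} [SmallCategory C] {A : LocallyDiscrete Cᵒᵖ ⥤ᵖ Cat.{0, 0}}
    {F G : (Tot A)ᵒᵖᵒᵖ ⥤ ModuleCat.{0} Ch} (p : F ⟶ G) {a b : Tot A} (h : a ⟶ b)
    (s : F.obj (op (op a))) : p.app _ (act F h s) = act G h (p.app _ s) :=
  NatTrans.naturality_apply p h.op.op s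

variable {F : (Tot A)ᵒᵖᵒᵖ ⥤ ModuleCat.{0} Ch}

/-- The sieve generated by the restrictions to the members of a family of open subsets. -/
def familySieve (a : Tot A) {ι : Type} (V : ι → Opens X) : Sieve (op a) where
  arrows c _ := ∃ i, dom c.unop ≤ V i
  downward_closed := by
    rintro c d f ⟨i, hi⟩ g
    exact ⟨i, (leOfHom g.unop.base.unop).trans hi⟩

lemma familySieve_mem (a : Tot A) {ι : Type} (V : ι → Opens X)
    (hV : ∀ x ∈ dom a, ∃ i, x ∈ V i) :
    familySieve a V ∈ totTopology (Opens.grothendieckTopology X) A (op a) := by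
  rw [mem_totTopology]
  intro x hx
  obtain ⟨i, hi⟩ := hV x hx
  exact ⟨V i ⊓ dom a, homOfLE inf_le_right, ⟨i, inf_le_left⟩, hi, hx⟩

/-- Two sections of a sheaf are equal if they are locally equal. -/
lemma eq_of_locally_eq
    (hF : Presheaf.IsSheaf (totTopology (Opens.grothendieckTopology X) A) F) {a : Tot A} (s t : F.obj (op (op a)))
    (h : ∀ x ∈ dom a, ∃ (V : Opens X) (hV : V ≤ dom a), x ∈ V ∧
      act F (toRs a V hV) s = act F (toRs a V hV) t) : s = t := by
  choose! V hV hx hst using h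
  refine hF.isSeparated (op a) _ (familySieve_mem a (fun x : dom a => V x.1)
    fun x hx' => ⟨⟨x, hx'⟩, hx x hx'⟩) s t ?_
  rintro ⟨c⟩ g ⟨⟨x, hxa⟩, hc⟩
  have e : g.unop = toRs a (V x) (hV x hxa) ≫ rsDesc (hV x hxa) g.unop hc :=
    (toRs_rsDesc _ _ _).symm
  change act F g.unop s = act F g.unop t
  rw [e, act_comp, act_comp, hst x hxa]

/-- Gluing of sections of a sheaf. -/
lemma exists_glue
    (hF : Presheaf.IsSheaf (totTopology (Opens.grothendieckTopology X) A) F) {a : Tot A}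
    {ι : Type} (V : ι → Opens X) (hV : ∀ i, V i ≤ dom a)
    (hcov : ∀ x ∈ dom a, ∃ i, x ∈ V i) (s : ∀ i, F.obj (op (op (rs a (V i) (hV i)))))
    (hs : ∀ i j, act F (rr a (hV i) (inf_le_left : V i ⊓ V j ≤ V i)) (s i) =
      act F (rr a (hV j) (inf_le_right : V i ⊓ V j ≤ V j)) (s j)) :
    ∃ t : F.obj (op (op a)), ∀ i, act F (toRs a (V i) (hV i)) t = s i := by
  have hF' := (Presheaf.isSheaf_iff_isSheaf_forget _ F (forget _)).1 hF
  rw [isSheaf_iff_isSheaf_of_type] at hF'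
  have key := hF' _ (familySieve_mem a V hcov)
  -- An index is chosen for each arrow of the sieve; `hz` makes the choice immaterial by passing
  -- through `V i ⊓ V j`.
  let z : Presieve.FamilyOfElements (F ⋙ forget _) (familySieve a V).arrows :=
    fun c g hg => act F (rsDesc (hV hg.choose) g.unop hg.choose_spec) (s hg.choose)
  have hz : ∀ {c : Tot A} (g : a ⟶ c) (i j : ι) (hi : dom c ≤ V i) (hj : dom c ≤ V j),
      act F (rsDesc (hV i) g hi) (s i) = act F (rsDesc (hV j) g hj) (s j) := by
    intro c g i j hi hj
    rw [← rr_rsDesc (hV i) (inf_le_left : V i ⊓ V j ≤ V i) g (le_inf hi hj),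
      ← rr_rsDesc (hV j) (inf_le_right : V i ⊓ V j ≤ V j) g (le_inf hi hj), act_comp, act_comp, hs]
  have hcomp : z.Compatible := by
    rw [Presieve.compatible_iff_sieveCompatible]
    rintro ⟨c⟩ ⟨d⟩ f g hf
    have hg : (familySieve a V) (g ≫ f) := (familySieve a V).downward_closed hf g
    change act F (rsDesc (hV hg.choose) (g ≫ f).unop hg.choose_spec) (s hg.choose) =
      act F g.unop (act F (rsDesc (hV hf.choose) f.unop hf.choose_spec) (s hf.choose))
    rw [← act_comp, rsDesc_comp]
    exact hz _ _ _ _ _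
  obtain ⟨t, ht, -⟩ := key z hcomp
  refine ⟨t, fun i => ?_⟩
  have hi : (familySieve a V) (toRs a (V i) (hV i)).op := ⟨i, le_rfl⟩
  have h1 := ht _ hi
  change act F (toRs a (V i) (hV i)) t = act F (rsDesc (hV hi.choose)
    (toRs a (V i) (hV i)) hi.choose_spec) (s hi.choose) at h1
  rw [h1, hz _ _ i _ le_rfl]
  have : rsDesc (hV i) (toRs a (V i) (hV i)) le_rfl = 𝟙 _ :=
    rs_hom_ext (by rw [toRs_rsDesc, Category.comp_id])
  rw [this, act_id]

end Sections

end Opens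

/-! ### Subsheaves, and the largest linear subsheaf. -/

section Submodules

variable {C : Type} [SmallCategory C] {A : LocallyDiscrete Cᵒᵖ ⥤ᵖ Cat.{0, 0}}

/-- A family of submodules which is stable under the action of the total category. -/
structure SubFamily (F : (Tot A)ᵒᵖᵒᵖ ⥤ ModuleCat.{0} Ch) where
  /-- The submodule of the sections over `a`. -/
  carrier (a : Tot A) : Submodule Ch (F.obj (op (op a)))
  act_mem {a b : Tot A} (h : a ⟶ b) {s : F.obj (op (op a))} (hs : s ∈ carrier a) :
    act F h s ∈ carrier b

variable {F : (Tot A)ᵒᵖᵒᵖ ⥤ ModuleCat.{0} Ch} (p : SubFamily F)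

/-- The presheaf of modules defined by a family of submodules. -/
def SubFamily.presheaf : (Tot A)ᵒᵖᵒᵖ ⥤ ModuleCat.{0} Ch where
  obj a := ModuleCat.of Ch (p.carrier a.unop.unop)
  map h := ModuleCat.ofHom ((act F h.unop.unop).restrict fun _ hs => p.act_mem h.unop.unop hs)
  map_id a := by
    refine ModuleCat.hom_ext (LinearMap.ext fun s => Subtype.ext ?_)
    exact act_id F _ s.1
  map_comp h k := by
    refine ModuleCat.hom_ext (LinearMap.ext fun s => Subtype.ext ?_)
    exact act_comp F h.unop.unop k.unop.unop s.1

/-- The inclusion of the presheaf defined by a family of submodules. -/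
def SubFamily.incl : p.presheaf ⟶ F where
  app a := ModuleCat.ofHom (p.carrier a.unop.unop).subtype

lemma SubFamily.incl_injective (a) : Function.Injective (p.incl.app a) :=
  Subtype.val_injective

/-- The membership in a family of submodules is a local property. -/
def SubFamily.IsLocal (K : GrothendieckTopology C) : Prop :=
  ∀ (a : Tot A) (S : Sieve (op a)), S ∈ totTopology K A (op a) → ∀ s : F.obj (op (op a)),
    (∀ (c : Tot A) (g : a ⟶ c), S g.op → act F g s ∈ p.carrier c) → s ∈ p.carrier a

/-- A compatible family glues in the ambient sheaf, and the result lies in the submodules because it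
does so locally. -/
lemma SubFamily.isSheaf {K : GrothendieckTopology C}
    (hF : Presheaf.IsSheaf (totTopology K A) F) (hp : p.IsLocal K) :
    Presheaf.IsSheaf (totTopology K A) p.presheaf := by
  rw [Presheaf.isSheaf_iff_isSheaf_forget _ _ (forget _), isSheaf_iff_isSheaf_of_type]
  have hF' := (Presheaf.isSheaf_iff_isSheaf_forget _ F (forget _)).1 hF
  rw [isSheaf_iff_isSheaf_of_type] at hF'
  rintro ⟨a⟩ S hS z hz
  have key := hF' S hS
  let y : Presieve.FamilyOfElements (F ⋙ forget _) S.arrows := fun c g hg => (z g hg).1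
  have hy : y.Compatible := by
    rw [Presieve.compatible_iff_sieveCompatible] at hz ⊢
    intro c d f g hf
    exact congrArg Subtype.val (hz f g hf)
  obtain ⟨t, ht, ht'⟩ := key y hy
  refine ⟨⟨t, hp a S hS t fun c g hg => ?_⟩, fun c g hg => Subtype.ext (ht g hg), ?_⟩
  · have := ht g.op hg
    change act F g t = _ at this
    rw [this]
    exact (z g.op hg).2
  · intro t₁ h₁
    exact Subtype.ext (ht' t₁.1 fun c g hg => congrArg Subtype.val (h₁ g hg))

lemma act_homMk_toRes (F : (Tot A)ᵒᵖᵒᵖ ⥤ ModuleCat.{0} Ch) {b c : Tot A} (f : b.base ⟶ c.base)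
    (φ : (A.map f.toLoc).toFunctor.obj b.fiber ⟶ c.fiber) {S : Cᵒᵖ} (k : c.base ⟶ S)
    (t : F.obj (op (op b))) :
    act F (toRes c k) (act F (homMk f φ) t) =
      act F (homMk (𝟙 S) (resFiber f k φ)) (act F (toRes b (f ≫ k)) t) := by
  rw [← act_comp, ← act_comp]
  exact congrArg (fun h => act F h t) (homMk_resFiber f k φ)

/-- A sieve on the target of a morphism restricts a section to members of a sieve of the source. -/
lemma eq_of_sieve {K : GrothendieckTopology C} (hF : Presheaf.IsSheaf (totTopology K A) F)
    {a b : Tot A} (S : Sieve (op a)) (hS : S ∈ totTopology K A (op a)) (h : a.base ⟶ b.base)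
    (u v : F.obj (op (op b)))
    (huv : ∀ (T : Cᵒᵖ) (k : b.base ⟶ T), S (toRes a (h ≫ k)).op →
      act F (toRes b k) u = act F (toRes b k) v) : u = v := by
  let R : Sieve (op b) :=
    { arrows := fun c g => act F g.unop u = act F g.unop v
      downward_closed := fun {c d g} hg k => by
        rw [unop_comp, act_comp, act_comp, hg] }
  refine hF.isSeparated _ R ?_ u v fun _ _ hg => hg
  rw [mem_totTopology]
  refine K.superset_covering ?_ (K.pullback_stable h.unop hS)
  intro W w hw
  exact huv (op W) w.op hw

variable [LinearPrestack A]

/-- The submodules of the sections on which the morphisms of `A` act linearly. -/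
def linearFamily (F : (Tot A)ᵒᵖᵒᵖ ⥤ ModuleCat.{0} Ch) : SubFamily F where
  carrier a :=
    -- Quantifying over all images `act F g s` makes the condition stable under the action.
    { carrier := {s | ∀ (b c : Tot A) (g : a ⟶ b) (f : b.base ⟶ c.base)
        (φ ψ : (A.map f.toLoc).toFunctor.obj b.fiber ⟶ c.fiber) (r : Ch),
        act F (homMk f (φ + ψ)) (act F g s) =
          act F (homMk f φ) (act F g s) + act F (homMk f ψ) (act F g s) ∧
        act F (homMk f (r • φ)) (act F g s) = r • act F (homMk f φ) (act F g s)}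
      add_mem' := by
        intro s t hs ht b c g f φ ψ r
        obtain ⟨h1, h2⟩ := hs b c g f φ ψ r
        obtain ⟨h3, h4⟩ := ht b c g f φ ψ r
        simp only [map_add, h1, h2, h3, h4, smul_add]
        exact ⟨by abel, trivial⟩
      zero_mem' := by
        intro b c g f φ ψ r
        simp
      smul_mem' := by
        intro x s hs b c g f φ ψ r
        obtain ⟨h1, h2⟩ := hs b c g f φ ψ r
        simp only [map_smul, h1, h2, smul_add]
        exact ⟨trivial, smul_comm _ _ _⟩ }
  act_mem {a a'} h s hs := by
    intro b c g f φ ψ r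
    have := hs b c (h ≫ g) f φ ψ r
    rwa [act_comp F h g] at this

/-- Both identities take place in a sheaf, so they may be checked after restriction to the members
of the covering; `resFiber_add` and `resFiber_smul` transport them there. -/
lemma linearFamily_isLocal {K : GrothendieckTopology C}
    (hF : Presheaf.IsSheaf (totTopology K A) F) : (linearFamily F).IsLocal K := by
  intro a S hS s hs b c g f φ ψ r
  have key : ∀ (T : Cᵒᵖ) (k : c.base ⟶ T), S (toRes a (g.base ≫ f ≫ k)).op →
      act F (toRes b (f ≫ k)) (act F g s) ∈ (linearFamily F).carrier _ := by
    intro T k hT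
    rw [← act_comp]
    have e : g ≫ toRes b (f ≫ k) = toRes a (g.base ≫ f ≫ k) ≫
        vert (b := res b (f ≫ k)) _ := homMk_toRes g.base g.fiber (f ≫ k)
    rw [e, act_comp]
    exact (linearFamily F).act_mem _ (hs _ _ hT)
  constructor
  · refine eq_of_sieve hF S hS (g.base ≫ f) _ _ fun T k hT => ?_
    rw [Category.assoc] at hT
    have h := (key T k hT _ (res c k) (𝟙 _) (𝟙 T) (resFiber f k φ) (resFiber f k ψ) r).1
    rw [act_id] at h
    rw [map_add, act_homMk_toRes, act_homMk_toRes, act_homMk_toRes, resFiber_add]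
    exact h
  · refine eq_of_sieve hF S hS (g.base ≫ f) _ _ fun T k hT => ?_
    rw [Category.assoc] at hT
    have h := (key T k hT _ (res c k) (𝟙 _) (𝟙 T) (resFiber f k φ) (resFiber f k ψ) r).2
    rw [act_id] at h
    rw [map_smul, act_homMk_toRes, act_homMk_toRes, resFiber_smul]
    exact h

lemma isLinear_linearFamily (F : (Tot A)ᵒᵖᵒᵖ ⥤ ModuleCat.{0} Ch) :
    IsLinear A (linearFamily F).presheaf where
  map_add {a b} f φ ψ s := by
    have h := (s.2 a b (𝟙 a) f φ ψ 0).1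
    rw [act_id] at h
    exact Subtype.ext h
  map_smul {a b} f r φ s := by
    have h := (s.2 a b (𝟙 a) f φ φ r).2
    rw [act_id] at h
    exact Subtype.ext h

lemma mem_linearFamily_of_isLinear {G : (Tot A)ᵒᵖᵒᵖ ⥤ ModuleCat.{0} Ch} (hG : IsLinear A G)
    (p : G ⟶ F) {a : Tot A} (s : G.obj (op (op a))) :
    p.app _ s ∈ (linearFamily F).carrier a := by
  intro b c g f φ ψ r
  constructor
  · rw [← act_naturality, ← act_naturality, ← act_naturality, ← act_naturality, ← map_add]
    exact congrArg _ (hG.map_add f φ ψ _)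
  · rw [← act_naturality, ← act_naturality, ← act_naturality, ← map_smul]
    exact congrArg _ (hG.map_smul f r φ _)

variable (K : GrothendieckTopology C)

/-- The largest linear subsheaf. -/
def linearPart (F : Sheaf (totTopology K A) (ModuleCat.{0} Ch)) : AMod K A :=
  ⟨⟨(linearFamily F.obj).presheaf,
    (linearFamily F.obj).isSheaf F.property (linearFamily_isLocal F.property)⟩,
    isLinear_linearFamily F.obj⟩

variable {K}

/-- The inclusion of the largest linear subsheaf. -/
def linearPartι (F : Sheaf (totTopology K A) (ModuleCat.{0} Ch)) : (linearPart K F).obj ⟶ F :=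
  ⟨(linearFamily F.obj).incl⟩

/-- A morphism from an `A`-module to a sheaf factors through the largest linear subsheaf. -/
def linearPartLift {M : AMod K A} {F : Sheaf (totTopology K A) (ModuleCat.{0} Ch)}
    (p : M.obj ⟶ F) : M ⟶ linearPart K F :=
  ObjectProperty.homMk ⟨
    { app := fun a => ModuleCat.ofHom ((p.hom.app a).hom.codRestrict _ fun s =>
        mem_linearFamily_of_isLinear M.property p.hom s)
      naturality := fun a b h => by
        ext s
        exact Subtype.ext (act_naturality p.hom h.unop.unop s) }⟩

lemma linearPartLift_ι {M : AMod K A} {F : Sheaf (totTopology K A) (ModuleCat.{0} Ch)}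
    (p : M.obj ⟶ F) : (linearPartLift p).hom ≫ linearPartι F = p := rfl

instance (F : Sheaf (totTopology K A) (ModuleCat.{0} Ch)) : Mono (linearPartι F) := by
  refine (sheafToPresheaf _ _).mono_of_mono_map ?_
  have : ∀ a, Mono ((linearFamily F.obj).incl.app a) := fun a =>
    (ModuleCat.mono_iff_injective _).2 ((linearFamily F.obj).incl_injective a)
  exact NatTrans.mono_of_mono_app (linearFamily F.obj).incl

end Submodules

/-! ### Exactness of the inclusion of an abelian subcategory. -/

section ExactInclusion

universe v u

variable {𝓒 : Type u} [Category.{v} 𝓒] [Abelian 𝓒] (P : ObjectProperty 𝓒) [P.ContainsZero]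
  [P.IsClosedUnderSubobjects] [P.IsClosedUnderQuotients] [P.IsClosedUnderFiniteProducts]

lemma preservesFiniteLimits_ι : PreservesFiniteLimits P.ι := by
  have := P.preservesKernels_ι
  exact P.ι.preservesFiniteLimits_of_preservesKernels

lemma preservesFiniteColimits_ι : PreservesFiniteColimits P.ι := by
  have := P.preservesCokernels_ι
  exact P.ι.preservesFiniteColimits_of_preservesCokernels

end ExactInclusion

/-! ### Injectives and exact colimits in the category of `A`-modules. -/

section Colimits

variable {C : Type} [SmallCategory C] (K : GrothendieckTopology C)
  (A : LocallyDiscrete Cᵒᵖ ⥤ᵖ Cat.{0, 0}) [LinearPrestack A]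

instance : PreservesFiniteLimits (linearSheaves K A).ι := preservesFiniteLimits_ι _

instance : PreservesFiniteColimits (linearSheaves K A).ι := preservesFiniteColimits_ι _

/-- Morphisms from an `A`-module to a sheaf factor through `linearPart`, which thus acts as a right
adjoint of an exact inclusion and carries injectives to injectives. -/
instance : EnoughInjectives (AMod K A) where
  presentation M := by
    let I := Injective.under M.obj
    refine ⟨⟨linearPart K I, ⟨fun {Y Z} g f _ => ?_⟩, linearPartLift (Injective.ι M.obj), ?_⟩⟩
    · have : Mono f.hom := inferInstanceAs (Mono ((linearSheaves K A).ι.map f))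
      refine ⟨linearPartLift (Injective.factorThru (g.hom ≫ linearPartι I) f.hom), ?_⟩
      refine ObjectProperty.hom_ext _ ?_
      rw [← cancel_mono (linearPartι I)]
      simp only [ObjectProperty.FullSubcategory.comp_hom, Category.assoc, linearPartLift_ι,
        Injective.comp_factorThru]
    · refine (linearSheaves K A).ι.mono_of_mono_map ?_
      have h : Mono ((linearPartLift (Injective.ι M.obj)).hom ≫ linearPartι I) := by
        rw [linearPartLift_ι]; infer_instance
      exact @mono_of_mono _ _ _ _ _ (linearPartLift (Injective.ι M.obj)).hom (linearPartι I) h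

variable {K A}

lemma isLinear_of_surjective {M N : (Tot A)ᵒᵖᵒᵖ ⥤ ModuleCat.{0} Ch} (p : M ⟶ N)
    (hp : ∀ a, Function.Surjective (p.app a)) (hM : IsLinear A M) : IsLinear A N where
  map_add {a b} f φ ψ y := by
    obtain ⟨x, rfl⟩ := hp _ y
    simp only [← NatTrans.naturality_apply, hM.map_add, _root_.map_add]
  map_smul {a b} f r φ y := by
    obtain ⟨x, rfl⟩ := hp _ y
    simp only [← NatTrans.naturality_apply, hM.map_smul, _root_.map_smul]

variable (K A)

/-- Each leg of the colimit cocone factors through the largest linear subsheaf. The universal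
property then splits the inclusion of that subsheaf, which is therefore surjective on sections. -/
instance (J : Type*) [Category* J] : (linearSheaves K A).IsClosedUnderColimitsOfShape J where
  colimitsOfShape_le := by
    rintro F ⟨p⟩
    let lift (j : J) : p.diag.obj j ⟶ (linearPart K F).obj :=
      (linearPartLift (M := ⟨_, p.prop_diag_obj j⟩) (p.ι.app j)).hom
    have hlift (j : J) : lift j ≫ linearPartι F = p.ι.app j := linearPartLift_ι _
    let c : Cocone p.diag := ⟨(linearPart K F).obj,
      { app := lift
        naturality := fun i j f => by
          rw [← cancel_mono (linearPartι F), Category.assoc, hlift, Category.assoc]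
          simp [hlift] }⟩
    let d : F ⟶ (linearPart K F).obj := p.isColimit.desc c
    have hd : d ≫ linearPartι F = 𝟙 F := p.isColimit.hom_ext fun j => by
      rw [← Category.assoc]
      have : p.ι.app j ≫ d = lift j := p.isColimit.fac c j
      refine (congrArg (· ≫ linearPartι F) this).trans ?_
      exact (hlift j).trans (Category.comp_id _).symm
    refine isLinear_of_surjective (linearPartι F).hom (fun a s => ⟨d.hom.app a s, ?_⟩)
      (linearPart K F).property
    exact congrArg (fun k => k.hom.app a s) hd

instance : HasColimitsOfSize.{0, 0} (Sheaf (totTopology K A) (ModuleCat.{0} Ch)) :=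
  IsGrothendieckAbelian.hasColimits _

instance : HasColimitsOfSize.{0, 0} (AMod K A) where
  has_colimits_of_shape _ _ := inferInstance

instance (J : Type) : HasExactColimitsOfShape (Discrete J) (AMod K A) := by
  have : AB4OfSize.{0} (Sheaf (totTopology K A) (ModuleCat.{0} Ch)) :=
    IsGrothendieckAbelian.ab4OfSize _
  exact HasExactColimitsOfShape.domain_of_functor _ (linearSheaves K A).ι

instance : HasExactColimitsOfShape ℕ (AMod K A) := by
  exact HasExactColimitsOfShape.domain_of_functor _ (linearSheaves K A).ι

end Colimits

/-! ### ℂ((ħ)) as the union of the ħ^(-n) ℂ[[ħ]]. -/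

section LaurentSeries

/-- The Laurent series `ħ ^ (-n)`. -/
def hbarInv (n : ℕ) : LaurentSeries ℂ := HahnSeries.single (-(n : ℤ)) 1

lemma hbar_pow_smul_hbarInv (n : ℕ) : hbar ^ n • hbarInv n = 1 := by
  rw [Algebra.smul_def, LaurentSeries.coe_algebraMap, map_pow, HahnSeries.ofPowerSeries_X,
    hbarInv, HahnSeries.single_pow, HahnSeries.single_mul_single]
  simp

lemma hbar_smul_hbarInv_succ (n : ℕ) : hbar • hbarInv (n + 1) = hbarInv n := by
  rw [Algebra.smul_def, LaurentSeries.coe_algebraMap, HahnSeries.ofPowerSeries_X,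
    hbarInv, HahnSeries.single_mul_single, hbarInv]
  congr 1
  · lia
  · simp

lemma algebraMap_laurentSeries_injective :
    Function.Injective (algebraMap Ch (LaurentSeries ℂ)) := by
  rw [LaurentSeries.coe_algebraMap]
  exact HahnSeries.ofPowerSeries_injective

lemma exists_hbar_pow_smul (x : LaurentSeries ℂ) :
    ∃ (n : ℕ) (c : Ch), hbar ^ n • x = algebraMap Ch (LaurentSeries ℂ) c := by
  obtain ⟨⟨c, ⟨_, n, rfl⟩⟩, h⟩ := IsLocalization.surj (Submonoid.powers (PowerSeries.X : Ch)) x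
  refine ⟨n, c, ?_⟩
  rw [Algebra.smul_def, mul_comm]
  exact h

lemma eq_smul_hbarInv {x : LaurentSeries ℂ} {n : ℕ} {c : Ch}
    (h : hbar ^ n • x = algebraMap Ch (LaurentSeries ℂ) c) : x = c • hbarInv n := by
  have h1 : hbarInv n * (hbar ^ n • x) = x := by
    rw [mul_smul_comm, ← smul_mul_assoc, hbar_pow_smul_hbarInv, one_mul]
  rw [← h1, h, Algebra.smul_def, mul_comm]

lemma exists_eq_smul_hbarInv (x : LaurentSeries ℂ) : ∃ (n : ℕ) (c : Ch), x = c • hbarInv n := by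
  obtain ⟨n, c, h⟩ := exists_hbar_pow_smul x
  exact ⟨n, c, eq_smul_hbarInv h⟩

variable {Z : Type*} [AddCommGroup Z] [Module Ch Z] {s : ℕ → Z}

lemma hbar_pow_smul_seq (hs : ∀ n, hbar • s (n + 1) = s n) (m n : ℕ) :
    hbar ^ m • s (n + m) = s n := by
  induction m with
  | zero => simp
  | succ m ih => rw [pow_succ, mul_smul, ← add_assoc, hs, ih]

lemma hbar_pow_smul_hbarInv_add (m n : ℕ) : hbar ^ m • hbarInv (n + m) = hbarInv n :=
  hbar_pow_smul_seq (Z := LaurentSeries ℂ) (s := hbarInv) hbar_smul_hbarInv_succ m n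

/-- This makes `laurentDesc` well defined. Multiplication by ħ^(m+n) turns the hypothesis into c ħ^n
= d ħ^m in ℂ[[ħ]], and the two sides of the conclusion are these multiples of `s (m + n)`. -/
lemma smul_seq_eq (hs : ∀ n, hbar • s (n + 1) = s n) {m n : ℕ} {c d : Ch}
    (h : c • hbarInv m = d • hbarInv n) : c • s m = d • s n := by
  have h1 : algebraMap Ch (LaurentSeries ℂ) (c * hbar ^ n) =
      algebraMap Ch (LaurentSeries ℂ) (d * hbar ^ m) := by
    have h2 := congrArg (fun x => hbar ^ (m + n) • x) h
    have h3 : hbar ^ (m + n) • c • hbarInv m = algebraMap Ch (LaurentSeries ℂ) (c * hbar ^ n) := by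
      rw [pow_add, mul_comm, mul_smul, smul_comm (hbar ^ m) c, hbar_pow_smul_hbarInv,
        Algebra.smul_def, Algebra.smul_def, mul_one, map_mul, mul_comm]
    have h4 : hbar ^ (m + n) • d • hbarInv n = algebraMap Ch (LaurentSeries ℂ) (d * hbar ^ m) := by
      rw [pow_add, mul_smul, smul_comm (hbar ^ n) d, hbar_pow_smul_hbarInv,
        Algebra.smul_def, Algebra.smul_def, mul_one, map_mul, mul_comm]
    rw [← h3, ← h4]
    exact h2
  have h2 := algebraMap_laurentSeries_injective h1
  calc c • s m = c • hbar ^ n • s (m + n) := by rw [hbar_pow_smul_seq hs]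
    _ = d • hbar ^ m • s (n + m) := by rw [← mul_smul, h2, mul_smul, add_comm]
    _ = d • s n := by rw [hbar_pow_smul_seq hs]

/-- The linear map `ℂ((ħ)) → Z` given by a sequence such that `ħ s (n + 1) = s n`. -/
def laurentDesc (s : ℕ → Z) (hs : ∀ n, hbar • s (n + 1) = s n) : LaurentSeries ℂ →ₗ[Ch] Z where
  toFun x := (exists_eq_smul_hbarInv x).choose_spec.choose • s (exists_eq_smul_hbarInv x).choose
  map_add' x y := by
    have key : ∀ x : LaurentSeries ℂ, _ := fun x => (exists_eq_smul_hbarInv x).choose_spec.choose_spec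
    have hx := key x
    have hy := key y
    have hxy := key (x + y)
    generalize (exists_eq_smul_hbarInv x).choose_spec.choose = c at *
    generalize (exists_eq_smul_hbarInv x).choose = m at *
    generalize (exists_eq_smul_hbarInv y).choose_spec.choose = d at *
    generalize (exists_eq_smul_hbarInv y).choose = n at *
    have e : x + y = (c * hbar ^ n + d * hbar ^ m) • hbarInv (m + n) := by
      have h1 : (c * hbar ^ n) • hbarInv (m + n) = x := by
        rw [mul_smul c (hbar ^ n) (hbarInv (m + n)), hbar_pow_smul_hbarInv_add, ← hx]
      have h2 : (d * hbar ^ m) • hbarInv (m + n) = y := by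
        rw [mul_smul d (hbar ^ m) (hbarInv (m + n)), add_comm m n, hbar_pow_smul_hbarInv_add, ← hy]
      rw [add_smul (c * hbar ^ n) (d * hbar ^ m) (hbarInv (m + n)), h1, h2]
    rw [smul_seq_eq hs (hxy.symm.trans e), add_smul, mul_smul, mul_smul, hbar_pow_smul_seq hs,
      add_comm m n, hbar_pow_smul_seq hs]
  map_smul' r x := by
    have key : ∀ x : LaurentSeries ℂ, _ := fun x => (exists_eq_smul_hbarInv x).choose_spec.choose_spec
    have hx := key x
    have hrx := key (r • x)
    have e : r • x = (r * (exists_eq_smul_hbarInv x).choose_spec.choose) •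
        hbarInv (exists_eq_smul_hbarInv x).choose := by
      rw [mul_smul]
      exact congrArg (r • ·) hx
    rw [smul_seq_eq hs (hrx.symm.trans e), mul_smul, RingHom.id_apply]

lemma laurentDesc_hbarInv (hs : ∀ n, hbar • s (n + 1) = s n) (n : ℕ) :
    laurentDesc s hs (hbarInv n) = s n := by
  have h := (exists_eq_smul_hbarInv (hbarInv n)).choose_spec.choose_spec
  exact (smul_seq_eq hs (h.symm.trans (one_smul Ch _).symm)).trans (one_smul _ _)

end LaurentSeries

/-! ### Free modules, their localizations, and the functors they represent. -/

section Free

variable {C : Type} [SmallCategory C] {A : LocallyDiscrete Cᵒᵖ ⥤ᵖ Cat.{0, 0}} [LinearPrestack A]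
  (K : GrothendieckTopology C)

/-- The `A`-module associated with a linear presheaf. -/
def sheafMod (P : (Tot A)ᵒᵖᵒᵖ ⥤ ModuleCat.{0} Ch) (hP : IsLinear A P) : AMod K A :=
  ⟨(presheafToSheaf (totTopology K A) _).obj P,
    IsLinear.of_locallySurjective K (toSheafify (totTopology K A) P) hP
      ((presheafToSheaf (totTopology K A) _).obj P).property⟩

/-- The canonical morphism to the associated `A`-module. -/
def toSheafMod (P : (Tot A)ᵒᵖᵒᵖ ⥤ ModuleCat.{0} Ch) (hP : IsLinear A P) :
    P ⟶ (sheafMod K P hP).obj.obj :=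
  toSheafify (totTopology K A) P

variable {K} {P : (Tot A)ᵒᵖᵒᵖ ⥤ ModuleCat.{0} Ch} {hP : IsLinear A P}

/-- The universal property of the associated `A`-module. -/
def sheafModLift {M : AMod K A} (η : P ⟶ M.obj.obj) : sheafMod K P hP ⟶ M :=
  ObjectProperty.homMk ⟨sheafifyLift (totTopology K A) η M.obj.property⟩

lemma toSheafMod_lift {M : AMod K A} (η : P ⟶ M.obj.obj) :
    toSheafMod K P hP ≫ (sheafModLift (hP := hP) η).hom.hom = η :=
  toSheafify_sheafifyLift _ _ _

lemma sheafMod_hom_ext {M : AMod K A} {f g : sheafMod K P hP ⟶ M}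
    (h : toSheafMod K P hP ≫ f.hom.hom = toSheafMod K P hP ≫ g.hom.hom) : f = g := by
  refine ObjectProperty.hom_ext _ (Sheaf.hom_ext ?_)
  exact sheafify_hom_ext _ _ _ M.obj.property h

lemma isLinear_freePresheaf (a : Tot A) : IsLinear A (freePresheaf a) where
  map_add {b c} f φ ψ x := by
    change FreeAt.map a (homMk f (φ + ψ)) x = FreeAt.map a (homMk f φ) x + FreeAt.map a (homMk f ψ) x
    rw [freePresheaf_map_add]
    rfl
  map_smul {b c} f r φ x := by
    change FreeAt.map a (homMk f (r • φ)) x = r • FreeAt.map a (homMk f φ) x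
    rw [freePresheaf_map_smul]
    rfl

/-- For a linear presheaf `M`, the linear map from the free module generated by `a` which sends
the morphism `k` to the image of the section `s` by `k`, as a linear function of `s`. -/
def freeEval {M : (Tot A)ᵒᵖᵒᵖ ⥤ ModuleCat.{0} Ch} (hM : IsLinear A M) (a b : Tot A) :
    FreeAt a b →ₗ[Ch] M.obj (op (op a)) →ₗ[Ch] M.obj (op (op b)) := by
  classical
  exact DirectSum.toModule Ch _ _ fun f =>
    { toFun := fun φ => act M (homMk f φ)
      map_add' := fun φ ψ => LinearMap.ext fun s => hM.map_add f φ ψ s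
      map_smul' := fun r φ => LinearMap.ext fun s => hM.map_smul f r φ s }

lemma freeEval_single {M : (Tot A)ᵒᵖᵒᵖ ⥤ ModuleCat.{0} Ch} (hM : IsLinear A M) {a b : Tot A}
    (k : a ⟶ b) : freeEval hM a b (FreeAt.single k) = act M k := by
  classical
  exact DirectSum.toModule_lof ..

lemma freeEval_map {M : (Tot A)ᵒᵖᵒᵖ ⥤ ModuleCat.{0} Ch} (hM : IsLinear A M) {a b c : Tot A}
    (g : b ⟶ c) (x : FreeAt a b) (s : M.obj (op (op a))) :
    freeEval hM a c (FreeAt.map a g x) s = act M g (freeEval hM a b x s) := by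
  have : ((freeEval hM a c).flip s) ∘ₗ FreeAt.map a g =
      act M g ∘ₗ (freeEval hM a b).flip s := by
    refine FreeAt.hom_ext fun k => ?_
    simp only [LinearMap.comp_apply, LinearMap.flip_apply, FreeAt.map_single, freeEval_single]
    exact act_comp M k g s
  exact congrArg (fun u => u x) this

/-- The morphism from the free presheaf given by a section. -/
def freePresheafDesc {M : (Tot A)ᵒᵖᵒᵖ ⥤ ModuleCat.{0} Ch} (hM : IsLinear A M) {a : Tot A}
    (s : M.obj (op (op a))) : freePresheaf a ⟶ M where
  app b := ModuleCat.ofHom ((freeEval hM a b.unop.unop).flip s)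
  naturality _ _ g := ModuleCat.hom_ext (LinearMap.ext fun x => freeEval_map hM g.unop.unop x s)

variable (K)

/-- The free `A`-module generated by `a = (U, σ)`. -/
def freeMod (a : Tot A) : AMod K A := sheafMod K (freePresheaf a) (isLinear_freePresheaf a)

/-- The generator of the free `A`-module. -/
def freeGen (a : Tot A) : (freeMod K a).obj.obj.obj (op (op a)) :=
  (toSheafMod K (freePresheaf a) (isLinear_freePresheaf a)).app _ (FreeAt.single (𝟙 a))

variable {K}

/-- The morphism from the free `A`-module given by a section. -/
def freeDesc {M : AMod K A} {a : Tot A} (s : M.obj.obj.obj (op (op a))) : freeMod K a ⟶ M :=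
  sheafModLift (freePresheafDesc M.property s)

lemma freeDesc_freeGen {M : AMod K A} {a : Tot A} (s : M.obj.obj.obj (op (op a))) :
    (freeDesc s).hom.hom.app _ (freeGen K a) = s := by
  have h := congrArg (fun u => u.app (op (op a)) (FreeAt.single (𝟙 a)))
    (toSheafMod_lift (hP := isLinear_freePresheaf a) (freePresheafDesc M.property s))
  refine h.trans ?_
  exact (congrArg (fun u => u s) (freeEval_single M.property (𝟙 a))).trans (act_id _ a s)

/-- With `freeDesc_freeGen`, this says that `freeMod K a` represents the sections over `a`. -/
lemma freeMod_hom_ext {M : AMod K A} {a : Tot A} {f g : freeMod K a ⟶ M}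
    (h : f.hom.hom.app _ (freeGen K a) = g.hom.hom.app _ (freeGen K a)) : f = g := by
  refine sheafMod_hom_ext (NatTrans.ext (funext fun b => ModuleCat.hom_ext ?_))
  refine FreeAt.hom_ext fun k => ?_
  have e : FreeAt.single k = (freePresheaf a).map k.op.op (FreeAt.single (𝟙 a)) := by
    refine Eq.trans ?_ (FreeAt.map_single (𝟙 a) k).symm
    rw [Category.id_comp]
  have key : ∀ u : freeMod K a ⟶ M,
      (toSheafMod K (freePresheaf a) (isLinear_freePresheaf a) ≫ u.hom.hom).app b
        (FreeAt.single k) = act M.obj.obj k (u.hom.hom.app _ (freeGen K a)) := by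
    intro u
    rw [e]
    exact act_naturality (toSheafMod K (freePresheaf a) (isLinear_freePresheaf a) ≫ u.hom.hom) k _
  exact (key f).trans ((congrArg _ h).trans (key g).symm)

open scoped TensorProduct

/-- The morphism from the localized free presheaf given by a sequence of sections. -/
def freeLocPresheafDesc {M : (Tot A)ᵒᵖᵒᵖ ⥤ ModuleCat.{0} Ch} (hM : IsLinear A M) {a : Tot A}
    (s : ℕ → M.obj (op (op a))) (hs : ∀ n, hbar • s (n + 1) = s n) : freeLocPresheaf a ⟶ M where
  app b := ModuleCat.ofHom
    (TensorProduct.lift ((freeEval hM a b.unop.unop).flip ∘ₗ laurentDesc s hs))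
  naturality b c g := by
    refine ModuleCat.hom_ext (TensorProduct.ext' fun x y => ?_)
    exact freeEval_map hM g.unop.unop y (laurentDesc s hs x)

variable (K) in
/-- The section `ħ ^ (-n)` of the localized free module. -/
def locGen (a : Tot A) (n : ℕ) : (locModule K a).obj.obj.obj (op (op a)) :=
  (toSheafMod K (freeLocPresheaf a) (isLinear_freeLocPresheaf a)).app (op (op a))
    (hbarInv n ⊗ₜ[Ch] (FreeAt.single (𝟙 a) : FreeAt a a) : LaurentSeries ℂ ⊗[Ch] FreeAt a a)

lemma hbar_smul_locGen (a : Tot A) (n : ℕ) : hbar • locGen K a (n + 1) = locGen K a n := by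
  refine (map_smul ((toSheafMod K (freeLocPresheaf a) (isLinear_freeLocPresheaf a)).app
    (op (op a))).hom hbar _).symm.trans (congrArg _ ?_)
  change hbar • (hbarInv (n + 1) ⊗ₜ[Ch] (FreeAt.single (𝟙 a) : FreeAt a a) :
    LaurentSeries ℂ ⊗[Ch] FreeAt a a) = hbarInv n ⊗ₜ[Ch] (FreeAt.single (𝟙 a) : FreeAt a a)
  rw [TensorProduct.smul_tmul', hbar_smul_hbarInv_succ]

/-- The morphism from the localized free module given by a sequence of sections. -/
def locDesc {M : AMod K A} {a : Tot A} (s : ℕ → M.obj.obj.obj (op (op a)))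
    (hs : ∀ n, hbar • s (n + 1) = s n) : locModule K a ⟶ M :=
  sheafModLift (hP := isLinear_freeLocPresheaf a) (freeLocPresheafDesc M.property s hs)

lemma locDesc_locGen {M : AMod K A} {a : Tot A} (s : ℕ → M.obj.obj.obj (op (op a)))
    (hs : ∀ n, hbar • s (n + 1) = s n) (n : ℕ) :
    (locDesc s hs).hom.hom.app _ (locGen K a n) = s n := by
  have h := congrArg (fun u => u.app (op (op a))
    (hbarInv n ⊗ₜ[Ch] (FreeAt.single (𝟙 a) : FreeAt a a) : LaurentSeries ℂ ⊗[Ch] FreeAt a a))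
    (toSheafMod_lift (hP := isLinear_freeLocPresheaf a) (freeLocPresheafDesc M.property s hs))
  refine h.trans ?_
  refine (congrArg (fun u => u (laurentDesc s hs (hbarInv n)))
    (freeEval_single M.property (𝟙 a))).trans ?_
  exact (act_id _ a _).trans (laurentDesc_hbarInv hs n)

/-- With `locDesc_locGen`, this identifies morphisms from `locModule K a` with sequences of sections
such that ħ s_{n+1} = s_n. All later computations with `locModule` go through this description. -/
lemma locModule_hom_ext {M : AMod K A} {a : Tot A} {f g : locModule K a ⟶ M}
    (h : ∀ n, f.hom.hom.app _ (locGen K a n) = g.hom.hom.app _ (locGen K a n)) : f = g := by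
  refine sheafMod_hom_ext (hP := isLinear_freeLocPresheaf a)
    (NatTrans.ext (funext fun b => ModuleCat.hom_ext ?_))
  let T (u : locModule K a ⟶ M) :=
    toSheafMod K (freeLocPresheaf a) (isLinear_freeLocPresheaf a) ≫ u.hom.hom
  have key : ∀ (u : locModule K a ⟶ M) (n : ℕ) (k : a ⟶ b.unop.unop),
      (T u).app b (hbarInv n ⊗ₜ[Ch] (FreeAt.single k : FreeAt a b.unop.unop) :
        LaurentSeries ℂ ⊗[Ch] FreeAt a b.unop.unop) =
        act M.obj.obj k (u.hom.hom.app _ (locGen K a n)) := by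
    intro u n k
    have e : (hbarInv n ⊗ₜ[Ch] (FreeAt.single k : FreeAt a b.unop.unop) :
        LaurentSeries ℂ ⊗[Ch] FreeAt a b.unop.unop) = act (freeLocPresheaf a) k
          (hbarInv n ⊗ₜ[Ch] (FreeAt.single (𝟙 a) : FreeAt a a) :
            LaurentSeries ℂ ⊗[Ch] FreeAt a a) := by
      change _ = hbarInv n ⊗ₜ[Ch] FreeAt.map a k (FreeAt.single (𝟙 a))
      rw [FreeAt.map_single, Category.id_comp]
    rw [e]
    exact act_naturality (T u) k _
  refine TensorProduct.ext (LinearMap.ext fun x => FreeAt.hom_ext fun k => ?_)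
  obtain ⟨n, c, rfl⟩ := exists_eq_smul_hbarInv x
  have e : ((c • hbarInv n) ⊗ₜ[Ch] (FreeAt.single k : FreeAt a b.unop.unop) :
      LaurentSeries ℂ ⊗[Ch] FreeAt a b.unop.unop) =
        c • (hbarInv n ⊗ₜ[Ch] (FreeAt.single k : FreeAt a b.unop.unop)) :=
    (TensorProduct.smul_tmul' c (hbarInv n) _).symm
  refine (congrArg ((T f).app b).hom e).trans ?_
  refine Eq.trans ?_ (congrArg ((T g).app b).hom e).symm
  refine (map_smul ((T f).app b).hom c _).trans ?_
  refine Eq.trans ?_ (map_smul ((T g).app b).hom c _).symm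
  exact congrArg (c • ·) ((key f n k).trans ((congrArg _ (h n)).trans (key g n k).symm))

end Free

/-! ### Morphisms of `A`-modules in terms of sections. -/

section SheafModMap

variable {C : Type} [SmallCategory C] {A : LocallyDiscrete Cᵒᵖ ⥤ᵖ Cat.{0, 0}} [LinearPrestack A]
  {K : GrothendieckTopology C}

/-- The functoriality of the associated `A`-module. -/
def sheafModMap {P P' : (Tot A)ᵒᵖᵒᵖ ⥤ ModuleCat.{0} Ch} (hP : IsLinear A P) (hP' : IsLinear A P')
    (η : P ⟶ P') : sheafMod K P hP ⟶ sheafMod K P' hP' :=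
  ObjectProperty.homMk ((presheafToSheaf (totTopology K A) _).map η)

lemma toSheafMod_map {P P' : (Tot A)ᵒᵖᵒᵖ ⥤ ModuleCat.{0} Ch} (hP : IsLinear A P)
    (hP' : IsLinear A P') (η : P ⟶ P') :
    toSheafMod K P hP ≫ (sheafModMap (K := K) hP hP' η).hom.hom = η ≫ toSheafMod K P' hP' :=
  (toSheafify_naturality (totTopology K A) η).symm

lemma mono_sheafModMap {P P' : (Tot A)ᵒᵖᵒᵖ ⥤ ModuleCat.{0} Ch} (hP : IsLinear A P)
    (hP' : IsLinear A P') (η : P ⟶ P') (h : ∀ a, Function.Injective (η.app a)) :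
    Mono (sheafModMap (K := K) hP hP' η) := by
  refine (linearSheaves K A).ι.mono_of_mono_map ?_
  have : ∀ a, Mono (η.app a) := fun a => (ModuleCat.mono_iff_injective _).2 (h a)
  have : Mono η := NatTrans.mono_of_mono_app η
  exact inferInstanceAs (Mono ((presheafToSheaf (totTopology K A) _).map η))

/-- The action of a morphism of `A`-modules on sections. -/
abbrev onSec {M N : AMod K A} (f : M ⟶ N) (a : Tot A) :
    M.obj.obj.obj (op (op a)) →ₗ[Ch] N.obj.obj.obj (op (op a)) :=
  (f.hom.hom.app (op (op a))).hom

/-- The action of a morphism of the total category on sections of an `A`-module. -/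
abbrev actM (M : AMod K A) {a b : Tot A} (h : a ⟶ b) :
    M.obj.obj.obj (op (op a)) →ₗ[Ch] M.obj.obj.obj (op (op b)) :=
  act M.obj.obj h

lemma onSec_actM {M N : AMod K A} (f : M ⟶ N) {a b : Tot A} (h : a ⟶ b)
    (s : M.obj.obj.obj (op (op a))) : onSec f b (actM M h s) = actM N h (onSec f a s) :=
  act_naturality f.hom.hom h s

lemma onSec_comp {M N P : AMod K A} (f : M ⟶ N) (g : N ⟶ P) (a : Tot A)
    (s : M.obj.obj.obj (op (op a))) : onSec (f ≫ g) a s = onSec g a (onSec f a s) := rfl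

lemma onSec_freeDesc {M : AMod K A} {a : Tot A} (s : M.obj.obj.obj (op (op a))) :
    onSec (freeDesc s) a (freeGen K a) = s :=
  freeDesc_freeGen s

lemma hom_eq_zero_of_onSec {M N : AMod K A} (f : M ⟶ N) (h : ∀ a s, onSec f a s = 0) : f = 0 := by
  refine ObjectProperty.hom_ext _ (Sheaf.hom_ext (NatTrans.ext (funext fun a => ?_)))
  exact ModuleCat.hom_ext (LinearMap.ext fun s => h a.unop.unop s)

lemma onSec_zero {M N : AMod K A} (a : Tot A) (s : M.obj.obj.obj (op (op a))) :
    onSec (0 : M ⟶ N) a s = 0 := rfl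

/-- The sections of the kernel term of an exact sequence. -/
lemma exists_onSec_eq_of_exact {S : ShortComplex (AMod K A)} (hS : S.Exact) [Mono S.f] {a : Tot A}
    (s : S.X₂.obj.obj.obj (op (op a))) (hs : onSec S.g a s = 0) :
    ∃ t : S.X₁.obj.obj.obj (op (op a)), onSec S.f a t = s := by
  -- A section is a morphism from a free module, and as such it lifts to the kernel.
  have h0 : freeDesc s ≫ S.g = 0 := by
    refine freeMod_hom_ext ?_
    change onSec S.g a (onSec (freeDesc s) a (freeGen K a)) = onSec (0 : freeMod K a ⟶ S.X₃) a _
    rw [onSec_freeDesc, hs, onSec_zero]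
  refine ⟨onSec (hS.lift (freeDesc s) h0) a (freeGen K a), ?_⟩
  rw [← onSec_comp, hS.lift_f, onSec_freeDesc]

/-- Multiplication by `ħ` on sections. -/
lemma onSec_hbarMap (M : AMod K A) (a : Tot A) (s : M.obj.obj.obj (op (op a))) :
    onSec ((hbarMap K A).app M) a s = hbar • s := rfl

end SheafModMap

/-! ### Flasque modules on a Noetherian space. -/

section Flasque

open TopologicalSpace

variable {X : Type} [TopologicalSpace X] {A : LocallyDiscrete (Opens X)ᵒᵖ ⥤ᵖ Cat.{0, 0}}
  [LinearPrestack A]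

local notation "𝓜" => AMod (Opens.grothendieckTopology X) A

/-- Epimorphisms of `A`-modules are locally surjective on sections. -/
lemma exists_lift_of_epi {M N : 𝓜} (f : M ⟶ N) [Epi f] {a : Tot A}
    (s : N.obj.obj.obj (op (op a))) (x : X) (hx : x ∈ dom a) :
    ∃ (V : Opens X) (hV : V ≤ dom a) (t : M.obj.obj.obj (op (op (rs a V hV)))), x ∈ V ∧
      onSec f _ t = actM N (toRs a V hV) s := by
  have : Epi f.hom := inferInstanceAs (Epi ((linearSheaves _ A).ι.map f))
  have : Sheaf.IsLocallySurjective f.hom := (Sheaf.isLocallySurjective_iff_epi' _ f.hom).2 this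
  have : Presheaf.IsLocallySurjective (totTopology (Opens.grothendieckTopology X) A) f.hom.hom :=
    this
  obtain ⟨V, g, ⟨t, ht⟩, hxV⟩ :=
    (Presheaf.imageSieve_mem (totTopology (Opens.grothendieckTopology X) A) f.hom.hom s) x hx
  exact ⟨V, leOfHom g, t, hxV, ht⟩

/-- Two sections over `rs a Z` are equal if they are locally equal. -/
lemma eq_of_locally_eq_rs (M : 𝓜) {a : Tot A} {Z : Opens X} (hZ : Z ≤ dom a)
    (s t : M.obj.obj.obj (op (op (rs a Z hZ))))
    (h : ∀ x ∈ Z, ∃ (V : Opens X) (hV : V ≤ Z), x ∈ V ∧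
      actM M (rr a hZ hV) s = actM M (rr a hZ hV) t) : s = t := by
  refine eq_of_locally_eq M.obj.property s t fun x hx => ?_
  obtain ⟨V, hV, hxV, e⟩ := h x hx
  refine ⟨V, hV, hxV, ?_⟩
  have e1 : toRs (rs a Z hZ) V hV = rr a hZ hV ≫
      rsDesc (hV.trans hZ) (toRs a Z hZ ≫ toRs (rs a Z hZ) V hV) le_rfl :=
    rs_hom_ext (by rw [← Category.assoc, toRs_rr, toRs_rsDesc])
  rw [e1, act_comp, act_comp]
  exact congrArg _ e

/-- Gluing of sections over `rs a Z`. -/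
lemma exists_glue_rs (M : 𝓜) {a : Tot A} {Z : Opens X} (hZ : Z ≤ dom a) {ι : Type}
    (V : ι → Opens X) (hV : ∀ i, V i ≤ Z) (hcov : ∀ x ∈ Z, ∃ i, x ∈ V i)
    (s : ∀ i, M.obj.obj.obj (op (op (rs a (V i) ((hV i).trans hZ)))))
    (hs : ∀ i j, actM M (rr a ((hV i).trans hZ) (inf_le_left : V i ⊓ V j ≤ V i)) (s i) =
      actM M (rr a ((hV j).trans hZ) (inf_le_right : V i ⊓ V j ≤ V j)) (s j)) :
    ∃ t : M.obj.obj.obj (op (op (rs a Z hZ))), ∀ i, actM M (rr a hZ (hV i)) t = s i := by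
  let e (W : Opens X) (hW : W ≤ Z) : rs a W (hW.trans hZ) ⟶ rs (rs a Z hZ) W hW :=
    rsDesc (hW.trans hZ) (toRs a Z hZ ≫ toRs (rs a Z hZ) W hW) le_rfl
  let e' (W : Opens X) (hW : W ≤ Z) : rs (rs a Z hZ) W hW ⟶ rs a W (hW.trans hZ) :=
    rsDesc hW (rr a hZ hW) le_rfl
  have he : ∀ W hW, e W hW ≫ e' W hW = 𝟙 _ := fun W hW => rs_hom_ext (by
    rw [← Category.assoc, toRs_rsDesc, Category.assoc, toRs_rsDesc, toRs_rr, Category.comp_id])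
  have hrr : ∀ (V W : Opens X) (hV : V ≤ Z) (hW : W ≤ V),
      e V hV ≫ rr (rs a Z hZ) hV hW = rr a (hV.trans hZ) hW ≫ e W (hW.trans hV) :=
    fun V W hV hW => rs_hom_ext (by
      rw [← Category.assoc, toRs_rsDesc, Category.assoc, toRs_rr, ← Category.assoc, toRs_rr,
        toRs_rsDesc])
  obtain ⟨t, ht⟩ := exists_glue M.obj.property (a := rs a Z hZ) V hV hcov
    (fun i => actM M (e _ (hV i)) (s i)) (fun i j => by
      have h1 := hrr (V i) (V i ⊓ V j) (hV i) inf_le_left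
      have h2 := hrr (V j) (V i ⊓ V j) (hV j) inf_le_right
      rw [← act_comp, ← act_comp, h1, h2, act_comp, act_comp]
      exact congrArg _ (hs i j))
  refine ⟨t, fun i => ?_⟩
  have e1 : rr a hZ (hV i) = toRs (rs a Z hZ) (V i) (hV i) ≫ e' _ (hV i) :=
    (toRs_rsDesc _ _ _).symm
  rw [e1, act_comp, ht, ← act_comp, he, act_id]

/-- Gluing of two sections. -/
lemma exists_glue_pair (M : 𝓜) {a : Tot A} {V W : Opens X} (hV : V ≤ dom a) (hW : W ≤ dom a)
    (s : M.obj.obj.obj (op (op (rs a V hV)))) (t : M.obj.obj.obj (op (op (rs a W hW))))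
    (h : actM M (rr a hV (inf_le_left : V ⊓ W ≤ V)) s =
      actM M (rr a hW (inf_le_right : V ⊓ W ≤ W)) t) :
    ∃ u : M.obj.obj.obj (op (op (rs a (V ⊔ W) (sup_le hV hW)))),
      actM M (rr a _ (le_sup_left : V ≤ V ⊔ W)) u = s ∧
        actM M (rr a _ (le_sup_right : W ≤ V ⊔ W)) u = t := by
  have hle : ∀ i, cond i V W ≤ V ⊔ W := by rintro (_ | _) <;> simp
  have h' : actM M (rr a hW (inf_le_left : W ⊓ V ≤ W)) t =
      actM M (rr a hV (inf_le_right : W ⊓ V ≤ V)) s := by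
    have e1 := rr_rr a hW (inf_le_right : V ⊓ W ≤ W) (inf_comm W V).le
    have e2 := rr_rr a hV (inf_le_left : V ⊓ W ≤ V) (inf_comm W V).le
    rw [← e1, ← e2, act_comp, act_comp]
    exact congrArg _ h.symm
  obtain ⟨u, hu⟩ := exists_glue_rs M (sup_le hV hW) (fun i : Bool => cond i V W) hle
    (fun x hx => by
      rcases hx with hx | hx
      · exact ⟨true, hx⟩
      · exact ⟨false, hx⟩)
    (fun i => match i with | true => s | false => t)
    (fun i j => by
      rcases i with (_ | _) <;> rcases j with (_ | _)
      · rfl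
      · exact h'
      · exact h
      · rfl)
  exact ⟨u, hu true, hu false⟩

/-- An `A`-module is flasque if its sections extend. -/
def IsFlasque (M : 𝓜) : Prop :=
  ∀ (a : Tot A) (V : Opens X) (hV : V ≤ dom a), Function.Surjective (actM M (toRs a V hV))

/-- The sections of a quotient by a flasque module lift. -/
lemma onSec_surjective_of_flasque [NoetherianSpace X] {S : ShortComplex 𝓜} (hS : S.ShortExact)
    (hJ : IsFlasque S.X₁) (a : Tot A) : Function.Surjective (onSec S.g a) := by
  have := hS.mono_f
  have := hS.epi_g
  intro q
  let 𝒱 : Set (Opens X) := {V | ∃ (hV : V ≤ dom a) (t : S.X₂.obj.obj.obj (op (op (rs a V hV)))),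
    onSec S.g _ t = actM S.X₃ (toRs a V hV) q}
  have hne : 𝒱.Nonempty := ⟨⊥, bot_le, 0,
    eq_of_locally_eq S.X₃.obj.property _ _ fun x hx => hx.elim⟩
  -- The ascending chain condition on open subsets provides a maximal one over which `q` lifts.
  obtain ⟨V, ⟨hV, t, ht⟩, hmax⟩ := WellFounded.has_min
    (wellFounded_gt : WellFounded ((· > ·) : Opens X → Opens X → Prop)) 𝒱 hne
  have hVtop : V = dom a := by
    refine le_antisymm hV fun x hx => ?_
    obtain ⟨W, hW, t', hxW, ht'⟩ := exists_lift_of_epi S.g q x hx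
    have hd : onSec S.g _ (actM S.X₂ (rr a hV (inf_le_left : V ⊓ W ≤ V)) t -
        actM S.X₂ (rr a hW (inf_le_right : V ⊓ W ≤ W)) t') = 0 := by
      rw [map_sub, onSec_actM, onSec_actM, ht, ht', ← act_comp, ← act_comp, toRs_rr, toRs_rr,
        sub_self]
    obtain ⟨j, hj⟩ := exists_onSec_eq_of_exact hS.exact _ hd
    -- Two lifts differ on `V ⊓ W` by a section of the kernel; extending it by flasqueness corrects
    -- `t'` so that the lifts glue.
    obtain ⟨j', rfl⟩ := hJ a (V ⊓ W) (inf_le_left.trans hV) j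
    obtain ⟨u, hu1, hu2⟩ := exists_glue_pair S.X₂ hV hW t
      (t' + onSec S.f _ (actM S.X₁ (toRs a W hW) j')) (by
        rw [map_add, ← onSec_actM, ← act_comp, toRs_rr, hj]
        abel)
    have hmem : V ⊔ W ∈ 𝒱 := by
      refine ⟨sup_le hV hW, u, ?_⟩
      refine eq_of_locally_eq_rs S.X₃ _ _ _ fun y hy => ?_
      rcases hy with hy | hy
      · refine ⟨V, le_sup_left, hy, ?_⟩
        rw [← onSec_actM, hu1, ht, ← act_comp, toRs_rr]
      · refine ⟨W, le_sup_right, hy, ?_⟩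
        rw [← onSec_actM, hu2, map_add, ht', ← act_comp, toRs_rr, ← onSec_comp, S.zero, onSec_zero,
          add_zero]
    have := hmax _ hmem
    have h3 : ¬ V < V ⊔ W := this
    rw [left_lt_sup, not_not] at h3
    exact h3 hxW
  subst hVtop
  have e : toRs a (dom a) le_rfl ≫ rsDesc le_rfl (𝟙 a) le_rfl = 𝟙 a := toRs_rsDesc _ _ _
  refine ⟨actM S.X₂ (rsDesc le_rfl (𝟙 a) le_rfl) t, ?_⟩
  rw [onSec_actM, ht, ← act_comp, e, act_id]

lemma IsFlasque.of_shortExact [NoetherianSpace X] {S : ShortComplex 𝓜} (hS : S.ShortExact)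
    (h₁ : IsFlasque S.X₁) (h₂ : IsFlasque S.X₂) : IsFlasque S.X₃ := by
  intro a V hV q
  obtain ⟨t, rfl⟩ := onSec_surjective_of_flasque hS h₁ _ q
  obtain ⟨t', rfl⟩ := h₂ a V hV t
  exact ⟨onSec S.g a t', (onSec_actM _ _ _).symm⟩

-- There is at most one inclusion between two open subsets, so the direct sum `FreeAt a b` has at
-- most one summand.
open scoped Classical in
lemma FreeAt.eq_lof {a b : Tot A} (g : a.base ⟶ b.base) (x : FreeAt a b) :
    ∃ φ, x = FreeAt.single (homMk g φ) := by
  refine ⟨x g, ?_⟩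
  ext f
  obtain rfl : f = g := Subsingleton.elim _ _
  exact (DirectSum.lof_apply Ch (M := fun f : a.base ⟶ b.base =>
    ((A.map f.toLoc).toFunctor.obj a.fiber ⟶ b.fiber)) f (x f)).symm

open scoped Classical in
lemma FreeAt.single_injective {a b : Tot A} {g : a.base ⟶ b.base}
    {φ ψ : (A.map g.toLoc).toFunctor.obj a.fiber ⟶ b.fiber}
    (h : FreeAt.single (homMk g φ) = FreeAt.single (homMk g ψ)) : φ = ψ := by
  exact DirectSum.of_injective (β := fun f : a.base ⟶ b.base =>
    ((A.map f.toLoc).toFunctor.obj a.fiber ⟶ b.fiber)) g h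

/-- The morphism of free presheaves given by the restriction of the generator. -/
def freeRes (a : Tot A) (V : Opens X) (hV : V ≤ dom a) :
    freePresheaf (rs a V hV) ⟶ freePresheaf a :=
  freePresheafDesc (isLinear_freePresheaf a) (a := rs a V hV) (FreeAt.single (toRs a V hV))

lemma freeRes_single (a : Tot A) (V : Opens X) (hV : V ≤ dom a) {b : Tot A} (k : rs a V hV ⟶ b) :
    (freeRes a V hV).app (op (op b)) (FreeAt.single k) = FreeAt.single (toRs a V hV ≫ k) := by
  refine (congrArg (fun u => u (FreeAt.single (toRs a V hV)))
    (freeEval_single (isLinear_freePresheaf a) k)).trans ?_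
  exact FreeAt.map_single _ _

/-- At (W, τ) the source is zero unless W ⊆ V, and in that case both sides are identified with the
morphisms σ|_W ⟶ τ, restriction being cocartesian. -/
lemma freeRes_injective (a : Tot A) (V : Opens X) (hV : V ≤ dom a) (b) :
    Function.Injective ((freeRes a V hV).app b) := by
  intro x y hxy
  by_cases h : Nonempty ((rs a V hV).base ⟶ b.unop.unop.base)
  · obtain ⟨g⟩ := h
    obtain ⟨φ, rfl⟩ := FreeAt.eq_lof g x
    obtain ⟨ψ, rfl⟩ := FreeAt.eq_lof g y
    rw [freeRes_single, freeRes_single] at hxy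
    have := FreeAt.single_injective (g := (homOfLE hV).op ≫ g) hxy
    have h2 : toRs a V hV ≫ homMk (a := rs a V hV) g φ =
        toRs a V hV ≫ homMk (a := rs a V hV) g ψ :=
      Pseudofunctor.Grothendieck.Hom.ext _ _ rfl (by simpa using this)
    rw [rs_hom_ext h2]
  · refine DirectSum.ext fun f => ?_
    exact (h ⟨f⟩).elim

/-- A section over V is a morphism from the free module on the restriction to V. That module embeds
in the free module on `a`, and the morphism extends by injectivity. -/
lemma isFlasque_of_injective (I : 𝓜) [Injective I] : IsFlasque I := by
  intro a V hV s
  let i : freeMod (Opens.grothendieckTopology X) (rs a V hV) ⟶ freeMod _ a :=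
    sheafModMap _ _ (freeRes a V hV)
  have : Mono i := mono_sheafModMap _ _ _ (freeRes_injective a V hV)
  refine ⟨onSec (Injective.factorThru (freeDesc s) i) a (freeGen _ a), ?_⟩
  rw [← onSec_actM]
  have e : actM (freeMod _ a) (toRs a V hV) (freeGen _ a) = onSec i _ (freeGen _ (rs a V hV)) := by
    have h := congrArg (fun u => u.app (op (op (rs a V hV))) (FreeAt.single (𝟙 (rs a V hV))))
      (toSheafMod_map (K := Opens.grothendieckTopology X) (isLinear_freePresheaf (rs a V hV))
        (isLinear_freePresheaf a) (freeRes a V hV))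
    refine Eq.trans ?_ h.symm
    refine (act_naturality (toSheafMod (Opens.grothendieckTopology X) (freePresheaf a)
      (isLinear_freePresheaf a)) (toRs a V hV) (FreeAt.single (𝟙 a))).symm.trans ?_
    refine congrArg ((toSheafMod (Opens.grothendieckTopology X) (freePresheaf a)
      (isLinear_freePresheaf a)).app _) ?_
    refine (FreeAt.map_single (𝟙 a) (toRs a V hV)).trans ?_
    refine Eq.trans ?_ (freeRes_single a V hV (𝟙 _)).symm
    rw [Category.id_comp, Category.comp_id]
  rw [e, ← onSec_comp, Injective.comp_factorThru, onSec_freeDesc]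

end Flasque

/-! ### Vanishing of Ext from `locModule` to flasque modules. -/

section ExtVanishing

open TopologicalSpace Abelian

variable {X : Type} [TopologicalSpace X] {A : LocallyDiscrete (Opens X)ᵒᵖ ⥤ᵖ Cat.{0, 0}}
  [LinearPrestack A]

local notation "𝓚" => Opens.grothendieckTopology X
local notation "𝓜" => AMod (Opens.grothendieckTopology X) A

/-- The sections of an `A`-module are divisible by `ħ`. -/
def IsDivisible (M : 𝓜) : Prop :=
  ∀ (a : Tot A) (s : M.obj.obj.obj (op (op a))), ∃ t, hbar • t = s

/-- The morphism from a free module defined by `s` extends along multiplication by ħ, a monomorphism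
by `hT`; the image of the generator under the extension is a quotient of `s` by ħ. -/
lemma isDivisible_of_injective
    (hT : ∀ a : Tot A, Mono ((hbarMap 𝓚 A).app (freeMod 𝓚 a))) (I : 𝓜) [Injective I] :
    IsDivisible I := by
  intro a s
  have := hT a
  let g : freeMod 𝓚 a ⟶ I := Injective.factorThru (freeDesc s) ((hbarMap 𝓚 A).app (freeMod 𝓚 a))
  have hg : (hbarMap 𝓚 A).app (freeMod 𝓚 a) ≫ g = freeDesc s := Injective.comp_factorThru _ _
  refine ⟨onSec g a (freeGen 𝓚 a), ?_⟩
  have h := congrArg (fun u => onSec u a (freeGen 𝓚 a)) hg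
  rw [onSec_freeDesc] at h
  rw [← h, onSec_comp, onSec_hbarMap, map_smul]

lemma IsDivisible.of_shortExact [NoetherianSpace X] {S : ShortComplex 𝓜} (hS : S.ShortExact)
    (h₁ : IsFlasque S.X₁) (h₂ : IsDivisible S.X₂) : IsDivisible S.X₃ := by
  intro a q
  obtain ⟨s, rfl⟩ := onSec_surjective_of_flasque hS h₁ a q
  obtain ⟨t, rfl⟩ := h₂ a s
  exact ⟨onSec S.g a t, (map_smul _ _ _).symm⟩

/-- Morphisms from `locModule 𝓚 a` lift to extensions by flasque divisible modules. -/
lemma exists_lift_locModule [NoetherianSpace X] {S : ShortComplex 𝓜} (hS : S.ShortExact)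
    (h₁ : IsFlasque S.X₁) (h₁' : IsDivisible S.X₁) {a : Tot A} (f : locModule 𝓚 a ⟶ S.X₃) :
    ∃ g : locModule 𝓚 a ⟶ S.X₂, g ≫ S.g = f := by
  have := hS.mono_f
  let q (n : ℕ) := onSec f a (locGen 𝓚 a n)
  have hq (n : ℕ) : hbar • q (n + 1) = q n := by
    rw [← map_smul, hbar_smul_locGen]
  -- For any lift `u` of `q (n + 1)`, the section `hbar • u - t` comes from the kernel. Dividing it
  -- by ħ there corrects `u` without changing its image.
  have step : ∀ (n : ℕ) (t : S.X₂.obj.obj.obj (op (op a))), onSec S.g a t = q n →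
      ∃ t', onSec S.g a t' = q (n + 1) ∧ hbar • t' = t := by
    intro n t ht
    obtain ⟨u, hu⟩ := onSec_surjective_of_flasque hS h₁ a (q (n + 1))
    obtain ⟨j, hj⟩ := exists_onSec_eq_of_exact hS.exact (a := a) (hbar • u - t)
      (by rw [map_sub, map_smul, hu, ht, hq, sub_self])
    obtain ⟨j', rfl⟩ := h₁' a j
    refine ⟨u - onSec S.f a j', ?_, ?_⟩
    · rw [map_sub, hu, ← onSec_comp, S.zero, onSec_zero, sub_zero]
    · rw [smul_sub, ← map_smul, hj, sub_sub_cancel]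
  obtain ⟨t₀, ht₀⟩ := onSec_surjective_of_flasque hS h₁ a (q 0)
  choose! nx hnx hnx' using step
  let t (n : ℕ) : S.X₂.obj.obj.obj (op (op a)) := n.rec t₀ nx
  have ht (n : ℕ) : onSec S.g a (t n) = q n := by
    induction n with
    | zero => exact ht₀
    | succ n ih => exact hnx n _ ih
  refine ⟨locDesc t fun n => hnx' n _ (ht n), locModule_hom_ext fun n => ?_⟩
  exact (congrArg (onSec S.g a) (locDesc_locGen t _ n)).trans (ht n)

/-- The short exact sequence of an embedding into an injective module. -/
abbrev underSeq (M : 𝓜) : ShortComplex 𝓜 :=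
  ShortComplex.mk (Injective.ι M) (cokernel.π (Injective.ι M)) (cokernel.condition _)

lemma underSeq_shortExact (M : 𝓜) : (underSeq M).ShortExact where
  exact := ShortComplex.exact_cokernel _
  mono_f := inferInstanceAs (Mono (Injective.ι M))
  epi_g := inferInstanceAs (Epi (cokernel.π _))

variable [HasExt.{w} (AMod (Opens.grothendieckTopology X) A)]

lemma ext_eq_zero_of_shortExact {S : ShortComplex 𝓜} (hS : S.ShortExact) (L : 𝓜) (n : ℕ)
    (h₂ : ∀ x : Ext.{w} L S.X₂ (n + 1), x = 0) (h₃ : ∀ x : Ext.{w} L S.X₃ n, x = 0)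
    (x : Ext.{w} L S.X₁ (n + 1)) : x = 0 := by
  obtain ⟨y, rfl⟩ := Ext.covariant_sequence_exact₁ L hS x (h₂ _) rfl
  rw [h₃ y, Ext.zero_comp]

/-- When Q is embedded in an injective module, the quotient is again flasque and divisible.
Dimension shifting therefore leaves only Ext^1, which `exists_lift_locModule` kills. -/
lemma ext_eq_zero_of_flasque_of_divisible [NoetherianSpace X]
    (hT : ∀ a : Tot A, Mono ((hbarMap 𝓚 A).app (freeMod 𝓚 a))) (n : ℕ) :
    ∀ (Q : 𝓜) (_ : IsFlasque Q) (_ : IsDivisible Q) (a : Tot A)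
      (x : Ext.{w} (locModule 𝓚 a) Q (n + 1)), x = 0 := by
  induction n with
  | zero =>
    intro Q h h' a x
    have hS := underSeq_shortExact Q
    obtain ⟨y, rfl⟩ := Ext.covariant_sequence_exact₁ (locModule 𝓚 a) hS x
      (Ext.eq_zero_of_injective (I := Injective.under Q) _) rfl
    obtain ⟨f, rfl⟩ := (Ext.mk₀_bijective _ _).2 y
    obtain ⟨g, rfl⟩ := exists_lift_locModule hS h h' f
    rw [← Ext.mk₀_comp_mk₀, Ext.comp_assoc_of_second_deg_zero, hS.comp_extClass, Ext.comp_zero]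
  | succ n ih =>
    intro Q h h' a x
    have hS := underSeq_shortExact Q
    refine ext_eq_zero_of_shortExact hS _ (n + 1)
      (fun y => Ext.eq_zero_of_injective (I := Injective.under Q) y) ?_ x
    exact ih _ (IsFlasque.of_shortExact hS h (isFlasque_of_injective (Injective.under Q)))
      (IsDivisible.of_shortExact hS h (isDivisible_of_injective hT (Injective.under Q))) a

/-- The quotient of an injective module by F is flasque and also divisible, whether or not F is
divisible. The one degree lost reflects the projective dimension 1 of ℂ((ħ)) over ℂ[[ħ]]. -/
lemma ext_eq_zero_of_flasque [NoetherianSpace X]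
    (hT : ∀ a : Tot A, Mono ((hbarMap 𝓚 A).app (freeMod 𝓚 a))) (n : ℕ) (F : 𝓜) (hF : IsFlasque F)
    (a : Tot A) (x : Ext.{w} (locModule 𝓚 a) F (n + 2)) : x = 0 := by
  have hS := underSeq_shortExact F
  refine ext_eq_zero_of_shortExact hS _ (n + 1)
    (fun y => Ext.eq_zero_of_injective (I := Injective.under F) y) ?_ x
  exact ext_eq_zero_of_flasque_of_divisible hT n _
    (IsFlasque.of_shortExact hS hF (isFlasque_of_injective (Injective.under F)))
    (IsDivisible.of_shortExact hS hF (isDivisible_of_injective hT (Injective.under F))) a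

end ExtVanishing

/-! ### Filtration by codimension and the projective dimension of `locModule`. -/

section Cousin

open TopologicalSpace Abelian

variable {X : Type} [TopologicalSpace X] {A : LocallyDiscrete (Opens X)ᵒᵖ ⥤ᵖ Cat.{0, 0}}
  [LinearPrestack A]

local notation "𝓚" => Opens.grothendieckTopology X
local notation "𝓜" => AMod (Opens.grothendieckTopology X) A

variable (δ : X → ℕ)

/-- The sections of `G` vanish near the points `x` with `δ x < k`. -/
def VanishesBelow (k : ℕ) (G : 𝓜) : Prop :=
  ∀ (a : Tot A) (s : G.obj.obj.obj (op (op a))) (x : X), x ∈ dom a → δ x < k →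
    ∃ (V : Opens X) (hV : V ≤ dom a), x ∈ V ∧ actM G (toRs a V hV) s = 0

variable {δ} {G I : AMod (Opens.grothendieckTopology X) A} (i : G ⟶ I) (k : ℕ)

variable (δ) in
/-- The submodules of the sections of `I` which belong to `G` near the points `x` with
`δ x ≤ k`. -/
def cousinFamily : SubFamily I.obj.obj where
  carrier a :=
    { carrier := {s | ∀ x ∈ dom a, δ x ≤ k → ∃ (V : Opens X) (hV : V ≤ dom a)
        (t : G.obj.obj.obj (op (op (rs a V hV)))), x ∈ V ∧
          onSec i _ t = actM I (toRs a V hV) s}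
      add_mem' := by
        intro s s' hs hs' x hx hk
        obtain ⟨V, hV, t, hxV, ht⟩ := hs x hx hk
        obtain ⟨V', hV', t', hxV', ht'⟩ := hs' x hx hk
        refine ⟨V ⊓ V', inf_le_left.trans hV, actM G (rr a hV inf_le_left) t +
          actM G (rr a hV' inf_le_right) t', ⟨hxV, hxV'⟩, ?_⟩
        rw [map_add, onSec_actM, onSec_actM, ht, ht', ← act_comp, ← act_comp, toRs_rr, toRs_rr,
          map_add]
      zero_mem' := fun x hx hk => ⟨dom a, le_rfl, 0, hx, by rw [map_zero, map_zero]⟩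
      smul_mem' := by
        intro c s hs x hx hk
        obtain ⟨V, hV, t, hxV, ht⟩ := hs x hx hk
        exact ⟨V, hV, c • t, hxV, by rw [map_smul, ht, map_smul]⟩ }
  act_mem {a b} h s hs := by
    intro x hx hk
    obtain ⟨V, hV, t, hxV, ht⟩ := hs x (leOfHom h.base.unop hx) hk
    refine ⟨V ⊓ dom b, inf_le_right,
      actM G (rsDesc hV (h ≫ toRs b (V ⊓ dom b) inf_le_right) inf_le_left) t, ⟨hxV, hx⟩, ?_⟩
    rw [onSec_actM, ht, ← act_comp, toRs_rsDesc, act_comp]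

lemma cousinFamily_isLocal : (cousinFamily δ i k).IsLocal 𝓚 := by
  intro a S hS s hs x hx hk
  obtain ⟨V, g, hg, hxV⟩ := hS x hx
  have hV : V ≤ dom a := leOfHom g
  obtain ⟨W, hW, t, hxW, ht⟩ := hs _ (toRs a V hV) hg x hxV hk
  have hW' : W ≤ V := hW
  refine ⟨W, hW'.trans hV, actM G (rsDesc hW (rr a hV hW') le_rfl) t, hxW, ?_⟩
  rw [onSec_actM, ht, ← act_comp, ← act_comp, toRs_rsDesc, toRs_rr]

/-- The submodule of `I` of the sections which belong to `G` near the points `x` with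
`δ x ≤ k`. -/
def cousin (δ : X → ℕ) (i : G ⟶ I) (k : ℕ) : 𝓜 :=
  ⟨⟨(cousinFamily δ i k).presheaf,
    (cousinFamily δ i k).isSheaf I.obj.property (cousinFamily_isLocal i k)⟩,
    IsLinear.of_injective (cousinFamily δ i k).incl (cousinFamily δ i k).incl_injective I.property⟩

/-- The inclusion of `cousin δ i k` in `I`. -/
def cousinι : cousin δ i k ⟶ I := ObjectProperty.homMk ⟨(cousinFamily δ i k).incl⟩

/-- The morphism from `G` to `cousin δ i k`. -/
def toCousin (δ : X → ℕ) (i : G ⟶ I) (k : ℕ) : G ⟶ cousin δ i k :=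
  ObjectProperty.homMk ⟨
    { app := fun a => ModuleCat.ofHom ((i.hom.hom.app a).hom.codRestrict _ fun s x hx _ =>
        ⟨dom a.unop.unop, le_rfl, actM G (toRs _ _ le_rfl) s, hx, onSec_actM i _ s⟩)
      naturality := fun a b h => by
        ext s
        exact Subtype.ext (act_naturality i.hom.hom h.unop.unop s) }⟩

lemma toCousin_ι : toCousin δ i k ≫ cousinι i k = i := rfl

instance [Mono i] : Mono (toCousin δ i k) := mono_of_mono_fac (toCousin_ι i k)

/-- A section `s` over V belongs to G, hence vanishes, near the points with δ < k, so the generic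
points of its support have δ ≥ k. Points of the closure of the support outside V are strict
specializations of these, so δ > k there and membership in `cousin` imposes no condition. Thus `s`
may be extended by zero off the closure of its support, and then arbitrarily by flasqueness of I. -/
lemma isFlasque_cousin [NoetherianSpace X] [QuasiSober X]
    (hδ : ∀ x y : X, x ⤳ y → x ≠ y → δ x < δ y) (hI : IsFlasque I) (hG : VanishesBelow δ k G) :
    IsFlasque (cousin δ i k) := by
  rintro a V hV ⟨s, hs⟩
  have hs' : ∀ x ∈ V, δ x ≤ k → ∃ (W : Opens X) (hW : W ≤ V)
      (t : G.obj.obj.obj (op (op (rs a W (hW.trans hV))))), x ∈ W ∧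
        onSec i _ t = actM I (rr a hV hW) s := by
    intro x hx hk
    obtain ⟨W, hW, t, hxW, ht⟩ := hs x hx hk
    refine ⟨W, hW, actM G (rsDesc hW (rr a hV hW) le_rfl) t, hxW, ?_⟩
    rw [onSec_actM, ht, ← act_comp, toRs_rsDesc]
  let 𝒰 : Set (Opens X) := {W | ∃ hW : W ≤ V, actM I (rr a hV hW) s = 0}
  -- `F` also contains the complement of `V`: it is closed in `X`, and the support of `s` is `V ∩
  -- F`.
  let F : Set X := {x | ∀ W ∈ 𝒰, x ∉ W}
  have hF : IsClosed F := by
    have : F = ((sSup 𝒰 : Opens X) : Set X)ᶜ := by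
      ext x
      simp [F]
    rw [this]
    exact (sSup 𝒰).2.isClosed_compl
  have hbound : ∀ x ∈ closure ((V : Set X) ∩ F), x ∉ V → k < δ x := by
    intro x hx hxV
    -- `x` lies in the closure of `V ∩ t` for one of finitely many irreducible closed `t`; the
    -- generic point `z` of `t` lies in `V` and specializes to `x`.
    obtain ⟨T, hTf, hTc, hTi, hTF⟩ := NoetherianSpace.exists_finite_set_isClosed_irreducible hF
    have e : (V : Set X) ∩ F = ⋃ t ∈ T, (V : Set X) ∩ t := by
      rw [hTF, Set.sUnion_eq_biUnion, Set.inter_iUnion₂]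
    rw [e, hTf.closure_biUnion] at hx
    simp only [Set.mem_iUnion] at hx
    obtain ⟨t, ht, hxt⟩ := hx
    have hne : ((V : Set X) ∩ t).Nonempty := by
      rw [← closure_nonempty_iff]
      exact ⟨x, hxt⟩
    obtain ⟨z, hz⟩ := QuasiSober.sober (hTi t ht) (hTc t ht)
    have hzV : z ∈ V := (hz.mem_open_set_iff V.2).2 (by rwa [Set.inter_comm])
    have hzx : z ⤳ x := hz.specializes (closure_minimal Set.inter_subset_right (hTc t ht) hxt)
    have hlt := hδ z x hzx fun h => hxV (h ▸ hzV)
    refine lt_of_not_ge fun hk => ?_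
    obtain ⟨W, hW, u, hzW, hu⟩ := hs' z hzV (hlt.le.trans hk)
    obtain ⟨W', hW', hzW', hu'⟩ := hG _ u z hzW (hlt.trans_le hk)
    have hW'' : W' ≤ W := hW'
    have hzF : z ∈ F := hTF ▸ Set.mem_sUnion_of_mem hz.mem ht
    refine hzF W' ⟨hW''.trans hW, ?_⟩ hzW'
    have e1 : rr a hV (hW''.trans hW) = rr a hV hW ≫ toRs _ W' hW' ≫
        rsDesc hW' (rr a (hW.trans hV) hW'') le_rfl := by rw [toRs_rsDesc, rr_rr]
    rw [e1, act_comp, act_comp, ← hu, ← onSec_actM, hu', map_zero, map_zero]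
  -- On this complement of the closure of the support, the extension is declared to be zero.
  let W : Opens X := dom a ⊓ ⟨(closure ((V : Set X) ∩ F))ᶜ, isClosed_closure.isOpen_compl⟩
  have hW : W ≤ dom a := inf_le_left
  obtain ⟨u, hu1, hu2⟩ := exists_glue_pair I hV hW s 0 (by
    rw [map_zero]
    refine eq_of_locally_eq_rs I _ _ _ fun x hx => ?_
    have hxF : x ∉ F := fun h => hx.2.2 (subset_closure ⟨hx.1, h⟩)
    simp only [F, Set.mem_ofPred_eq, not_forall, not_not] at hxF
    obtain ⟨W', ⟨hW'V, e0⟩, hxW'⟩ := hxF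
    refine ⟨W' ⊓ (V ⊓ W), inf_le_right, ⟨hxW', hx⟩, ?_⟩
    rw [map_zero, ← act_comp, rr_rr, ← rr_rr a hV hW'V inf_le_left, act_comp, e0, map_zero])
  obtain ⟨s', hs'2⟩ := hI a _ (sup_le hV hW) u
  have hsV : actM I (toRs a V hV) s' = s := by
    rw [← toRs_rr a (sup_le hV hW) le_sup_left, act_comp, hs'2, hu1]
  have hsW : actM I (toRs a W hW) s' = 0 := by
    rw [← toRs_rr a (sup_le hV hW) le_sup_right, act_comp, hs'2, hu2]
  refine ⟨⟨s', fun x hx hk => ?_⟩, Subtype.ext hsV⟩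
  by_cases hxV : x ∈ V
  · obtain ⟨W', hW', t, hxW', ht⟩ := hs' x hxV hk
    refine ⟨W', hW'.trans hV, t, hxW', ?_⟩
    rw [ht, ← hsV, ← act_comp, toRs_rr]
  · have hxW : x ∈ W := ⟨hx, fun h => (hbound x h hxV).not_ge hk⟩
    exact ⟨W, hW, 0, hxW, by rw [map_zero, hsW]⟩

/-- Near a point with δ ≤ k every section of `cousin` comes from G and dies in the quotient, so each
step of the resolution gains one codimension. -/
lemma vanishesBelow_cokernel_toCousin :
    VanishesBelow δ (k + 1) (cokernel (toCousin δ i k)) := by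
  intro a q x hx hk
  obtain ⟨V, hV, s, hxV, e⟩ := exists_lift_of_epi (cokernel.π (toCousin δ i k)) q x hx
  obtain ⟨W, hW, t, hxW, ht⟩ :=
    (show s.1 ∈ (cousinFamily δ i k).carrier (rs a V hV) from s.2) x hxV (Nat.lt_succ_iff.1 hk)
  have hW' : W ≤ V := hW
  refine ⟨W, hW'.trans hV, hxW, ?_⟩
  have e1 : onSec (toCousin δ i k) _ t = actM (cousin δ i k) (toRs _ W hW) s :=
    Subtype.ext ht
  have e2 : toRs a W (hW'.trans hV) = toRs a V hV ≫ toRs _ W hW ≫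
      rsDesc hW (rr a hV hW') le_rfl := by rw [toRs_rsDesc, toRs_rr]
  rw [e2, act_comp, act_comp, ← e, ← onSec_actM, ← e1, ← onSec_comp, cokernel.condition,
    onSec_zero, map_zero]

lemma id_eq_zero_of_vanishesBelow (h : ∀ x, δ x < k) (hG : VanishesBelow δ k G) : 𝟙 G = 0 := by
  refine hom_eq_zero_of_onSec _ fun a s => ?_
  refine eq_of_locally_eq G.obj.property _ _ fun x hx => ?_
  obtain ⟨V, hV, hxV, e⟩ := hG a s x hx (h x)
  exact ⟨V, hV, hxV, e.trans (map_zero _).symm⟩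

variable [HasExt.{w} (AMod (Opens.grothendieckTopology X) A)] [NoetherianSpace X] [QuasiSober X]

/-- Descending induction on k, starting at k = d + 1 where G = 0. The embedding of G in `cousin` has
a cokernel one codimension deeper, and the flasque module `cousin` contributes nothing to Ext in
degrees at least 2. -/
lemma ext_eq_zero_of_vanishesBelow (hT : ∀ a : Tot A, Mono ((hbarMap 𝓚 A).app (freeMod 𝓚 a)))
    (hδ : ∀ x y : X, x ⤳ y → x ≠ y → δ x < δ y) {d : ℕ} (hd : ∀ x, δ x ≤ d) (m : ℕ) :
    ∀ (k : ℕ) (_ : k + m = d + 1) (G : 𝓜) (_ : VanishesBelow δ k G) (a : Tot A) (n : ℕ) (_ : m < n)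
      (x : Ext.{w} (locModule 𝓚 a) G n), x = 0 := by
  induction m with
  | zero =>
    intro k hk G hG a n hn x
    have h0 : 𝟙 G = 0 :=
      id_eq_zero_of_vanishesBelow k (fun x => lt_of_le_of_lt (hd x) (by lia)) hG
    rw [← x.comp_mk₀_id, h0, Ext.mk₀_zero, Ext.comp_zero]
  | succ m ih =>
    intro k hk G hG a n hn x
    obtain ⟨n, rfl⟩ : ∃ l, n = l + 2 := ⟨n - 2, by lia⟩
    let S : ShortComplex 𝓜 := ShortComplex.mk (toCousin δ (Injective.ι G) k)
      (cokernel.π _) (cokernel.condition _)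
    have hS : S.ShortExact :=
      { exact := ShortComplex.exact_cokernel _
        mono_f := inferInstanceAs (Mono (toCousin δ (Injective.ι G) k))
        epi_g := inferInstanceAs (Epi (cokernel.π _)) }
    refine ext_eq_zero_of_shortExact hS _ (n + 1) ?_ ?_ x
    · exact ext_eq_zero_of_flasque hT n _
        (isFlasque_cousin _ k hδ (isFlasque_of_injective (Injective.under G)) hG) a
    · exact ih (k + 1) (by lia) _ (vanishesBelow_cokernel_toCousin _ k) a (n + 1) (by lia)

/-- The modules `locModule 𝓚 a` have bounded projective dimension. -/
lemma ext_locModule_eq_zero (hT : ∀ a : Tot A, Mono ((hbarMap 𝓚 A).app (freeMod 𝓚 a)))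
    (hδ : ∀ x y : X, x ⤳ y → x ≠ y → δ x < δ y) {d : ℕ} (hd : ∀ x, δ x ≤ d)
    (G : 𝓜) (a : Tot A) (n : ℕ) (hn : d + 1 < n) (x : Ext.{w} (locModule 𝓚 a) G n) : x = 0 :=
  ext_eq_zero_of_vanishesBelow hT hδ hd (d + 1) 0 (by lia) G
    (fun _ _ _ _ h => (Nat.not_lt_zero _ h).elim) a n hn x

end Cousin

/-! ### Schemes of finite type over ℂ have bounded codimension. -/

section Dimension

/-- R is a quotient of a polynomial ring in n variables over ℂ, which has dimension n. -/
lemma exists_ringKrullDim_le {R : Type} [CommRing R] (φ : ℂ →+* R) (hφ : φ.FiniteType) :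
    ∃ n : ℕ, ringKrullDim R ≤ n := by
  let := φ.toAlgebra
  have : Algebra.FiniteType ℂ R := hφ
  obtain ⟨n, g, hg⟩ := Algebra.FiniteType.iff_quotient_mvPolynomial''.1 this
  refine ⟨n, (ringKrullDim_le_of_surjective g.toRingHom hg).trans ?_⟩
  rw [MvPolynomial.ringKrullDim_of_isNoetherianRing, ringKrullDim_eq_zero_of_field]
  simp

variable {X : Scheme.{0}} (f : X ⟶ Spec (.of ℂ))

/-- On an affine open subset the coheight of a point is the height of its prime ideal, bounded by
the Krull dimension; quasi-compactness makes the bound uniform. -/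
lemma exists_coheight_le_of_finiteType [LocallyOfFiniteType f] [CompactSpace X] :
    ∃ d : ℕ, ∀ x : X, Order.coheight x ≤ d := by
  suffices h : ∃ d : ℕ, ∀ x ∈ (Set.univ : Set X), Order.coheight x ≤ d by
    obtain ⟨d, hd⟩ := h
    exact ⟨d, fun x => hd x trivial⟩
  refine isCompact_univ.induction_on (p := fun s => ∃ d : ℕ, ∀ x ∈ s, Order.coheight x ≤ d)
    ⟨0, fun _ h => h.elim⟩ (fun s t hst ⟨d, hd⟩ => ⟨d, fun x hx => hd x (hst hx)⟩) ?_ ?_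
  · rintro s t ⟨d, hd⟩ ⟨e, he⟩
    refine ⟨max d e, ?_⟩
    rintro x (hx | hx)
    · exact (hd x hx).trans (by exact_mod_cast le_max_left d e)
    · exact (he x hx).trans (by exact_mod_cast le_max_right d e)
  · intro x _
    obtain ⟨R, g, hg, hsub⟩ := Scheme.exists_affine_mem_range_and_range_subset
      (show x ∈ (⊤ : X.Opens) from trivial)
    refine ⟨Set.range g, mem_nhdsWithin_of_mem_nhds (g.isOpenEmbedding.isOpen_range.mem_nhds hsub.1),
      ?_⟩
    have h : LocallyOfFiniteType (Spec.map (Spec.preimage (g ≫ f))) := by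
      rw [Spec.map_preimage]
      infer_instance
    rw [HasRingHomProperty.Spec_iff (P := @LocallyOfFiniteType)] at h
    obtain ⟨n, hn⟩ := exists_ringKrullDim_le _ h
    refine ⟨n, ?_⟩
    rintro _ ⟨y, rfl⟩
    refine (coheight_eq_of_isOpenImmersion g).trans_le ?_
    rw [← idealHeight_eq_coheight]
    have : y.asIdeal.IsPrime := y.isPrime
    have := (Ideal.height_le_ringKrullDim_of_isPrime (I := y.asIdeal)).trans hn
    exact_mod_cast this

/-- The points of a scheme of finite type over `ℂ` have bounded codimension. -/
lemma exists_codimension [LocallyOfFiniteType f] [CompactSpace X] :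
    ∃ (δ : X → ℕ) (d : ℕ), (∀ x y : X, x ⤳ y → x ≠ y → δ x < δ y) ∧ ∀ x, δ x ≤ d := by
  obtain ⟨d, hd⟩ := exists_coheight_le_of_finiteType f
  have hfin (x : X) : Order.coheight x ≠ ⊤ := ((hd x).trans_lt (ENat.natCast_lt_top d)).ne
  refine ⟨fun x => (Order.coheight x).toNat, d, fun x y hxy hne => ?_, fun x => ?_⟩
  -- A point is smaller in this order when it is more special, so coheight measures codimension.
  · have hle : y ≤ x := hxy
    have hlt : y < x := lt_of_le_not_ge hle fun h => hne (hxy.antisymm h).eq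
    have h := Order.coheight_strictAnti hlt (lt_top_iff_ne_top.2 (hfin x))
    rw [← ENat.natCast_toNat (hfin x), ← ENat.natCast_toNat (hfin y)] at h
    exact_mod_cast h
  · exact ENat.toNat_le_of_le_natCast (hd x)

lemma noetherianSpace_of_finiteType [LocallyOfFiniteType f] [CompactSpace X] :
    TopologicalSpace.NoetherianSpace X := by
  have : AlgebraicGeometry.IsNoetherian X :=
    { __ := LocallyOfFiniteType.isLocallyNoetherian f }
  infer_instance

end Dimension

/-! ### Absence of ħ-torsion in a DQ-algebroid and in its free modules. -/

section TorsionFree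

variable {X : Scheme.{0}} {f : X ⟶ Spec (.of ℂ)} {A : LocallyDiscrete X.Opensᵒᵖ ⥤ᵖ Cat.{0, 0}}

/-- The morphisms of a stack are determined by their restrictions to a covering. -/
lemma hom_eq_of_locally_eq (h : A.IsStack (Opens.grothendieckTopology X)) {U : X.Opens}
    {σ τ : A.obj ⟨op U⟩} (φ ψ : σ ⟶ τ)
    (hφ : ∀ x ∈ U, ∃ (V : X.Opens) (hV : V ≤ U), x ∈ V ∧
      (A.map (homOfLE hV).op.toLoc).toFunctor.map φ =
        (A.map (homOfLE hV).op.toLoc).toFunctor.map ψ) : φ = ψ := by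
  choose V hV hxV e using hφ
  let g (x : U) : V x.1 x.2 ⟶ U := homOfLE (hV x.1 x.2)
  have hg : Sieve.ofArrows _ g ∈ Opens.grothendieckTopology X U := fun x hx =>
    ⟨V x hx, g ⟨x, hx⟩, Sieve.ofArrows_mk _ g (⟨x, hx⟩ : U), hxV x hx⟩
  refine (A.fullyFaithfulToDescentData g hg).map_injective ?_
  ext x
  exact e x.1 x.2

variable [LinearPrestack A]

/-- The morphisms of a DQ-algebroid have no `ħ`-torsion. -/
lemma hom_eq_zero_of_hbar_smul (hA : IsDQAlgebroid f A) {U : X.Opens} {σ τ : A.obj ⟨op U⟩}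
    (φ : σ ⟶ τ) (hφ : hbar • φ = 0) : φ = 0 := by
  refine hom_eq_of_locally_eq hA.isStack φ 0 fun x hx => ?_
  obtain ⟨W, hW, hxW, ⟨i⟩⟩ := hA.locally_iso U σ τ x hx
  obtain ⟨V, hV, hxV, S, ⟨t⟩⟩ := hA.locally_star W (restr hW σ) x hxW
  let F := (A.map (homOfLE hW).op.toLoc).toFunctor
  let G := (A.map (homOfLE hV).op.toLoc).toFunctor
  have hF : ∀ {M N : A.obj ⟨op U⟩}, F.map (0 : M ⟶ N) = 0 := fun {M N} => by
    have := LinearPrestack.map_smul (A := A) (homOfLE hW).op (0 : Ch) (0 : M ⟶ N)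
    simpa using this
  have hG : ∀ {M N : A.obj ⟨op W⟩}, G.map (0 : M ⟶ N) = 0 := fun {M N} => by
    have := LinearPrestack.map_smul (A := A) (homOfLE hV).op (0 : Ch) (0 : M ⟶ N)
    simpa using this
  -- A local isomorphism between σ and τ turns φ into an endomorphism, that is, into a formal power
  -- series, on which ħ acts injectively.
  let u : restr hV (restr hW σ) ⟶ restr hV (restr hW σ) := G.map (F.map φ) ≫ G.map i.inv
  have hu : hbar • u = 0 := by
    have e1 : hbar • u = (hbar • G.map (F.map φ)) ≫ G.map i.inv := (Linear.smul_comp ..).symm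
    have e2 : hbar • G.map (F.map φ) = G.map (hbar • F.map φ) :=
      (LinearPrestack.map_smul (A := A) (homOfLE hV).op _ _).symm
    have e3 : hbar • F.map φ = F.map (hbar • φ) :=
      (LinearPrestack.map_smul (A := A) (homOfLE hW).op _ _).symm
    rw [e1, e2, e3, hφ, hF, hG, zero_comp]
  have hu0 : u = 0 := by
    refine (t.equiv V le_rfl).injective ?_
    have h := t.map_smul V le_rfl hbar u
    rw [hu, map_zero, PowerSeries.map_X] at h
    rw [map_zero]
    exact (PowerSeries.X_mul_cancel (h.symm.trans (mul_zero _).symm))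
  have hGF : G.map (F.map φ) = 0 := by
    have : G.map (F.map φ) = u ≫ G.map i.hom := by
      simp only [u, Category.assoc, ← G.map_comp]
      simp
    rw [this, hu0, zero_comp]
  refine ⟨V, hV.trans hW, hxV, ?_⟩
  have nat : ∀ ψ : σ ⟶ τ, (A.map (homOfLE (hV.trans hW)).op.toLoc).toFunctor.map ψ =
      (A.mapComp (homOfLE hW).op.toLoc (homOfLE hV).op.toLoc).hom.toNatTrans.app σ ≫
        G.map (F.map ψ) ≫
        (A.mapComp (homOfLE hW).op.toLoc (homOfLE hV).op.toLoc).inv.toNatTrans.app τ := by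
    intro ψ
    have n1 := (A.mapComp (homOfLE hW).op.toLoc (homOfLE hV).op.toLoc).hom.toNatTrans.naturality ψ
    have n2 := congrArg (fun k => k.toNatTrans.app τ)
      (A.mapComp (homOfLE hW).op.toLoc (homOfLE hV).op.toLoc).hom_inv_id
    refine Eq.trans ?_ (Category.assoc _ _ _)
    refine Eq.trans ?_ (congrArg (· ≫ _) n1)
    refine Eq.trans ?_ (Category.assoc _ _ _).symm
    refine Eq.trans ?_ (congrArg (_ ≫ ·) n2.symm)
    exact (Category.comp_id _).symm
  rw [nat φ, nat 0, hGF, hF, hG]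

lemma FreeAt.eq_zero_of_hbar_smul (hA : IsDQAlgebroid f A) {a b : Tot A} (x : FreeAt a b)
    (hx : hbar • x = 0) : x = 0 := by
  refine DirectSum.ext fun g => ?_
  exact hom_eq_zero_of_hbar_smul hA _ (congrArg (fun y : FreeAt a b => y g) hx)

/-- Sheafification preserves monomorphisms, so it suffices that ħ is injective on the free presheaf,
a direct sum of modules of morphisms of `A`. -/
lemma mono_hbarMap_freeMod (hA : IsDQAlgebroid f A) (a : Tot A) :
    Mono ((hbarMap (Opens.grothendieckTopology X) A).app (freeMod _ a)) := by
  let η : freePresheaf a ⟶ freePresheaf a :=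
    { app := fun b => ModuleCat.ofHom (hbar • LinearMap.id)
      naturality := fun b c g => ModuleCat.hom_ext (LinearMap.ext fun x =>
        (map_smul (act (freePresheaf a) g.unop.unop) hbar x).symm) }
  have hη : ∀ b, Function.Injective (η.app b) := by
    intro b
    refine (injective_iff_map_eq_zero (η.app b).hom).2 fun x hx => ?_
    exact FreeAt.eq_zero_of_hbar_smul hA x hx
  have e : (hbarMap (Opens.grothendieckTopology X) A).app (freeMod _ a) =
      sheafModMap (isLinear_freePresheaf a) (isLinear_freePresheaf a) η := by
    refine sheafMod_hom_ext ?_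
    refine Eq.trans ?_ (toSheafMod_map _ _ η).symm
    refine NatTrans.ext (funext fun b => ModuleCat.hom_ext (LinearMap.ext fun x => ?_))
    exact (map_smul ((toSheafMod _ _ (isLinear_freePresheaf a)).app b).hom hbar x).symm
  rw [e]
  exact mono_sheafModMap _ _ η hη

end TorsionFree

/-! ### Endomorphisms θ of an identity functor, to be applied with θ = ħ. -/

section EndomorphismOfIdentity

universe v u

variable {𝓒 : Type u} [Category.{v} 𝓒] (θ : 𝟭 𝓒 ⟶ 𝟭 𝓒)

lemma mono_app_of_mono {M N : 𝓒} (f : M ⟶ N) [Mono f] (h : Mono (θ.app N)) :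
    Mono (θ.app M) := by
  have e : θ.app M ≫ f = f ≫ θ.app N := (θ.naturality f).symm
  have : Mono (θ.app M ≫ f) := by
    rw [e]
    exact mono_comp _ _
  exact mono_of_mono _ f

lemma isIso_app_of_iso {M N : 𝓒} (f : M ≅ N) (h : IsIso (θ.app M)) : IsIso (θ.app N) := by
  have e : θ.app N = f.inv ≫ θ.app M ≫ f.hom := by
    rw [Iso.eq_inv_comp]
    exact θ.naturality f.hom
  rw [e]
  infer_instance

end EndomorphismOfIdentity

/-! ### Functorial covers by objects without θ-torsion. -/

section TorsionFreeCover

variable {𝓒 : Type 1} [Category.{0} 𝓒] (θ : 𝟭 𝓒 ⟶ 𝟭 𝓒) {ι : Type} (P : ι → 𝓒)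

open ZeroObject

variable [HasColimitsOfSize.{0, 0} 𝓒]

/-- The inclusion of a summand of the sum of the `P i`, over all the morphisms from `P i`
to `M`. -/
def sumCoverι {M : 𝓒} {i : ι} (f : P i ⟶ M) : P i ⟶ ∐ fun p : Σ i, (P i ⟶ M) => P p.1 :=
  Sigma.ι (fun p : Σ i, (P i ⟶ M) => P p.1) ⟨i, f⟩

variable {P} in
lemma sumCoverι_desc {M N : 𝓒} (g : ∀ p : Σ i, (P i ⟶ M), P p.1 ⟶ N) {i : ι} (f : P i ⟶ M) :
    sumCoverι P f ≫ Sigma.desc g = g ⟨i, f⟩ :=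
  Sigma.ι_desc g _

variable {P} in
lemma sumCover_hom_ext {M N : 𝓒} {u v : (∐ fun p : Σ i, (P i ⟶ M) => P p.1) ⟶ N}
    (h : ∀ i (f : P i ⟶ M), sumCoverι P f ≫ u = sumCoverι P f ≫ v) : u = v :=
  Sigma.hom_ext _ _ fun p => h p.1 p.2

/-- The sum of the `P i`, over all the morphisms from `P i` to `M`. -/
abbrev sumCover : 𝓒 ⥤ 𝓒 where
  obj M := ∐ fun p : Σ i, (P i ⟶ M) => P p.1
  map {M N} f := Sigma.desc fun p => sumCoverι P (p.2 ≫ f)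
  map_id M := sumCover_hom_ext fun i f => by
    rw [sumCoverι_desc, Category.comp_id, Category.comp_id]
  map_comp {M N L} f g := sumCover_hom_ext fun i k => by
    rw [sumCoverι_desc, ← Category.assoc (sumCoverι P k), sumCoverι_desc, sumCoverι_desc,
      Category.assoc]

lemma sumCoverι_map {M N : 𝓒} {i : ι} (f : P i ⟶ M) (g : M ⟶ N) :
    sumCoverι P f ≫ (sumCover P).map g = sumCoverι P (f ≫ g) :=
  sumCoverι_desc _ f

/-- The morphism `sumCover P ⟶ 𝟭` whose components are the given morphisms. -/
abbrev sumCoverπ : sumCover P ⟶ 𝟭 𝓒 where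
  app M := Sigma.desc fun p => p.2
  naturality {M N} f := sumCover_hom_ext fun i k => by
    rw [← Category.assoc, sumCoverι_map, sumCoverι_desc, ← Category.assoc, sumCoverι_desc]
    rfl

lemma sumCoverι_π {M : 𝓒} {i : ι} (f : P i ⟶ M) : sumCoverι P f ≫ (sumCoverπ P).app M = f :=
  sumCoverι_desc _ f

variable [Abelian 𝓒]

/-- On a direct sum, θ is the direct sum of its components, and direct sums are exact. -/
lemma mono_app_sumCover [∀ J : Type, HasExactColimitsOfShape (Discrete J) 𝓒]
    (hP : ∀ i, Mono (θ.app (P i))) (M : 𝓒) : Mono (θ.app ((sumCover P).obj M)) := by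
  let α : Discrete.functor (fun p : Σ i, (P i ⟶ M) => P p.1) ⟶
      Discrete.functor (fun p : Σ i, (P i ⟶ M) => P p.1) :=
    Discrete.natTrans fun p => θ.app _
  have : ∀ j, Mono (α.app j) := fun j => hP j.as.1
  have : Mono α := NatTrans.mono_of_mono_app α
  have h : Mono (colim.map α) := inferInstance
  have e : θ.app ((sumCover P).obj M) = colim.map α := by
    refine colimit.hom_ext fun j => ?_
    refine (θ.naturality (colimit.ι (Discrete.functor fun p : Σ i, (P i ⟶ M) => P p.1) j)).trans ?_
    exact (colimit.ι_map α j).symm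
  rw [e]
  exact h

/-- The kernel of `sumCover P ⟶ sumCover P 0`, which unlike `sumCover P` preserves the zero
morphisms. -/
abbrev cover : 𝓒 ⥤ 𝓒 where
  obj M := kernel ((sumCover P).map (0 : M ⟶ 0))
  map {M N} f := kernel.map _ _ ((sumCover P).map f) (𝟙 _) (by
    rw [Category.comp_id, ← (sumCover P).map_comp, comp_zero])
  map_id M := by
    rw [← cancel_mono (kernel.ι _), kernel.lift_ι, (sumCover P).map_id, Category.comp_id,
      Category.id_comp]
  map_comp f g := by
    rw [← cancel_mono (kernel.ι _), kernel.lift_ι, Category.assoc, kernel.lift_ι,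
      kernel.lift_ι_assoc, (sumCover P).map_comp, Category.assoc]

/-- A zero morphism factors through 0, and `cover` is a kernel of the map induced by M ⟶ 0. This
property is what lets `cover` act termwise on complexes. -/
instance : (cover P).PreservesZeroMorphisms where
  map_zero M N := by
    have e : (0 : M ⟶ N) = (0 : M ⟶ 0) ≫ 0 := by simp
    refine (cancel_mono (kernel.ι ((sumCover P).map (0 : N ⟶ 0)))).1 ?_
    refine (kernel.lift_ι _ _ _).trans ?_
    rw [zero_comp, e, Functor.map_comp, kernel.condition_assoc, zero_comp]

/-- The morphism from `cover P` to the identity functor. -/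
abbrev coverπ : cover P ⟶ 𝟭 𝓒 where
  app M := kernel.ι _ ≫ (sumCoverπ P).app M
  naturality {M N} f := by
    change kernel.lift _ _ _ ≫ kernel.ι _ ≫ _ = (kernel.ι _ ≫ _) ≫ f
    rw [kernel.lift_ι_assoc, Category.assoc, Category.assoc, (sumCoverπ P).naturality]
    rfl

/-- The difference of the inclusions indexed by f and by 0 lies in the kernel defining `cover` and
maps to f - 0 = f, so every morphism from a generator factors through `cover`. -/
lemma epi_coverπ_app (hP : ∀ {M N : 𝓒} (g : M ⟶ N), (∀ i (f : P i ⟶ M), f ≫ g = 0) → g = 0)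
    (M : 𝓒) : Epi ((coverπ P).app M) := by
  refine Preadditive.epi_of_cancel_zero _ fun {N} (g : M ⟶ N) hg => hP g
    fun i (f : P i ⟶ M) => ?_
  let s : P i ⟶ (sumCover P).obj M := sumCoverι P f - sumCoverι P (0 : P i ⟶ M)
  have hs : s ≫ (sumCover P).map (0 : M ⟶ 0) = 0 := by
    rw [Preadditive.sub_comp, sumCoverι_map, sumCoverι_map, comp_zero, comp_zero, sub_self]
  have hs' : s ≫ (sumCoverπ P).app M = f := by
    refine (Preadditive.sub_comp _ _ _).trans ?_
    rw [sumCoverι_π, sumCoverι_π, sub_zero]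
  have e : f = kernel.lift _ s hs ≫ (coverπ P).app M := by
    refine hs'.symm.trans ?_
    exact (kernel.lift_ι_assoc _ s hs _).symm
  rw [e, Category.assoc, hg, comp_zero]

lemma mono_app_cover [∀ J : Type, HasExactColimitsOfShape (Discrete J) 𝓒]
    (hP : ∀ i, Mono (θ.app (P i))) (M : 𝓒) : Mono (θ.app ((cover P).obj M)) :=
  mono_app_of_mono θ (kernel.ι _) (mono_app_sumCover θ P hP M)

end TorsionFreeCover

/-! ### Left derived functors computed by functorial resolutions. -/

section FunctorialResolution

universe v₁ v₂ v₃ u₁ u₂ u₃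

variable {C : Type u₁} [Category.{v₁} C] {D : Type u₂} [Category.{v₂} D] {H : Type u₃}
  [Category.{v₃} H] (W : MorphismProperty C) (L : C ⥤ D) [L.IsLocalization W] (F : C ⥤ H)
  {ρ : C ⥤ C} (π : ρ ⟶ 𝟭 C)

/-- The functor induced by `ρ ⋙ F` on a localization, for a functorial resolution `ρ`. -/
abbrev resolutionDerived (hρ : W.IsInvertedBy (ρ ⋙ F)) : D ⥤ H := Localization.lift (ρ ⋙ F) hρ L

/-- The counit of the left derived functor given by a functorial resolution. -/
def resolutionCounit (hρ : W.IsInvertedBy (ρ ⋙ F)) : L ⋙ resolutionDerived W L F hρ ⟶ F :=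
  (Localization.fac (ρ ⋙ F) hρ L).hom ≫ Functor.whiskerRight π F ≫ F.leftUnitor.hom

lemma resolutionCounit_app (hρ : W.IsInvertedBy (ρ ⋙ F)) (X : C) :
    (resolutionCounit W L F π hρ).app X =
      (Localization.fac (ρ ⋙ F) hρ L).hom.app X ≫ F.map (π.app X) := by
  simp [resolutionCounit]

variable {W L F} in
/-- The universal property of the functor `resolutionDerived`. -/
lemma existsUnique_resolutionDerived (hπ : ∀ X, W (π.app X)) (hρ : W.IsInvertedBy (ρ ⋙ F))
    (h : ∀ X, IsIso (F.map (π.app (ρ.obj X)))) (G : D ⥤ H) (β : L ⋙ G ⟶ F) :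
    ∃! γ : G ⟶ resolutionDerived W L F hρ,
      Functor.whiskerLeft L γ ≫ resolutionCounit W L F π hρ = β := by
  have hL : ∀ X, IsIso (L.map (π.app X)) := fun X => Localization.inverts L W _ (hπ X)
  let φ := Localization.fac (ρ ⋙ F) hρ L
  have hα : ∀ X, IsIso ((resolutionCounit W L F π hρ).app (ρ.obj X)) := fun X => by
    rw [resolutionCounit_app]
    have := h X
    infer_instance
  -- `β` is evaluated at the resolution of `X` and carried back to `X` along the isomorphism `L.map
  -- (π.app X)`.
  let γ₀ : L ⋙ G ⟶ ρ ⋙ F :=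
    { app := fun X => inv (G.map (L.map (π.app X))) ≫ β.app (ρ.obj X)
      naturality := fun X X' f => by
        have h1 := β.naturality (ρ.map f)
        have h2 := congrArg (fun k => G.map (L.map k)) (π.naturality f)
        dsimp at h1 h2 ⊢
        simp only [Functor.map_comp] at h2
        rw [Category.assoc, ← h1, ← cancel_epi (G.map (L.map (π.app X))),
          IsIso.hom_inv_id_assoc, ← Category.assoc, ← h2, Category.assoc,
          IsIso.hom_inv_id_assoc] }
  have hγ₀ (X : C) : G.map (L.map (π.app X)) ≫ γ₀.app X = β.app (ρ.obj X) :=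
    IsIso.hom_inv_id_assoc _ _
  let γ : G ⟶ resolutionDerived W L F hρ := Localization.liftNatTrans L W (L ⋙ G)
    (L ⋙ resolutionDerived W L F hρ) G _ (γ₀ ≫ φ.inv)
  have hγ (X : C) : γ.app (L.obj X) = γ₀.app X ≫ φ.inv.app X :=
    (Localization.liftNatTrans_app ..).trans (by simp)
  have hγ' : Functor.whiskerLeft L γ ≫ resolutionCounit W L F π hρ = β := by
    ext X
    have h1 := β.naturality (π.app X)
    dsimp at h1
    change γ.app (L.obj X) ≫ _ = _
    rw [resolutionCounit_app, hγ, Category.assoc]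
    change _ ≫ φ.inv.app X ≫ φ.hom.app X ≫ _ = _
    rw [Iso.inv_hom_id_app_assoc, ← cancel_epi (G.map (L.map (π.app X))), h1, ← Category.assoc,
      hγ₀]
  refine ⟨γ, hγ', fun γ' hγ'' => Localization.natTrans_ext L W fun X => ?_⟩
  -- For uniqueness, naturality along `π` moves each component to `ρ.obj X`, where the counit is
  -- invertible.
  have key : ∀ γ₁ : G ⟶ resolutionDerived W L F hρ,
      Functor.whiskerLeft L γ₁ ≫ resolutionCounit W L F π hρ = β →
      γ₁.app (L.obj X) ≫ (resolutionDerived W L F hρ).map (inv (L.map (π.app X))) ≫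
        (resolutionCounit W L F π hρ).app (ρ.obj X) =
        inv (G.map (L.map (π.app X))) ≫ β.app (ρ.obj X) := by
    intro γ₁ h₁
    have e := congrArg (fun k => k.app (ρ.obj X)) h₁
    change γ₁.app (L.obj (ρ.obj X)) ≫ _ = _ at e
    rw [← e, ← Category.assoc, ← γ₁.naturality, Functor.map_inv, Category.assoc]
  have := (key γ' hγ'').trans (key γ hγ').symm
  rwa [cancel_mono] at this

/-- A functorial resolution by objects on which `F` is well-behaved computes the left derived
functor of `F`. -/
lemma isLeftDerivedFunctor_of_resolution (hπ : ∀ X, W (π.app X)) (hρ : W.IsInvertedBy (ρ ⋙ F))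
    (h : ∀ X, IsIso (F.map (π.app (ρ.obj X)))) :
    (resolutionDerived W L F hρ).IsLeftDerivedFunctor (resolutionCounit W L F π hρ) W := by
  have key := existsUnique_resolutionDerived (L := L) π hπ hρ h
  refine ⟨⟨⟨IsTerminal.ofUniqueHom
    (fun Y => CostructuredArrow.homMk (key Y.left Y.hom).choose (key Y.left Y.hom).choose_spec.1)
    fun Y m => ?_⟩⟩⟩
  exact CostructuredArrow.hom_ext _ _ ((key Y.left Y.hom).choose_spec.2 m.left
    (CostructuredArrow.w m))

end FunctorialResolution

/-! ### The mapping cone resolution, and the quotient complexes K / θK. -/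

section Resolution

open CochainComplex

universe v u

variable {𝓒 : Type u} [Category.{v} 𝓒] [Abelian 𝓒] (T : 𝓒 ⥤ 𝓒) [T.PreservesZeroMorphisms]
  (κ : T ⟶ 𝟭 𝓒)

/-- The morphism of complexes from `T K` to `K` given by a natural transformation `T ⟶ 𝟭`. -/
def coverComplexπ (K : CochainComplex 𝓒 ℤ) :
    (T.mapHomologicalComplex (ComplexShape.up ℤ)).obj K ⟶ K where
  f i := κ.app (K.X i)
  comm' i j _ := (κ.naturality (K.d i j)).symm

/-- The short exact sequence `0 ⟶ R ⟶ T K ⟶ K ⟶ 0` of complexes. -/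
abbrev resSeq (K : CochainComplex 𝓒 ℤ) : ShortComplex (CochainComplex 𝓒 ℤ) :=
  ShortComplex.mk (kernel.ι (coverComplexπ T κ K)) (coverComplexπ T κ K) (kernel.condition _)

lemma resSeq_shortExact (hκ : ∀ M, Epi (κ.app M)) (K : CochainComplex 𝓒 ℤ) :
    (resSeq T κ K).ShortExact where
  exact := ShortComplex.exact_kernel _
  mono_f := inferInstanceAs (Mono (kernel.ι _))
  epi_g := HomologicalComplex.epi_of_epi_f _ fun i => hκ (K.X i)

lemma coverComplexπ_naturality {K L : CochainComplex 𝓒 ℤ} (f : K ⟶ L) :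
    (T.mapHomologicalComplex (ComplexShape.up ℤ)).map f ≫ coverComplexπ T κ L =
      coverComplexπ T κ K ≫ f := by
  ext i
  exact κ.naturality (f.f i)

/-- The functoriality of `resSeq`. -/
abbrev resSeqMap {K L : CochainComplex 𝓒 ℤ} (f : K ⟶ L) : resSeq T κ K ⟶ resSeq T κ L where
  τ₁ := kernel.map _ _ ((T.mapHomologicalComplex (ComplexShape.up ℤ)).map f) f
    (coverComplexπ_naturality T κ f).symm
  τ₂ := (T.mapHomologicalComplex (ComplexShape.up ℤ)).map f
  τ₃ := f
  comm₁₂ := kernel.lift_ι _ _ _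
  comm₂₃ := coverComplexπ_naturality T κ f

lemma resSeqMap_id (K : CochainComplex 𝓒 ℤ) : resSeqMap T κ (𝟙 K) = 𝟙 _ := by
  ext : 1
  · rw [← cancel_mono (kernel.ι (coverComplexπ T κ K))]
    refine (kernel.lift_ι _ _ _).trans ?_
    rw [CategoryTheory.Functor.map_id, Category.comp_id]
    exact (Category.id_comp _).symm
  · exact (T.mapHomologicalComplex (ComplexShape.up ℤ)).map_id K
  · rfl

lemma resSeqMap_comp {K L N : CochainComplex 𝓒 ℤ} (f : K ⟶ L) (g : L ⟶ N) :
    resSeqMap T κ (f ≫ g) = resSeqMap T κ f ≫ resSeqMap T κ g := by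
  ext : 1
  · rw [← cancel_mono (kernel.ι (coverComplexπ T κ N))]
    refine (kernel.lift_ι _ _ _).trans ?_
    change _ = (kernel.lift _ _ _ ≫ kernel.lift _ _ _) ≫ _
    rw [Category.assoc, kernel.lift_ι, kernel.lift_ι_assoc, Functor.map_comp, Category.assoc]
  · exact (T.mapHomologicalComplex (ComplexShape.up ℤ)).map_comp f g
  · rfl

/-- The functorial resolution of complexes given by a natural epimorphism `T ⟶ 𝟭`: the mapping
cone of `R ⟶ T K`. -/
def resolution : CochainComplex 𝓒 ℤ ⥤ CochainComplex 𝓒 ℤ where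
  obj K := mappingCone (resSeq T κ K).f
  map f := mappingCone.map _ _ (resSeqMap T κ f).τ₁ (resSeqMap T κ f).τ₂
    (resSeqMap T κ f).comm₁₂.symm
  map_id K := by
    refine Eq.trans ?_ (mappingCone.map_id _)
    congr 1
    · exact congrArg ShortComplex.Hom.τ₁ (resSeqMap_id T κ K)
    · exact congrArg ShortComplex.Hom.τ₂ (resSeqMap_id T κ K)
  map_comp f g := by
    refine Eq.trans ?_ (mappingCone.map_comp _ _ _ _ _ _ _ _ _)
    congr 1
    · exact congrArg ShortComplex.Hom.τ₁ (resSeqMap_comp T κ f g)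
    · exact congrArg ShortComplex.Hom.τ₂ (resSeqMap_comp T κ f g)

/-- The morphism from the resolution of a complex to the complex. -/
def resolutionπ : resolution T κ ⟶ 𝟭 _ where
  app K := mappingCone.descShortComplex (resSeq T κ K)
  naturality _ _ f := mappingCone.map_descShortComplex _ _ (resSeqMap T κ f)

lemma quasiIso_resolutionπ (hκ : ∀ M, Epi (κ.app M)) (K : CochainComplex 𝓒 ℤ) :
    QuasiIso ((resolutionπ T κ).app K) :=
  mappingCone.quasiIso_descShortComplex (resSeq_shortExact T κ hκ K)

variable (θ : 𝟭 𝓒 ⟶ 𝟭 𝓒)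

/-- The terms of the complex have no `θ`-torsion. -/
def IsTorsionFree (K : CochainComplex 𝓒 ℤ) : Prop := ∀ n, Mono (θ.app (K.X n))

/-- In each degree the cone is a sum of a term of the kernel R and a term of T K. Since R is a
subcomplex of T K it inherits torsion-freeness, which is why two steps suffice. -/
lemma isTorsionFree_resolution (hT : ∀ M, Mono (θ.app (T.obj M))) (K : CochainComplex 𝓒 ℤ) :
    IsTorsionFree θ ((resolution T κ).obj K) := by
  intro n
  let φ := (resSeq T κ K).f
  have h₂ (i : ℤ) : Mono (θ.app ((resSeq T κ K).X₂.X i)) := hT (K.X i)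
  have h₁ (i : ℤ) : Mono (θ.app ((resSeq T κ K).X₁.X i)) := by
    have : Mono (φ.f i) := inferInstanceAs
      (Mono ((HomologicalComplex.eval 𝓒 (ComplexShape.up ℤ) i).map (kernel.ι (coverComplexπ T κ K))))
    exact mono_app_of_mono θ (φ.f i) (h₂ i)
  refine Preadditive.mono_of_cancel_zero _ fun {G} (g : G ⟶ (mappingCone φ).X n) hg => ?_
  have nat : ∀ {M : 𝓒} (p : (mappingCone φ).X n ⟶ M), (g ≫ p) ≫ θ.app M = 0 := by
    intro M p
    have h := θ.naturality p
    dsimp at h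
    have hg' : g ≫ θ.app ((mappingCone φ).X n) = 0 := hg
    rw [Category.assoc, h, ← Category.assoc, hg', zero_comp]
  refine mappingCone.ext_to φ n (n + 1) rfl ?_ ?_
  · have := h₁ (n + 1)
    exact (zero_of_comp_mono (θ.app ((resSeq T κ K).X₁.X (n + 1))) (nat _)).trans zero_comp.symm
  · have := h₂ n
    exact (zero_of_comp_mono (θ.app ((resSeq T κ K).X₂.X n)) (nat _)).trans zero_comp.symm

/-- The endomorphism `θ` of a complex. -/
def thetaMap (K : CochainComplex 𝓒 ℤ) : K ⟶ K where
  f i := θ.app (K.X i)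
  comm' i j _ := (θ.naturality (K.d i j)).symm

/-- The complex `K / θ K`. -/
abbrev cokernelComplex (K : CochainComplex 𝓒 ℤ) : CochainComplex 𝓒 ℤ :=
  ((cokernelFunctor θ).mapHomologicalComplex (ComplexShape.up ℤ)).obj K

/-- The projection `K ⟶ K / θ K`. -/
def toCokernelComplex (K : CochainComplex 𝓒 ℤ) : K ⟶ cokernelComplex θ K where
  f i := cokernel.π (θ.app (K.X i))
  comm' _ _ _ := cokernel.π_desc _ _ _

/-- The sequence `K ⟶ K ⟶ K / θ K`. -/
abbrev thetaSeq (K : CochainComplex 𝓒 ℤ) : ShortComplex (CochainComplex 𝓒 ℤ) :=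
  ShortComplex.mk (thetaMap θ K) (toCokernelComplex θ K) (by
    ext i
    exact cokernel.condition (θ.app (K.X i)))

lemma thetaSeq_shortExact {K : CochainComplex 𝓒 ℤ} (hK : IsTorsionFree θ K) :
    (thetaSeq θ K).ShortExact := by
  refine HomologicalComplex.shortExact_of_degreewise_shortExact _ fun i => ?_
  have := hK i
  exact { exact := ShortComplex.exact_cokernel (θ.app (K.X i))
          mono_f := hK i
          epi_g := inferInstanceAs (Epi (cokernel.π (θ.app (K.X i)))) }

/-- Without torsion, 0 → K → K → K/θK → 0 is exact, and the long exact homology sequences can be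
compared. -/
lemma quasiIso_cokernelFunctor {K L : CochainComplex 𝓒 ℤ} (hK : IsTorsionFree θ K)
    (hL : IsTorsionFree θ L) (f : K ⟶ L) (hf : QuasiIso f) :
    QuasiIso (((cokernelFunctor θ).mapHomologicalComplex (ComplexShape.up ℤ)).map f) := by
  let φ : thetaSeq θ K ⟶ thetaSeq θ L :=
    { τ₁ := f
      τ₂ := f
      τ₃ := ((cokernelFunctor θ).mapHomologicalComplex (ComplexShape.up ℤ)).map f
      comm₁₂ := by
        ext i
        exact θ.naturality (f.f i)
      comm₂₃ := by
        ext i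
        exact (cokernel.π_desc _ _ _).symm }
  exact HomologicalComplex.HomologySequence.quasiIso_τ₃ φ (thetaSeq_shortExact θ hK)
    (thetaSeq_shortExact θ hL) hf hf

lemma homologyMap_thetaMap (K : CochainComplex 𝓒 ℤ) (i : ℤ) :
    HomologicalComplex.homologyMap (thetaMap θ K) i = θ.app (K.homology i) := by
  have h1 : HomologicalComplex.cyclesMap (thetaMap θ K) i = θ.app (K.cycles i) := by
    rw [← cancel_mono (K.iCycles i), HomologicalComplex.cyclesMap_i]
    exact θ.naturality (K.iCycles i)
  rw [← cancel_epi (K.homologyπ i), HomologicalComplex.homologyπ_naturality, h1]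
  exact (θ.naturality (K.homologyπ i)).symm

/-- `θ` is an isomorphism on the homology where `K / θ K` is exact. -/
lemma isIso_theta_homology {K : CochainComplex 𝓒 ℤ} (hK : IsTorsionFree θ K) {i j : ℤ}
    (hij : i + 1 = j) (hi : (cokernelComplex θ K).ExactAt i)
    (hj : (cokernelComplex θ K).ExactAt j) : IsIso (θ.app (K.homology j)) := by
  have hS := thetaSeq_shortExact θ hK
  have h1 := hS.homology_exact₁ i j hij
  have h2 := hS.homology_exact₂ j
  have hm : Mono (HomologicalComplex.homologyMap (thetaMap θ K) j) :=
    h1.mono_g (hi.isZero_homology.eq_of_src _ _)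
  have he : Epi (HomologicalComplex.homologyMap (thetaMap θ K) j) :=
    h2.epi_f (hj.isZero_homology.eq_of_tgt _ _)
  rw [homologyMap_thetaMap] at hm he
  exact isIso_of_mono_of_epi _

end Resolution

/-! ### The left derived functor of M ↦ E(M / θM). -/

section Derived

variable {𝓒 𝓑 : Type 1} [Category.{0} 𝓒] [Abelian 𝓒] [Category.{0} 𝓑] [Abelian 𝓑]
  (T : 𝓒 ⥤ 𝓒) [T.PreservesZeroMorphisms] (κ : T ⟶ 𝟭 𝓒) (θ : 𝟭 𝓒 ⟶ 𝟭 𝓒)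
  (E : (annihilated θ).FullSubcategory ⥤ 𝓑) [E.Additive]
  [PreservesFiniteLimits E] [PreservesFiniteColimits E]

instance : PreservesFiniteLimits (annihilated θ).ι := preservesFiniteLimits_ι _
instance : PreservesFiniteColimits (annihilated θ).ι := preservesFiniteColimits_ι _

/-- The inclusion of the annihilated objects is exact and reflects isomorphisms, so
quasi-isomorphisms may be tested in 𝓒; the exact functor E preserves them. -/
lemma quasiIso_quotientFunctor_comp {K L : CochainComplex 𝓒 ℤ} (hK : IsTorsionFree θ K)
    (hL : IsTorsionFree θ L) (f : K ⟶ L) (hf : QuasiIso f) :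
    QuasiIso (((quotientFunctor θ ⋙ E).mapHomologicalComplex (ComplexShape.up ℤ)).map f) := by
  have h := quasiIso_cokernelFunctor θ hK hL f hf
  have h2 : QuasiIso (((annihilated θ).ι.mapHomologicalComplex (ComplexShape.up ℤ)).map
    (((quotientFunctor θ).mapHomologicalComplex (ComplexShape.up ℤ)).map f)) := h
  rw [HomologicalComplex.quasiIso_map_iff_of_preservesHomology] at h2
  have h3 : QuasiIso ((E.mapHomologicalComplex (ComplexShape.up ℤ)).map
    (((quotientFunctor θ).mapHomologicalComplex (ComplexShape.up ℤ)).map f)) := inferInstance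
  exact h3

lemma exactAt_cokernelComplex_iff [E.Faithful] (K : CochainComplex 𝓒 ℤ) (i : ℤ) :
    (((quotientFunctor θ ⋙ E).mapHomologicalComplex (ComplexShape.up ℤ)).obj K).ExactAt i ↔
      (cokernelComplex θ K).ExactAt i := by
  let S := (((quotientFunctor θ).mapHomologicalComplex (ComplexShape.up ℤ)).obj K).sc i
  have h1 : (S.map E).Exact ↔ S.Exact := S.exact_map_iff_of_faithful E
  have h2 : (S.map (annihilated θ).ι).Exact ↔ S.Exact := S.exact_map_iff_of_faithful _
  exact h1.trans h2.symm

variable [HasDerivedCategory.{w} 𝓑]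

lemma isInvertedBy_resolution_comp (hκ : ∀ M, Epi (κ.app M))
    (hT : ∀ M, Mono (θ.app (T.obj M))) :
    (HomologicalComplex.quasiIso 𝓒 (ComplexShape.up ℤ)).IsInvertedBy
      (resolution T κ ⋙ onComplexes (quotientFunctor θ ⋙ E)) := by
  intro K L f hf
  have hf' : QuasiIso f := hf
  have h1 : QuasiIso ((resolution T κ).map f) := by
    have := quasiIso_resolutionπ T κ hκ K
    have := quasiIso_resolutionπ T κ hκ L
    have e : (resolution T κ).map f ≫ (resolutionπ T κ).app L =
      (resolutionπ T κ).app K ≫ f := (resolutionπ T κ).naturality f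
    have : QuasiIso ((resolution T κ).map f ≫ (resolutionπ T κ).app L) := by
      rw [e]
      infer_instance
    exact quasiIso_of_comp_right _ ((resolutionπ T κ).app L)
  have h2 := quasiIso_quotientFunctor_comp θ E (isTorsionFree_resolution T κ θ hT K)
    (isTorsionFree_resolution T κ θ hT L) _ h1
  exact (DerivedCategory.isIso_Q_map_iff_quasiIso _ _).2 h2

lemma isIso_onComplexes_resolutionπ (hκ : ∀ M, Epi (κ.app M))
    (hT : ∀ M, Mono (θ.app (T.obj M))) (K : CochainComplex 𝓒 ℤ) :
    IsIso ((onComplexes (quotientFunctor θ ⋙ E)).map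
      ((resolutionπ T κ).app ((resolution T κ).obj K))) := by
  refine (DerivedCategory.isIso_Q_map_iff_quasiIso _ _).2 ?_
  exact quasiIso_quotientFunctor_comp θ E (isTorsionFree_resolution T κ θ hT _)
    (isTorsionFree_resolution T κ θ hT _) _ (quasiIso_resolutionπ T κ hκ _)

variable [HasDerivedCategory.{w} 𝓒]

lemma isLeftDerivedFunctor_resolution (hκ : ∀ M, Epi (κ.app M))
    (hT : ∀ M, Mono (θ.app (T.obj M))) :
    (resolutionDerived (HomologicalComplex.quasiIso 𝓒 (ComplexShape.up ℤ)) DerivedCategory.Q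
      (onComplexes (quotientFunctor θ ⋙ E))
      (isInvertedBy_resolution_comp T κ θ E hκ hT)).IsLeftDerivedFunctor
      (resolutionCounit _ _ _ (resolutionπ T κ) _)
        (HomologicalComplex.quasiIso 𝓒 (ComplexShape.up ℤ)) :=
  isLeftDerivedFunctor_of_resolution _ _ _ (resolutionπ T κ)
    (fun K => quasiIso_resolutionπ T κ hκ K) _ (isIso_onComplexes_resolutionπ T κ θ E hκ hT)

lemma hasLeftDerived_quotientFunctor_comp (hκ : ∀ M, Epi (κ.app M))
    (hT : ∀ M, Mono (θ.app (T.obj M))) : HasLeftDerived.{w} (quotientFunctor θ ⋙ E) := by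
  have := isLeftDerivedFunctor_resolution T κ θ E hκ hT
  exact Functor.HasLeftDerivedFunctor.mk' _ (resolutionCounit _ DerivedCategory.Q _
    (resolutionπ T κ) (isInvertedBy_resolution_comp T κ θ E hκ hT))

/-- The left derived functor of `M ↦ E (M / θ M)` is computed by the resolution. -/
lemma nonempty_leftDerived_iso (hκ : ∀ M, Epi (κ.app M))
    (hT : ∀ M, Mono (θ.app (T.obj M))) [HasLeftDerived.{w} (quotientFunctor θ ⋙ E)]
    (K : CochainComplex 𝓒 ℤ) :
    Nonempty ((leftDerived (quotientFunctor θ ⋙ E)).obj (DerivedCategory.Q.obj K) ≅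
      DerivedCategory.Q.obj (((quotientFunctor θ ⋙ E).mapHomologicalComplex
        (ComplexShape.up ℤ)).obj ((resolution T κ).obj K))) := by
  have := isLeftDerivedFunctor_resolution T κ θ E hκ hT
  let F := onComplexes (quotientFunctor θ ⋙ E)
  let W := HomologicalComplex.quasiIso 𝓒 (ComplexShape.up ℤ)
  let hρ : W.IsInvertedBy (resolution T κ ⋙ F) := isInvertedBy_resolution_comp T κ θ E hκ hT
  let e := Functor.leftDerivedNatIso (leftDerived (quotientFunctor θ ⋙ E)) _
    (F.totalLeftDerivedCounit DerivedCategory.Q W)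
    (resolutionCounit W DerivedCategory.Q F (resolutionπ T κ) hρ) W (Iso.refl _)
  exact ⟨e.app _ ≪≫ (Localization.fac (resolution T κ ⋙ F) hρ DerivedCategory.Q).app K⟩

/-- If the left derived functor of `M ↦ E (M / θ M)` is bounded at `K`, then `θ` is an isomorphism
on the cohomology of `K` in all degrees but finitely many. -/
lemma exists_isIso_theta_homology (hκ : ∀ M, Epi (κ.app M))
    (hT : ∀ M, Mono (θ.app (T.obj M))) [HasLeftDerived.{w} (quotientFunctor θ ⋙ E)]
    [E.Faithful] (K : CochainComplex 𝓒 ℤ)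
    (hK : IsBounded ((leftDerived (quotientFunctor θ ⋙ E)).obj (DerivedCategory.Q.obj K))) :
    ∃ p q : ℤ, ∀ i, (i < p ∨ q < i) → IsIso (θ.app (K.homology i)) := by
  obtain ⟨e⟩ := nonempty_leftDerived_iso T κ θ E hκ hT K
  obtain ⟨⟨p, hp⟩, ⟨q, hq⟩⟩ := ObjectProperty.prop_of_iso _ e hK
  have hp' := (DerivedCategory.isGE_Q_obj_iff _ p).1 hp
  have hq' := (DerivedCategory.isLE_Q_obj_iff _ q).1 hq
  let P := (resolution T κ).obj K
  have hex : ∀ i, (i < p ∨ q < i) → (cokernelComplex θ P).ExactAt i := by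
    intro i hi
    rw [← exactAt_cokernelComplex_iff θ E]
    rcases hi with hi | hi
    · exact CochainComplex.exactAt_of_isGE _ p i hi
    · exact CochainComplex.exactAt_of_isLE _ q i hi
  -- Invertibility of θ on the i-th homology needs exactness of the quotient complex in degrees i -
  -- 1 and i, whence the shift of the upper bound.
  refine ⟨p, q + 1, fun i hi => ?_⟩
  have h := isIso_theta_homology θ (isTorsionFree_resolution T κ θ hT K) (i := i - 1) (j := i)
    (by lia) (hex _ (by lia)) (hex _ (by lia))
  have := quasiIso_resolutionπ T κ hκ K
  let f : P.homology i ≅ K.homology i :=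
    asIso (HomologicalComplex.homologyMap ((resolutionπ T κ).app K) i)
  exact isIso_app_of_iso θ f h

end Derived

/-! ### Inverting θ by a sequential colimit. -/

section InvertTheta

universe v u

variable {𝓒 : Type u} [Category.{v} 𝓒] (θ : 𝟭 𝓒 ⟶ 𝟭 𝓒)

/-- The sequence `M ⟶ M ⟶ ⋯` whose transition morphisms are `θ`. -/
abbrev thetaDiagram : 𝓒 ⥤ ℕ ⥤ 𝓒 where
  obj M := Functor.ofSequence (X := fun _ => M) (fun _ => θ.app M)
  map {M N} f := NatTrans.ofSequence (F := Functor.ofSequence (X := fun _ => M) (fun _ => θ.app M))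
    (G := Functor.ofSequence (X := fun _ => N) (fun _ => θ.app N)) (fun _ => f) (fun n => by
      rw [Functor.ofSequence_map_homOfLE_succ, Functor.ofSequence_map_homOfLE_succ]
      exact (θ.naturality f).symm)

variable [HasColimitsOfShape ℕ 𝓒]

/-- The functor inverting `θ`: the colimit of `M ⟶ M ⟶ ⋯`. -/
abbrev invertTheta : 𝓒 ⥤ 𝓒 := thetaDiagram θ ⋙ colim

variable {θ} in
/-- The `n`-th inclusion of `M` in the colimit of `M ⟶ M ⟶ ⋯`. -/
def invertThetaι (M : 𝓒) (n : ℕ) : M ⟶ (invertTheta θ).obj M :=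
  colimit.ι ((thetaDiagram θ).obj M) n

lemma theta_invertThetaι (M : 𝓒) (n : ℕ) :
    θ.app M ≫ invertThetaι (θ := θ) M (n + 1) = invertThetaι M n := by
  have h := colimit.w ((thetaDiagram θ).obj M) (homOfLE (Nat.le_add_right n 1))
  rw [Functor.ofSequence_map_homOfLE_succ] at h
  exact h

variable {θ} in
lemma invertTheta_hom_ext {M N : 𝓒} {f g : (invertTheta θ).obj M ⟶ N}
    (h : ∀ n, invertThetaι M n ≫ f = invertThetaι M n ≫ g) : f = g :=
  colimit.hom_ext h

/-- The universal property of the colimit of `M ⟶ M ⟶ ⋯`. -/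
lemma exists_invertTheta_desc {M N : 𝓒} (f : ℕ → (M ⟶ N)) (hf : ∀ n, θ.app M ≫ f (n + 1) = f n) :
    ∃ g : (invertTheta θ).obj M ⟶ N, ∀ n, invertThetaι M n ≫ g = f n := by
  let c : Cocone ((thetaDiagram θ).obj M) := ⟨N,
    NatTrans.ofSequence (F := (thetaDiagram θ).obj M) (G := (Functor.const ℕ).obj N) f
      (fun n => by
        rw [Functor.ofSequence_map_homOfLE_succ]
        exact (hf n).trans (Category.comp_id _).symm)⟩
  exact ⟨colimit.desc _ c, fun n => colimit.ι_desc c n⟩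

/-- The morphism from `M` to the colimit of `M ⟶ M ⟶ ⋯`. -/
def toInvertTheta : 𝟭 𝓒 ⟶ invertTheta θ where
  app M := invertThetaι M 0
  naturality _ _ f := (colimit.ι_map ((thetaDiagram θ).map f) 0).symm

/-- The inverse is the shift of the sequence by one step. -/
lemma isIso_theta_invertTheta (M : 𝓒) : IsIso (θ.app ((invertTheta θ).obj M)) := by
  obtain ⟨s, hs⟩ := exists_invertTheta_desc θ (fun n => invertThetaι (θ := θ) M (n + 1))
    fun n => theta_invertThetaι θ M (n + 1)
  have nat (n : ℕ) : invertThetaι M n ≫ θ.app ((invertTheta θ).obj M) =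
      θ.app M ≫ invertThetaι M n := θ.naturality (invertThetaι M n)
  refine ⟨s, invertTheta_hom_ext fun n => ?_, invertTheta_hom_ext fun n => ?_⟩
  · rw [← Category.assoc, nat, Category.assoc, hs, theta_invertThetaι]
    exact (Category.comp_id _).symm
  · rw [← Category.assoc, hs, nat, theta_invertThetaι]
    exact (Category.comp_id _).symm

/-- The inverse is induced by θ^(-n) on the n-th copy of M. -/
lemma isIso_toInvertTheta (M : 𝓒) [IsIso (θ.app M)] : IsIso ((toInvertTheta θ).app M) := by
  let f (n : ℕ) : M ⟶ M := n.rec (𝟙 M) fun _ g => inv (θ.app M) ≫ g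
  have hf (n : ℕ) : θ.app M ≫ f (n + 1) = f n := IsIso.hom_inv_id_assoc _ _
  have hf' (n : ℕ) : f n ≫ invertThetaι (θ := θ) M 0 = invertThetaι M n := by
    induction n with
    | zero => exact Category.id_comp _
    | succ n ih =>
      rw [← cancel_epi (θ.app M), ← Category.assoc, hf, ih, theta_invertThetaι]
  obtain ⟨s, hs⟩ := exists_invertTheta_desc θ f hf
  refine ⟨s, hs 0, invertTheta_hom_ext fun n => ?_⟩
  rw [← Category.assoc, hs]
  exact (hf' n).trans (Category.comp_id _).symm

end InvertTheta

/-! ### Inverting θ is exact; application to complexes. -/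

section InvertThetaExact

universe v u

variable {𝓒 : Type u} [Category.{v} 𝓒] [Abelian 𝓒] (θ : 𝟭 𝓒 ⟶ 𝟭 𝓒) [HasColimitsOfShape ℕ 𝓒]

instance : PreservesFiniteLimits (thetaDiagram θ) :=
  preservesFiniteLimits_of_evaluation _ fun _ => inferInstanceAs (PreservesFiniteLimits (𝟭 𝓒))

instance : PreservesFiniteColimits (thetaDiagram θ) :=
  preservesFiniteColimits_of_evaluation _ fun _ => inferInstanceAs (PreservesFiniteColimits (𝟭 𝓒))

variable [HasExactColimitsOfShape ℕ 𝓒]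

instance : PreservesFiniteLimits (invertTheta θ) := by
  have : PreservesFiniteLimits (colim (J := ℕ) (C := 𝓒)) :=
    HasExactColimitsOfShape.preservesFiniteLimits
  exact comp_preservesFiniteLimits _ _

instance : PreservesFiniteColimits (invertTheta θ) := comp_preservesFiniteColimits _ _

/-- The complex obtained by inverting `θ`. -/
abbrev invertComplex (N : CochainComplex 𝓒 ℤ) : CochainComplex 𝓒 ℤ :=
  ((invertTheta θ).mapHomologicalComplex (ComplexShape.up ℤ)).obj N

/-- The morphism from a complex to the complex obtained by inverting `θ`. -/
def toInvertComplex (N : CochainComplex 𝓒 ℤ) : N ⟶ invertComplex θ N where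
  f i := (toInvertTheta θ).app (N.X i)
  comm' i j _ := ((toInvertTheta θ).naturality (N.d i j)).symm

/-- An exact functor commutes with homology, and inverting θ changes nothing on homology where θ is
already invertible. -/
lemma quasiIso_toInvertComplex {N : CochainComplex 𝓒 ℤ}
    (hN : ∀ i, IsIso (θ.app (N.homology i))) : QuasiIso (toInvertComplex θ N) where
  quasiIsoAt i := by
    rw [quasiIsoAt_iff_isIso_homologyMap]
    have h := (N.sc i).homologyMap_mapNatTrans (toInvertTheta θ)
    have := hN i
    have : IsIso ((toInvertTheta θ).app (N.sc i).homology) := isIso_toInvertTheta θ (N.homology i)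
    have h2 : IsIso (ShortComplex.homologyMap ((N.sc i).mapNatTrans (toInvertTheta θ))) := by
      rw [h]
      infer_instance
    exact h2

end InvertThetaExact

/-! ### Cycles, and morphisms out of a single object. -/

section Cycles

universe v u

variable {𝓒 : Type u} [Category.{v} 𝓒] [Abelian 𝓒]

/-- The inverse of θ commutes with the differentials and so preserves cycles. -/
lemma isIso_theta_cycles (θ : 𝟭 𝓒 ⟶ 𝟭 𝓒) {K : CochainComplex 𝓒 ℤ}
    (hK : ∀ i, IsIso (θ.app (K.X i))) (i : ℤ) :
    IsIso (θ.app (K.cycles i)) := by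
  have := hK i
  have nat : θ.app (K.cycles i) ≫ K.iCycles i = K.iCycles i ≫ θ.app (K.X i) :=
    (θ.naturality (K.iCycles i)).symm
  let g : K.cycles i ⟶ K.cycles i := K.liftCycles (K.iCycles i ≫ inv (θ.app (K.X i))) (i + 1)
    (by simp) (by
      have := hK (i + 1)
      have h := θ.naturality (K.d i (i + 1))
      dsimp at h
      have h' : inv (θ.app (K.X i)) ≫ K.d i (i + 1) =
          K.d i (i + 1) ≫ inv (θ.app (K.X (i + 1))) := by
        rw [IsIso.inv_comp_eq, ← Category.assoc, ← h, Category.assoc, IsIso.hom_inv_id,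
          Category.comp_id]
      dsimp at h'
      rw [Category.assoc, h', HomologicalComplex.iCycles_d_assoc, zero_comp])
  have hg : g ≫ K.iCycles i = K.iCycles i ≫ inv (θ.app (K.X i)) :=
    HomologicalComplex.liftCycles_i ..
  refine ⟨g, ?_, ?_⟩
  · refine (cancel_mono (K.iCycles i)).1 ?_
    refine (Category.assoc _ _ _).trans ?_
    rw [hg, ← Category.assoc, nat, Category.assoc, IsIso.hom_inv_id, Category.comp_id]
    exact (Category.id_comp _).symm
  · refine (cancel_mono (K.iCycles i)).1 ?_
    refine (Category.assoc _ _ _).trans ?_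
    rw [nat, ← Category.assoc, hg, Category.assoc, IsIso.inv_hom_id, Category.comp_id]
    exact (Category.id_comp _).symm

/-- A morphism from L to the cycles is a morphism of complexes from L placed in degree i; on
homology it is `u` followed by the projection. -/
lemma homologyMap_mkHomFromSingle_ne_zero {K : CochainComplex 𝓒 ℤ} {i : ℤ} {L : 𝓒}
    (u : L ⟶ K.cycles i) (hu : u ≫ K.homologyπ i ≠ 0) :
    HomologicalComplex.homologyMap (HomologicalComplex.mkHomFromSingle (c := ComplexShape.up ℤ)
      (u ≫ K.iCycles i) (fun k _ => by simp)) i ≠ 0 := by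
  intro h
  let s := HomologicalComplex.mkHomFromSingle (c := ComplexShape.up ℤ) (u ≫ K.iCycles i)
    (fun k _ => by simp)
  let w := (HomologicalComplex.singleObjCyclesSelfIso (ComplexShape.up ℤ) i L).inv
  have hw : w ≫ HomologicalComplex.cyclesMap s i = u := by
    rw [← cancel_mono (K.iCycles i), Category.assoc, HomologicalComplex.cyclesMap_i,
      HomologicalComplex.mkHomFromSingle_f]
    simp [w]
  refine hu ?_
  rw [← hw, Category.assoc, ← HomologicalComplex.homologyπ_naturality, h, comp_zero, comp_zero]

end Cycles

/-! ### Boundedness by truncation, detection and finite projective dimension. -/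

section Endgame

open DerivedCategory Pretriangulated

universe v u

variable {𝓒 : Type u} [Category.{v} 𝓒] [Abelian 𝓒] [HasDerivedCategory.{w} 𝓒]

lemma homologyMap_eq_zero_of_map_Q {K L : CochainComplex 𝓒 ℤ} (f : K ⟶ L) (i : ℤ)
    (h : (homologyFunctor 𝓒 i).map (Q.map f) = 0) : HomologicalComplex.homologyMap f i = 0 := by
  have hf := (homologyFunctorFactors 𝓒 i).hom.naturality f
  have : (Q ⋙ homologyFunctor 𝓒 i).map f = 0 := h
  rw [this, zero_comp] at hf
  exact (cancel_epi ((homologyFunctorFactors 𝓒 i).hom.app K)).1 (hf.symm.trans comp_zero.symm)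

lemma homologyFunctor_map_eq_zero_of_iso {X X' Y Y' : DerivedCategory 𝓒} (a : X' ≅ X) (f : X ⟶ Y)
    (b : Y ≅ Y') (i : ℤ) (h : (homologyFunctor 𝓒 i).map (a.hom ≫ f ≫ b.hom) = 0) :
    (homologyFunctor 𝓒 i).map f = 0 := by
  have hf : f = a.inv ≫ (a.hom ≫ f ≫ b.hom) ≫ b.inv := by simp
  rw [hf, (homologyFunctor 𝓒 i).map_comp, (homologyFunctor 𝓒 i).map_comp, h, zero_comp, comp_zero]

variable {ι : Type*} {Lc : ι → 𝓒}

lemma eq_zero_of_shift_eq_zero {X M : DerivedCategory 𝓒} (n : ℤ)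
    (h : ∀ v : X⟦n⟧ ⟶ M⟦n⟧, v = 0) (u : X ⟶ M) : u = 0 :=
  (shiftFunctor (DerivedCategory 𝓒) n).map_injective ((h _).trans (h _).symm)

lemma hom_single_eq_zero {X : 𝓒} {M : DerivedCategory 𝓒}
    (hM : ∀ (n : ℤ) (u : (singleFunctor 𝓒 0).obj X ⟶ M⟦n⟧), u = 0) (i : ℤ)
    (u : (singleFunctor 𝓒 i).obj X ⟶ M) : u = 0 := by
  refine eq_zero_of_shift_eq_zero i (fun v => ?_) u
  let e := ((singleFunctors 𝓒).shiftIso i 0 i (add_zero i)).app X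
  exact (cancel_epi e.inv).1 ((hM _ _).trans (hM _ _).symm)

lemma hom_single_single_eq_zero {X Y : 𝓒} {d : ℕ}
    (h : ∀ n : ℕ, d ≤ n → ∀ u : (singleFunctor 𝓒 0).obj X ⟶ ((singleFunctor 𝓒 0).obj Y)⟦(n : ℤ)⟧,
      u = 0) {i t : ℤ} (hi : t + d ≤ i)
    (u : (singleFunctor 𝓒 i).obj X ⟶ (singleFunctor 𝓒 t).obj Y) : u = 0 := by
  refine eq_zero_of_shift_eq_zero i (fun v => ?_) u
  obtain ⟨n, hn⟩ := Int.eq_ofNat_of_zero_le (show 0 ≤ i - t by lia)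
  let e := ((singleFunctors 𝓒).shiftIso i 0 i (add_zero i)).app X
  let e₁ := ((singleFunctors 𝓒).shiftIso i (t - i) t (by lia)).app Y
  let e₂ := ((singleFunctors 𝓒).shiftIso (n : ℤ) (t - i) 0 (by lia)).app Y
  have h0 : e.inv ≫ v ≫ e₁.hom ≫ e₂.inv = 0 := h n (by lia) _
  refine (cancel_epi e.inv).1 ((cancel_mono (e₁.hom ≫ e₂.inv)).1 ?_)
  rw [Category.assoc, h0, comp_zero, zero_comp]

/-- Dévissage on the amplitude: truncation triangles split off the top cohomology until Y is a
single shifted object, where the hypothesis on Ext applies. -/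
lemma hom_single_eq_zero_of_isGE_of_isLE {X : 𝓒} {d : ℕ}
    (h : ∀ (Y : 𝓒) (n : ℕ), d ≤ n →
      ∀ u : (singleFunctor 𝓒 0).obj X ⟶ ((singleFunctor 𝓒 0).obj Y)⟦(n : ℤ)⟧, u = 0)
    {i : ℤ} (m : ℕ) : ∀ (t : ℤ), t + d ≤ i → ∀ (Y : DerivedCategory 𝓒) [Y.IsGE (t - m)] [Y.IsLE t]
      (u : (singleFunctor 𝓒 i).obj X ⟶ Y), u = 0 := by
  induction m with
  | zero =>
    intro t ht Y _ _ u
    have : Y.IsGE t := by simpa using ‹Y.IsGE (t - (0 : ℕ))›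
    obtain ⟨Z, ⟨e⟩⟩ := exists_iso_singleFunctor_obj_of_isGE_of_isLE Y t
    rw [← cancel_mono e.hom, zero_comp]
    exact hom_single_single_eq_zero (h Z) ht _
  | succ m ih =>
    intro t ht Y _ _ u
    obtain ⟨A, B, hA, hB, f, g, δ, hT⟩ := TStructure.t.exists_triangle Y (t - 1) t (by lia)
    have hA : A.IsLE (t - 1) := ⟨hA⟩
    have hB : B.IsGE t := ⟨hB⟩
    have hB' : B.IsLE t := (isLE_iff _ _).2 fun k hk => by
      refine (HomologySequence.exact₃ _ hT k (k + 1)).isZero_of_both_zeros ?_ ?_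
      · exact (isZero_of_isLE Y t k hk).eq_of_src _ _
      · exact (isZero_of_isLE A (t - 1) (k + 1) (by lia)).eq_of_tgt _ _
    have hA' : A.IsGE (t - 1 - m) := (isGE_iff _ _).2 fun k hk => by
      refine (HomologySequence.exact₁ _ hT (k - 1) k).isZero_of_both_zeros ?_ ?_
      · exact (isZero_of_isGE B t (k - 1) (by lia)).eq_of_src _ _
      · exact (isZero_of_isGE Y (t - (m + 1 : ℕ)) k (by push_cast; lia)).eq_of_tgt _ _
    have : B.IsGE (t - m) := TStructure.t.isGE_of_ge B (t - m) t (by lia)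
    obtain ⟨v, hv⟩ := Triangle.coyoneda_exact₂ _ hT u (ih t ht B _)
    rw [hv, ih (t - 1) (by lia) A v]
    exact zero_comp

variable [HasColimitsOfShape ℕ 𝓒] [HasExactColimitsOfShape ℕ 𝓒] (θ : 𝟭 𝓒 ⟶ 𝟭 𝓒)

/-- If `θ` is invertible on the cohomology of `N`, a nonzero cohomology object of `N` is detected
by a morphism from one of the objects `Lc b`, as soon as these detect the nonzero morphisms from
objects on which `θ` is invertible. -/
lemma exists_single_hom_ne_zero
    (hloc : ∀ {Z H : 𝓒} (φ : Z ⟶ H), IsIso (θ.app Z) → φ ≠ 0 → ∃ b, ∃ u : Lc b ⟶ Z, u ≫ φ ≠ 0)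
    (N : DerivedCategory 𝓒) (hN : ∀ i, IsIso (θ.app ((homologyFunctor 𝓒 i).obj N))) (i : ℤ)
    (hi : ¬ IsZero ((homologyFunctor 𝓒 i).obj N)) :
    ∃ b, ∃ u : (singleFunctor 𝓒 i).obj (Lc b) ⟶ N, (homologyFunctor 𝓒 i).map u ≠ 0 := by
  let K := Q.objPreimage N
  let e : Q.obj K ≅ N := Q.objObjPreimageIso N
  let eH (j : ℤ) : K.homology j ≅ (homologyFunctor 𝓒 j).obj N :=
    ((homologyFunctorFactors 𝓒 j).app K).symm ≪≫ (homologyFunctor 𝓒 j).mapIso e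
  have hK (j : ℤ) : IsIso (θ.app (K.homology j)) := isIso_app_of_iso θ (eH j).symm (hN j)
  -- A morphism from `Lc b` to the homology need not come from the derived category, but one to the
  -- cycles does; hence the passage to a complex on whose cycles θ is invertible.
  have := quasiIso_toInvertComplex θ hK
  let K' := invertComplex θ K
  have hπ : K'.homologyπ i ≠ 0 := fun h0 => hi <| by
    have : IsZero (K'.homology i) := by
      rw [IsZero.iff_id_eq_zero, ← cancel_epi (K'.homologyπ i), h0, zero_comp, zero_comp]
    exact this.of_iso ((eH i).symm ≪≫
      asIso (HomologicalComplex.homologyMap (toInvertComplex θ K) i))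
  obtain ⟨b, u, hu⟩ := hloc (K'.homologyπ i)
    (isIso_theta_cycles θ (fun j => isIso_theta_invertTheta θ (K.X j)) i) hπ
  let s : (HomologicalComplex.single 𝓒 (ComplexShape.up ℤ) i).obj (Lc b) ⟶ K' :=
    HomologicalComplex.mkHomFromSingle (u ≫ K'.iCycles i) (fun k _ => by simp)
  let a : (singleFunctor 𝓒 i).obj (Lc b) ≅
      Q.obj ((HomologicalComplex.single 𝓒 (ComplexShape.up ℤ) i).obj (Lc b)) :=
    (singleFunctorIsoCompQ 𝓒 i).app (Lc b)
  refine ⟨b, a.hom ≫ Q.map s ≫ ((asIso (Q.map (toInvertComplex θ K))).symm ≪≫ e).hom,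
    fun h0 => ?_⟩
  exact homologyMap_mkHomFromSingle_ne_zero u hu (homologyMap_eq_zero_of_map_Q s i
    (homologyFunctor_map_eq_zero_of_iso a (Q.map s) _ i h0))

/-- An object `M` which is right orthogonal to all shifts of the objects `Lc b` is bounded as soon
as `θ` is invertible on its cohomology in high and low degrees. -/
theorem isBounded_of_isIso_theta
    (hloc : ∀ {Z H : 𝓒} (φ : Z ⟶ H), IsIso (θ.app Z) → φ ≠ 0 → ∃ b, ∃ u : Lc b ⟶ Z, u ≫ φ ≠ 0)
    {d : ℕ} (hext : ∀ (b : ι) (Y : 𝓒) (n : ℕ), d ≤ n →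
      ∀ u : (singleFunctor 𝓒 0).obj (Lc b) ⟶ ((singleFunctor 𝓒 0).obj Y)⟦(n : ℤ)⟧, u = 0)
    {M : DerivedCategory 𝓒}
    (hM : ∀ (b : ι) (n : ℤ) (u : (singleFunctor 𝓒 0).obj (Lc b) ⟶ M⟦n⟧), u = 0) {p q : ℤ}
    (hpq : ∀ i, (i < p ∨ q < i) → IsIso (θ.app ((homologyFunctor 𝓒 i).obj M))) :
    TStructure.t.bounded M := by
  have hθ0 {Z : 𝓒} (hZ : IsZero Z) : IsIso (θ.app Z) :=
    ⟨0, hZ.eq_of_src _ _, hZ.eq_of_src _ _⟩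
  -- With `A` the truncation of `M` below degree `p`, a detecting morphism to `A` dies in `M` by
  -- `hM`, although `f` is an isomorphism on homology below `p`.
  have hMp : M.IsGE p := by
    obtain ⟨A, B, hA, hB, f, g, δ, hT⟩ := TStructure.t.exists_triangle M (p - 1) p (by lia)
    have hA : A.IsLE (p - 1) := ⟨hA⟩
    have hB : B.IsGE p := ⟨hB⟩
    have hmono (i : ℤ) (hi : i < p) : Mono ((homologyFunctor 𝓒 i).map f) :=
      (HomologySequence.mono_homologyMap_mor₁_iff _ hT (i - 1) i).2
        ((isZero_of_isGE B p (i - 1) (by lia)).eq_of_src _ _)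
    have hepi (i : ℤ) (hi : i < p) : Epi ((homologyFunctor 𝓒 i).map f) :=
      (HomologySequence.epi_homologyMap_mor₁_iff _ hT i).2
        ((isZero_of_isGE B p i hi).eq_of_tgt _ _)
    have hiso (i : ℤ) (hi : i < p) : IsIso ((homologyFunctor 𝓒 i).map f) := by
      have := hmono i hi
      have := hepi i hi
      exact isIso_of_mono_of_epi _
    refine (isGE_iff _ _).2 fun i hi => ?_
    have := hiso i hi
    refine IsZero.of_iso ?_ (asIso ((homologyFunctor 𝓒 i).map f)).symm
    by_contra h0
    obtain ⟨b, u, hu⟩ := exists_single_hom_ne_zero θ hloc A (fun j => by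
      by_cases hj : j < p
      · have := hiso j hj
        exact isIso_app_of_iso θ (asIso ((homologyFunctor 𝓒 j).map f)).symm (hpq j (.inl hj))
      · exact hθ0 (isZero_of_isLE A (p - 1) j (by lia))) i h0
    refine hu ((cancel_mono ((homologyFunctor 𝓒 i).map f)).1 ?_)
    rw [← Functor.map_comp, hom_single_eq_zero (hM b) i (u ≫ f), Functor.map_zero, zero_comp]
  -- Beyond this bound i > q and i ≥ (q - 1) + d, where q - 1 bounds the degrees of `A⟦1⟧` from
  -- above.
  refine ⟨⟨p, hMp⟩, ⟨max (q + 1) (q + d), (isLE_iff _ _).2 fun i hi => ?_⟩⟩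
  obtain ⟨A, B, hA, hB, f, g, δ, hT⟩ := TStructure.t.exists_triangle M q (q + 1) rfl
  have hA : A.IsLE q := ⟨hA⟩
  have hB : B.IsGE (q + 1) := ⟨hB⟩
  have hiso (j : ℤ) (hj : q < j) : IsIso ((homologyFunctor 𝓒 j).map g) := by
    have : Mono ((homologyFunctor 𝓒 j).map g) :=
      (HomologySequence.mono_homologyMap_mor₂_iff _ hT j).2
        ((isZero_of_isLE A q j hj).eq_of_src _ _)
    have : Epi ((homologyFunctor 𝓒 j).map g) :=
      (HomologySequence.epi_homologyMap_mor₂_iff _ hT j (j + 1)).2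
        ((isZero_of_isLE A q (j + 1) (by lia)).eq_of_tgt _ _)
    exact isIso_of_mono_of_epi _
  have hA' : A.IsGE p := (isGE_iff _ _).2 fun k hk => by
    by_cases hkq : q < k
    · exact isZero_of_isLE A q k hkq
    · refine (HomologySequence.exact₁ _ hT (k - 1) k).isZero_of_both_zeros ?_ ?_
      · exact (isZero_of_isGE B (q + 1) (k - 1) (by lia)).eq_of_src _ _
      · exact (isZero_of_isGE M p k hk).eq_of_tgt _ _
  have := hiso i (by lia)
  refine IsZero.of_iso ?_ (asIso ((homologyFunctor 𝓒 i).map g))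
  by_contra h0
  obtain ⟨b, u, hu⟩ := exists_single_hom_ne_zero θ hloc B (fun j => by
    by_cases hj : q < j
    · have := hiso j hj
      exact isIso_app_of_iso θ (asIso ((homologyFunctor 𝓒 j).map g)) (hpq j (.inr hj))
    · exact hθ0 (isZero_of_isGE B (q + 1) j (by lia))) i h0
  -- This is the obstruction to lifting `u` to `M`. Its target is bounded because `M` is already
  -- bounded below, with amplitude at most `(q - p).toNat`.
  have hδ : u ≫ δ = 0 := by
    have : TStructure.t.IsLE (A⟦(1 : ℤ)⟧) (q - 1) := TStructure.t.isLE_shift A q 1 (q - 1)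
    have : TStructure.t.IsGE (A⟦(1 : ℤ)⟧) (p - 1) := TStructure.t.isGE_shift A p 1 (p - 1)
    have : TStructure.t.IsGE (A⟦(1 : ℤ)⟧) (q - 1 - (q - p).toNat) :=
      TStructure.t.isGE_of_ge _ _ (p - 1) (by lia)
    exact hom_single_eq_zero_of_isGE_of_isLE (hext b) (q - p).toNat (q - 1) (by lia) _ _
  obtain ⟨v, hv⟩ := Triangle.coyoneda_exact₃ _ hT u hδ
  refine hu ?_
  rw [hv, hom_single_eq_zero (hM b) i v]
  exact (congrArg _ zero_comp).trans ((homologyFunctor 𝓒 i).map_zero _ _)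

end Endgame

/-! ### Detection of morphisms by free and localized free modules. -/

section Detection

variable {C : Type} [SmallCategory C] {K : GrothendieckTopology C}
  {A : LocallyDiscrete Cᵒᵖ ⥤ᵖ Cat.{0, 0}} [LinearPrestack A]

/-- Every section is the image of the generator under some `freeDesc`, so the free modules generate
and `cover` applies to them. -/
lemma eq_zero_of_freeMod_comp {M N : AMod K A} (g : M ⟶ N)
    (h : ∀ (a : Tot A) (f : freeMod K a ⟶ M), f ≫ g = 0) : g = 0 :=
  hom_eq_zero_of_onSec g fun a s => by
    have h' := congrArg (fun u => onSec u a (freeGen K a)) (h a (freeDesc s))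
    rw [onSec_comp, onSec_freeDesc] at h'
    exact h'.trans (onSec_zero a _)

/-- The localized free modules detect the nonzero morphisms from modules on which `ħ` is
invertible. -/
lemma exists_locModule_hom_comp_ne_zero {Z H : AMod K A} (φ : Z ⟶ H)
    (hZ : IsIso ((hbarMap K A).app Z)) (hφ : φ ≠ 0) :
    ∃ (a : Tot A) (u : locModule K a ⟶ Z), u ≫ φ ≠ 0 := by
  by_contra! h
  refine hφ (hom_eq_zero_of_onSec φ fun a z => ?_)
  let g : Z ⟶ Z := inv ((hbarMap K A).app Z)
  have hg (t : Z.obj.obj.obj (op (op a))) : hbar • onSec g a t = t := by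
    rw [← onSec_hbarMap, ← onSec_comp]
    exact congrArg (fun u => onSec u a t) (IsIso.inv_hom_id ((hbarMap K A).app Z))
  -- This is the sequence ħ^(-n) z; the morphism it defines sends `locGen K a 0` to `z`.
  let s (n : ℕ) : Z.obj.obj.obj (op (op a)) := n.rec z fun _ t => onSec g a t
  have hs (n : ℕ) : hbar • s (n + 1) = s n := hg (s n)
  have h0 : onSec (locDesc s hs) a (locGen K a 0) = z := locDesc_locGen s hs 0
  have h1 := congrArg (fun u => onSec u a (locGen K a 0)) (h a (locDesc s hs))
  rw [onSec_comp, h0] at h1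
  exact h1.trans (onSec_zero a _)

end Detection

/-! ### Assembly for a DQ-algebroid. -/

section Main

variable {X : Scheme.{0}} (f : X ⟶ Spec (.of ℂ)) [Smooth f] [QuasiCompact f]
  {A : LocallyDiscrete X.Opensᵒᵖ ⥤ᵖ Cat.{0, 0}} [LinearPrestack A]

lemma exists_hom_locModule_eq_zero (hA : IsDQAlgebroid f A)
    [HasDerivedCategory.{w} (AMod (Opens.grothendieckTopology X) A)] :
    ∃ d : ℕ, ∀ (a : Tot A) (Y : AMod (Opens.grothendieckTopology X) A) (n : ℕ), d ≤ n →
      ∀ u : (DerivedCategory.singleFunctor _ 0).obj (locModule (Opens.grothendieckTopology X) a) ⟶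
        (shiftFunctor _ (n : ℤ)).obj ((DerivedCategory.singleFunctor _ 0).obj Y), u = 0 := by
  have : CompactSpace X := (quasiCompact_iff_compactSpace f).1 ‹_›
  have := noetherianSpace_of_finiteType f
  obtain ⟨δ, d, hδ, hd⟩ := exists_codimension f
  have : HasExt.{w} (AMod (Opens.grothendieckTopology X) A) := hasExt_of_hasDerivedCategory _
  -- Ext vanishes in degrees greater than d + 1, where d bounds the codimension of points.
  refine ⟨d + 2, fun a Y n hn u => ?_⟩
  have h := ext_locModule_eq_zero (fun a => mono_hbarMap_freeMod hA a) hδ hd Y a n (by lia)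
  have e := Abelian.Ext.homEquiv (X := locModule (Opens.grothendieckTopology X) a) (Y := Y) (n := n)
  exact e.symm.injective ((h _).trans (h _).symm)

/-- Both halves of the theorem are instances, with E the identity or the given equivalence. The
separate G lets `gr ⋙ 𝟭` be replaced by `gr`. -/
lemma hasLeftDerived_and_isBounded (hA : IsDQAlgebroid f A)
    [HasDerivedCategory.{w} (AMod (Opens.grothendieckTopology X) A)]
    {𝓑 : Type 1} [Category.{0} 𝓑] [Abelian 𝓑] [HasDerivedCategory.{w} 𝓑]
    (E : GrMod (Opens.grothendieckTopology X) A ⥤ 𝓑) [E.Additive] [PreservesFiniteLimits E]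
    [PreservesFiniteColimits E] [E.Faithful]
    (G : AMod (Opens.grothendieckTopology X) A ⥤ 𝓑) [G.Additive]
    (hG : gr (Opens.grothendieckTopology X) A ⋙ E = G) :
    ∃ _ : HasLeftDerived G, ∀ M : DerivedCategory (AMod (Opens.grothendieckTopology X) A),
      IsCohomologicallyComplete M → IsBounded ((leftDerived G).obj M) → IsBounded M := by
  subst hG
  let P : Tot A → AMod (Opens.grothendieckTopology X) A := freeMod (Opens.grothendieckTopology X)
  have hκ := epi_coverπ_app P eq_zero_of_freeMod_comp
  have hT := mono_app_cover (hbarMap _ A) P fun a => mono_hbarMap_freeMod hA a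
  have hE := hasLeftDerived_quotientFunctor_comp (cover P) (coverπ P) (hbarMap _ A) E hκ hT
  refine ⟨hE, fun M hM hb => ?_⟩
  let K := DerivedCategory.Q.objPreimage M
  let i : DerivedCategory.Q.obj K ≅ M := DerivedCategory.Q.objObjPreimageIso M
  obtain ⟨p, q, hpq⟩ := exists_isIso_theta_homology (cover P) (coverπ P) (hbarMap _ A) E hκ hT K
    (ObjectProperty.prop_of_iso _ ((leftDerived (gr _ A ⋙ E)).mapIso i).symm hb)
  obtain ⟨d, hd⟩ := exists_hom_locModule_eq_zero.{w} f hA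
  refine isBounded_of_isIso_theta (hbarMap _ A) (fun φ => exists_locModule_hom_comp_ne_zero φ)
    hd hM (p := p) (q := q) fun j hj => isIso_app_of_iso (hbarMap _ A) ?_ (hpq j hj)
  exact ((DerivedCategory.homologyFunctorFactors _ j).app K).symm ≪≫
    (DerivedCategory.homologyFunctor _ j).mapIso i

end Main

end DQ

end

theorem proposition3p11 {X : Scheme.{0}} (f : X ⟶ Spec (.of ℂ))
    [Smooth f] [IsSeparated f] [QuasiCompact f]
    (A : LocallyDiscrete X.Opensᵒᵖ ⥤ᵖ Cat.{0, 0}) [DQ.LinearPrestack A]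
    (hA : DQ.IsDQAlgebroid f A)
    [HasDerivedCategory.{w} (DQ.AMod (Opens.grothendieckTopology X) A)]
    [HasDerivedCategory.{w} (DQ.GrMod (Opens.grothendieckTopology X) A)]
    [HasDerivedCategory.{w} X.Modules] :
    (∃ _ : DQ.HasLeftDerived (DQ.gr (Opens.grothendieckTopology X) A),
      ∀ M : DerivedCategory (DQ.AMod (Opens.grothendieckTopology X) A),
        DQ.IsCohomologicallyComplete M →
        DQ.IsBounded ((DQ.leftDerived (DQ.gr (Opens.grothendieckTopology X) A)).obj M) →
        DQ.IsBounded M) ∧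
    ∀ (e : DQ.GrMod (Opens.grothendieckTopology X) A ≌ X.Modules) [e.functor.Additive],
      ∃ _ : DQ.HasLeftDerived (DQ.gr (Opens.grothendieckTopology X) A ⋙ e.functor),
        ∀ M : DerivedCategory (DQ.AMod (Opens.grothendieckTopology X) A),
          DQ.IsCohomologicallyComplete M →
          DQ.IsBounded ((DQ.leftDerived
            (DQ.gr (Opens.grothendieckTopology X) A ⋙ e.functor)).obj M) →
          DQ.IsBounded M :=
  ⟨DQ.hasLeftDerived_and_isBounded f hA (𝟭 _) _ (Functor.comp_id _),
    fun e _ => DQ.hasLeftDerived_and_isBounded f hA e.functor _ rfl⟩
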